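/- \textbf{Setting.} Let $\Theta$ be a measurable space of types with a probability measure $\lambda$, let $\rho>0$, and let $\nu$ be a probability distribution on $(0,\infty)$ with mean $1/\rho$ (the lifespan distribution). A \emph{system process} runs in doubly infinite continuous time. It records the state $\omega_t\in\{W,B\}$ of a machine (working or broken; paths are piecewise constant and right-continuous), the strictly increasing, locally finite sequence of arrival times of agents (unbounded in both directions of time), and for each agent a type in $\Theta$ and an action: use the machine, contribute, or neither. A contribution makes the machine work, and a broken machine starts to work only through a contribution. An agent who arrives at time $t$ encounters the state $\omega_{t-}$. The process is \emph{stationary} if its law is invariant under time shifts. It is \emph{admissible} if (1) conditionally on the history of the process before time $0$, the arrivals from time $0$ on form a Poisson process of rate $1$, and their types are i.i.d. with law $\lambda$, independent of the arrival times; (2) almost surely every working machine eventually breaks, and, conditionally on the event that the machine is fixed infinitely often after time $0$ (if this event has positive probability), the lifespans $L_1,L_2,\dots$ that start at these repairs are i.i.d. with law $\nu$; (3) almost surely agents use the machine only if they encounter it working, and contribute only if they encounter it broken. A triple $(R,P,Q)$, with $R,P:\Theta\to[0,1]$ measurable and $Q\in[0,1]$, is a \emph{reduced form} of a stationary process if $Q=\Pr(\omega_t=W)$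 for all $t$ and, for every measurable $B\subseteq\Theta$, the expected number per unit of time of agents who have a type in $B$ and use the machine (respectively contribute) is $\int_B R\,\mathrm d\lambda$ (respectively $\int_B P\,\mathrm d\lambda$). As agents arrive at rate $1$, this is the probability that an arriving agent has a type in $B$ and uses the machine (respectively contributes). The \emph{balance condition} is $\rho\, Q=\int P\,\mathrm d\lambda$, and the \emph{simplex bounds} at $\theta$ are $R(\theta)\le Q$ and $P(\theta)\le 1-Q$. A \emph{Markovian mechanism} is a measurable function $\sigma:\Theta\times\{W,B\}\to[0,1]$. A process is \emph{compatible} with $\sigma$ if there are i.i.d. uniform randomizations on $[0,1]$, one for each agent who arrives from time $0$ on, independent of the arrival times and types of these agents and, jointly with them, of the history before time $0$, such that almost surely an agent of type $\theta$ who encounters a working machine uses it exactly when his randomization is below $\sigma(\theta,W)$, and one who encounters a broken machine contributes exactly when it is below $\sigma(\theta,B)$. \textbf{Proposition.} 1. Every stationary admissible process has a reduced form $(R,P,Q)$ that satisfies the balance condition and the simplex bounds for all $\theta\in\Theta$. Moreover, each of its reduced forms satisfies the balance condition, and the simplex bounds for $\lambda$-almost every $\theta$. 2. Let $R,P:\Theta\to[0,1]$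 be measurable and $Q\in[0,1]$, and suppose that $(R,P,Q)$ satisfies the balance condition and the simplex bounds for all $\theta\in\Theta$. Then there is a Markovian mechanism $\sigma$ that induces $(R,P,Q)$: there exists a stationary admissible process that is compatible with $\sigma$ and has the reduced form $(R,P,Q)$, and every stationary admissible process that is compatible with $\sigma$ has the reduced form $(R,P,Q)$. -/

import Mathlib

open MeasureTheory ProbabilityTheory Set Filter Topology

universe u v

noncomputable section

namespace Upkeep

/-- The two possible states of the machine. -/
inductive MachineState : Type
  | working
  | broken

/-- What an arriving agent does: use the machine, contribute to fixing it, or neither. -/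
inductive Action : Type
  | usage
  | contribution
  | abstention

instance : MeasurableSpace MachineState := ⊤

instance : MeasurableSpace Action := ⊤

instance : DiscreteMeasurableSpace MachineState := ⟨fun _ => trivial⟩

instance : DiscreteMeasurableSpace Action := ⟨fun _ => trivial⟩

/-- A system process in doubly infinite continuous time: the state of the machine at every time,
and the arrival times, the types and the actions of the agents. Arrivals are enumerated by `ℤ` in
increasing order so that agent `1` is the first one to arrive at or after time `0`.
Paths of the state are piecewise constant and right-continuous. A contribution fixes the machine,
and nothing else does. -/
structure SystemProcess (Ω : Type*) [MeasurableSpace Ω] (Θ : Type*) [MeasurableSpace Θ] where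
  state : ℝ → Ω → MachineState
  arrival : ℤ → Ω → ℝ
  agentType : ℤ → Ω → Θ
  action : ℤ → Ω → Action
  measurable_state : ∀ t, Measurable (state t)
  measurable_arrival : ∀ n, Measurable (arrival n)
  measurable_agentType : ∀ n, Measurable (agentType n)
  measurable_action : ∀ n, Measurable (action n)
  arrival_strictMono : ∀ ω, StrictMono fun n => arrival n ω
  arrival_zero_neg : ∀ ω, arrival 0 ω < 0
  arrival_one_nonneg : ∀ ω, 0 ≤ arrival 1 ω
  arrival_tendsto_atTop : ∀ ω, Tendsto (fun n => arrival n ω) atTop atTop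
  arrival_tendsto_atBot : ∀ ω, Tendsto (fun n => arrival n ω) atBot atBot
  state_rightCont : ∀ ω t, ∀ᶠ s in 𝓝[>] t, state s ω = state t ω
  state_leftLim : ∀ ω t, ∃ m, ∀ᶠ s in 𝓝[<] t, state s ω = m
  working_of_contribution : ∀ ω n, action n ω = Action.contribution →
    state (arrival n ω) ω = MachineState.working
  contribution_of_fixed : ∀ ω t, (∀ᶠ s in 𝓝[<] t, state s ω = MachineState.broken) →
    state t ω = MachineState.working → ∃ n, arrival n ω = t ∧ action n ω = Action.contribution

namespace SystemProcess

variable {Ω : Type*} [MeasurableSpace Ω] {Θ : Type*} [MeasurableSpace Θ]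

/-- The state of the machine just before time `t` (the left limit) is `m`. This is the state that
an agent arriving at time `t` encounters. -/
def StateBefore (X : SystemProcess Ω Θ) (ω : Ω) (t : ℝ) (m : MachineState) : Prop :=
  ∀ᶠ s in 𝓝[<] t, X.state s ω = m

/-- The marked point process of arrivals as seen from time `s`: the counting measure of the
triples (arrival time minus `s`, type, action). -/
def arrivalsFrom (X : SystemProcess Ω Θ) (s : ℝ) (ω : Ω) : Measure (ℝ × Θ × Action) :=
  Measure.sum fun n : ℤ => Measure.dirac (X.arrival n ω - s, X.agentType n ω, X.action n ω)

/-- The whole path of the system as seen from time `s`. -/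
def pathFrom (X : SystemProcess Ω Θ) (s : ℝ) (ω : Ω) :
    (ℝ → MachineState) × Measure (ℝ × Θ × Action) :=
  (fun t => X.state (s + t) ω, X.arrivalsFrom s ω)

/-- The law of the system process is invariant under time shifts. -/
def IsStationary (X : SystemProcess Ω Θ) (μ : Measure Ω) : Prop :=
  ∀ s : ℝ, μ.map (X.pathFrom s) = μ.map (X.pathFrom 0)

/-- The history of the system process before time `0`: states at negative times, and
arrival times, types and actions of the agents who arrive at negative times. -/
abbrev history (X : SystemProcess Ω Θ) : MeasurableSpace Ω :=
  (⨆ t : Set.Iio (0 : ℝ), MeasurableSpace.comap (X.state t) inferInstance) ⊔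
    ⨆ n : Set.Iic (0 : ℤ), MeasurableSpace.comap
      (fun ω => (X.arrival n ω, X.agentType n ω, X.action n ω)) inferInstance

/-- The waiting times after time `0`: until the first arrival, and then between
consecutive arrivals. -/
def waitingTime (X : SystemProcess Ω Θ) : ℕ → Ω → ℝ
  | 0, ω => X.arrival 1 ω
  | n + 1, ω => X.arrival (n + 2) ω - X.arrival (n + 1) ω

/-- Waiting times and types of the agents who arrive at nonnegative times. -/
def futureArrivals (X : SystemProcess Ω Θ) (ω : Ω) : ℕ → ℝ × Θ :=
  fun n => (X.waitingTime n ω, X.agentType (n + 1) ω)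

/-- `X.Fixes ω n`: the `n`-th agent (counted from `0`) who arrives at a nonnegative time
contributes and so fixes the machine. -/
def Fixes (X : SystemProcess Ω Θ) (ω : Ω) (n : ℕ) : Prop :=
  X.action (n + 1) ω = Action.contribution

/-- The lifespan of the machine that starts when it is fixed for the `i`-th time (counted from `0`)
after time `0`. -/
def lifespan (X : SystemProcess Ω Θ) (i : ℕ) (ω : Ω) : ℝ :=
  sInf {s : ℝ | 0 < s ∧
    X.state (X.arrival (Nat.nth (X.Fixes ω) i + 1) ω + s) ω = MachineState.broken}

/-- Admissibility for the type distribution `lam` and the lifespan distribution `ν`.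

* Conditionally on the history before time `0`, arrivals after time `0` form a Poisson process with
  rate `1` (independent exponential waiting times), and types are i.i.d. with distribution `lam`.
* A working machine breaks eventually, and the lifespans that start after time `0` are i.i.d. with
  distribution `ν`. The machine may stay broken forever, so that there are no lifespans; hence the
  condition is conditional on the event that the infinite sequence of lifespans exists (under
  stationarity the number of repairs after time `0` is almost surely zero or infinite).
* Agents use the machine only when they find it working, and contribute only when they find it
  broken. -/
structure IsAdmissible (X : SystemProcess Ω Θ) (μ : Measure Ω) (lam : Measure Θ) (ν : Measure ℝ) :
    Prop where
  arrivals_law : HasLaw X.futureArrivals (Measure.infinitePi fun _ : ℕ => (expMeasure 1).prod lam) μ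
  arrivals_indep : Indep X.history (MeasurableSpace.comap X.futureArrivals inferInstance) μ
  breaks : ∀ᵐ ω ∂μ, ∀ t, X.state t ω = MachineState.working →
    ∃ s, t < s ∧ X.state s ω = MachineState.broken
  lifespans_law : μ {ω | {n | X.Fixes ω n}.Infinite} ≠ 0 →
    HasLaw (fun ω i => X.lifespan i ω) (Measure.infinitePi fun _ : ℕ => ν)
      (cond μ {ω | {n | X.Fixes ω n}.Infinite})
  usage_working : ∀ᵐ ω ∂μ, ∀ n, X.action n ω = Action.usage →
    X.StateBefore ω (X.arrival n ω) MachineState.working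
  contribution_broken : ∀ᵐ ω ∂μ, ∀ n, X.action n ω = Action.contribution →
    X.StateBefore ω (X.arrival n ω) MachineState.broken

/-- The expected number of agents arriving during `[0, T)` who have a type in `B` and choose the
action `a`. -/
def expectedCount (X : SystemProcess Ω Θ) (μ : Measure Ω) (T : ℝ) (B : Set Θ) (a : Action) :
    ENNReal :=
  ∫⁻ ω, X.arrivalsFrom 0 ω (Set.Ico 0 T ×ˢ B ×ˢ {a}) ∂μ

/-- `(R, P, Q)` is the reduced form of the stationary process `X`: `Q` is the probability that the
machine is working at any given time, and `R` (resp. `P`) is the density with respect to `lam`,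
over types, of the frequency of usage (resp. contribution): the expected number per unit of
time of agents who have a type in `B` and use the machine is `∫_B R`. As agents arrive at
rate `1`, this is the probability that an arriving agent has a type in `B` and uses it. -/
structure IsReducedForm (X : SystemProcess Ω Θ) (μ : Measure Ω) (lam : Measure Θ)
    (R P : Θ → ℝ) (Q : ℝ) : Prop where
  measurable_usage : Measurable R
  measurable_contribution : Measurable P
  usage_mem : ∀ θ, R θ ∈ Set.Icc (0 : ℝ) 1
  contribution_mem : ∀ θ, P θ ∈ Set.Icc (0 : ℝ) 1
  uptime : ∀ t, μ.real {ω | X.state t ω = MachineState.working} = Q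
  usage_freq : ∀ T : ℝ, 0 < T → ∀ B : Set Θ, MeasurableSet B →
    X.expectedCount μ T B Action.usage = ENNReal.ofReal (T * ∫ θ in B, R θ ∂lam)
  contribution_freq : ∀ T : ℝ, 0 < T → ∀ B : Set Θ, MeasurableSet B →
    X.expectedCount μ T B Action.contribution = ENNReal.ofReal (T * ∫ θ in B, P θ ∂lam)

end SystemProcess

/-- A Markovian mechanism: an agent of type `θ` is directed to use a working machine with
probability `prob (θ, working)`, and to fix a broken machine with probability
`prob (θ, broken)`. -/
structure MarkovianMechanism (Θ : Type*) [MeasurableSpace Θ] where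
  prob : Θ × MachineState → ℝ
  measurable_prob : Measurable prob
  prob_mem : ∀ x, prob x ∈ Set.Icc (0 : ℝ) 1

/-- The process `X` is compatible with the Markovian mechanism `σ`: there are independent uniform
randomizations `U`, one for each agent arriving after time `0`, which are independent of
the arrival times, the types and the history before time `0`, such that an agent who finds the
machine working (resp. broken) uses (resp. fixes) it exactly when his randomization falls below the
probability prescribed by `σ` for his type and the current state. (For a stationary process, this
determines the law of the actions at all times.) -/
def MarkovianMechanism.IsCompatible {Ω : Type*} [MeasurableSpace Ω] {Θ : Type*} [MeasurableSpace Θ]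
    (σ : MarkovianMechanism Θ) (X : SystemProcess Ω Θ) (μ : Measure Ω) (lam : Measure Θ) : Prop :=
  ∃ U : ℕ → Ω → ℝ,
    HasLaw (fun ω n => (X.futureArrivals ω n, U n ω)) (Measure.infinitePi fun _ : ℕ =>
      ((expMeasure 1).prod lam).prod (volume.restrict (Set.Icc (0 : ℝ) 1))) μ ∧
    Indep X.history
      (MeasurableSpace.comap (fun ω n => (X.futureArrivals ω n, U n ω)) inferInstance) μ ∧
    ∀ᵐ ω ∂μ, ∀ n : ℕ,
      (X.StateBefore ω (X.arrival (n + 1) ω) MachineState.working →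
        (X.action (n + 1) ω = Action.usage ↔
          U n ω < σ.prob (X.agentType (n + 1) ω, MachineState.working))) ∧
      (X.StateBefore ω (X.arrival (n + 1) ω) MachineState.broken →
        (X.action (n + 1) ω = Action.contribution ↔
          U n ω < σ.prob (X.agentType (n + 1) ω, MachineState.broken)))

/-- The balance condition. -/
def Balance {Θ : Type*} [MeasurableSpace Θ] (lam : Measure Θ) (ρ : ℝ) (P : Θ → ℝ) (Q : ℝ) : Prop :=
  ρ * Q = ∫ θ, P θ ∂lam

/-- The simplex bounds at the type `θ`. -/
def SimplexBounds {Θ : Type*} (R P : Θ → ℝ) (Q : ℝ) (θ : Θ) : Prop :=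
  R θ ≤ Q ∧ P θ ≤ 1 - Q

end Upkeep

end

/-! Necessity of the bounds. Erlang densities add up to 1 on the half-line, so the mean number of
agents who arrive in `[0, h)` with a type in `B`, on an event `H` of the history, is `μ H * h * lam
B` (`campbell_history`). Cut a unit of time into `N` intervals. Stationarity moves each of them to
`[0, 1/N)`, where the state at time `-1/N` belongs to the history; as `N` grows, the state at the
preceding grid point becomes the state that the agent encounters (`tendsto_campbell_first`). Hence
users with types in `B` have frequency at most `Pr(W) * lam B`, and contributors at most `Pr(B) *
lam B` (`freq_le_of_stateBefore`). Radon-Nikodym densities of these frequencies satisfy the simplex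
bounds. If actions follow a Markovian mechanism, the randomization becomes part of the mark, and the
inequality turns into an equality (`freq_eq_of_randomization`).

Necessity of balance. Up to boundary effects, the uptime in `[0, n)` is the sum of the lifespans
that start there. By the strong law, repairs per unit of time minus `ρ` times the fraction of uptime
tends to 0 almost surely (`tendsto_fixCount_sub_workTime`). The sequence is uniformly integrable,
and stationarity makes its mean independent of `n`; so this mean is 0 (`IsStationary.balance`).

Sufficiency. Working machines are used with probability `R / Q`, and broken ones are fixed with
probability `P / (1 - Q)`. If a compatible process has uptime `q`, its balance condition reads `ρ q
= (1 - q) ρ Q / (1 - Q)`, so that `q = Q`, and its frequencies are then `R` and `P`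
(`isReducedForm_of_isCompatible`).

Existence of a compatible process. Every agent carries a type, a randomization and a potential
lifespan, all i.i.d. along a two-sided Poisson process. An agent regenerates the system if the
potential lives of all earlier agents have ended by his arrival: he finds the machine broken
whatever happened before. As lifespans have a finite mean, Borel-Cantelli, Poincaré recurrence and
Kolmogorov's zero-one law yield regenerations arbitrarily far in the past (`ae_exists_regenerates`).
The state is computed recursively from any of them, and the choice does not matter
(`lastEnd_lt_iff`). The time since the last arrival and the time until the next one are independent
exponentials. This description displays the independence of past and future; the equivalent Palm
description, a uniform position in a length-biased gap, displays stationarity (`ofAge_eq_ofGaps`,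
`lintegral_palmMap`, `lintegral_Ioc_shift_eq`). Realized lifespans are potential ones selected by a
nonanticipating rule, hence i.i.d. (`hasLaw_nth`). -/

set_option linter.unusedSectionVars false

/-! ### Erlang laws and mean counts of a marked Poisson process -/

namespace Upkeep

open scoped ENNReal NNReal

/-- The density of the sum of `n + 1` independent standard exponential variables. -/
noncomputable def erlangPDF (n : ℕ) (x : ℝ) : ℝ≥0∞ :=
  (Ici (0 : ℝ)).indicator (fun x => ENNReal.ofReal (x ^ n / n.factorial * Real.exp (-x))) x

lemma measurable_erlangPDF (n : ℕ) : Measurable (erlangPDF n) := by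
  unfold erlangPDF
  exact Measurable.indicator (by fun_prop) measurableSet_Ici

lemma expMeasure_one_eq : expMeasure 1 = volume.withDensity (erlangPDF 0) := by
  have : gammaPDF 1 1 = erlangPDF 0 := by
    ext x
    have := exponentialPDF_eq 1 x
    rw [exponentialPDF, exponentialPDFReal] at this
    rw [gammaPDF, this, erlangPDF]
    by_cases hx : 0 ≤ x
    · rw [indicator_of_mem (mem_Ici.2 hx)]; simp [hx]
    · rw [indicator_of_notMem (by simpa using hx)]; simp [hx]
  rw [expMeasure, gammaMeasure, this]

instance : IsProbabilityMeasure (expMeasure 1) := isProbabilityMeasure_expMeasure one_pos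

/-- The two exponential factors multiply to `exp (-x)`, which does not depend on `y`; integrating `y
^ n / n!` over `[0, x]` raises the degree by one. -/
lemma lconvolution_erlangPDF (n : ℕ) :
    (erlangPDF n ⋆ₗ[volume] erlangPDF 0) = erlangPDF (n + 1) := by
  ext x
  rw [lconvolution_def]
  have key : ∀ y, erlangPDF n y * erlangPDF 0 (-y + x) =
      (Icc 0 x).indicator (fun y => ENNReal.ofReal (y ^ n / n.factorial * Real.exp (-x))) y := by
    intro y
    by_cases h0 : 0 ≤ y
    · by_cases hx : y ≤ x
      · rw [indicator_of_mem (mem_Icc.2 ⟨h0, hx⟩), erlangPDF, erlangPDF,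
          indicator_of_mem (mem_Ici.2 h0), indicator_of_mem (mem_Ici.2 (by linarith)),
          ← ENNReal.ofReal_mul (by positivity)]
        congr 1
        simp only [pow_zero, Nat.factorial_zero, Nat.cast_one, div_one, one_mul]
        rw [mul_assoc, ← Real.exp_add]
        ring_nf
      · rw [indicator_of_notMem (fun h => hx h.2), erlangPDF, erlangPDF,
          indicator_of_notMem (s := Ici 0) (a := -y + x) (by simp; linarith), mul_zero]
    · rw [indicator_of_notMem (fun h => h0 h.1), erlangPDF,
          indicator_of_notMem (s := Ici 0) (a := y) (by simpa using h0), zero_mul]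
  simp_rw [key]
  rw [lintegral_indicator measurableSet_Icc, erlangPDF]
  by_cases hx : 0 ≤ x
  · rw [indicator_of_mem (mem_Ici.2 hx), ← ofReal_integral_eq_lintegral_ofReal]
    · congr 1
      rw [integral_Icc_eq_integral_Ioc, ← intervalIntegral.integral_of_le hx,
        intervalIntegral.integral_mul_const, intervalIntegral.integral_div, integral_pow,
        Nat.factorial_succ]
      push_cast
      have : (n.factorial : ℝ) ≠ 0 := by positivity
      field_simp
      simp
    · exact (by fun_prop : Continuous fun y : ℝ => y ^ n / n.factorial * Real.exp (-x)).integrableOn_Icc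
    · filter_upwards [ae_restrict_mem measurableSet_Icc] with y hy
      have := hy.1
      simp only [Pi.zero_apply]; positivity
  · rw [indicator_of_notMem (by simpa using hx), Icc_eq_empty hx]
    simp

/-- The exponential series cancels the factor `exp (-x)`. This is the constant intensity of the
Poisson process. -/
lemma tsum_erlangPDF {x : ℝ} (hx : 0 ≤ x) : ∑' n, erlangPDF n x = 1 := by
  have h : ∀ n, erlangPDF n x = ENNReal.ofReal (x ^ n / n.factorial * Real.exp (-x)) := fun n => by
    rw [erlangPDF, indicator_of_mem (mem_Ici.2 hx)]
  have hs : HasSum (fun n : ℕ => x ^ n / n.factorial * Real.exp (-x)) 1 := by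
    have := (NormedSpace.expSeries_div_hasSum_exp (𝔸 := ℝ) x).mul_right (Real.exp (-x))
    rwa [← Real.exp_eq_exp_ℝ, ← Real.exp_add, add_neg_cancel, Real.exp_zero] at this
  simp_rw [h]
  rw [← ENNReal.ofReal_tsum_of_nonneg (fun n => by positivity) hs.summable, hs.tsum_eq]
  simp

/-- Sums of independent standard exponential variables have Erlang distributions. -/
lemma map_sum_eq_withDensity_erlangPDF {Ω : Type*} [MeasurableSpace Ω] {μ : Measure Ω}
    {X : ℕ → Ω → ℝ} (hX : ∀ n, HasLaw (X n) (expMeasure 1) μ)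
    (hm : ∀ n, Measurable (X n)) (hi : iIndepFun X μ) (n : ℕ) :
    μ.map (fun ω => ∑ i ∈ Finset.range (n + 1), X i ω) = volume.withDensity (erlangPDF n) := by
  have := hi.isProbabilityMeasure
  induction n with
  | zero => simpa [expMeasure_one_eq] using (hX 0).map_eq
  | succ n ih =>
    have hind : IndepFun (fun ω => ∑ i ∈ Finset.range (n + 1), X i ω) (X (n + 1)) μ := by
      have := hi.indepFun_finsetSum_of_notMem hm (s := Finset.range (n + 1)) (i := n + 1) (by simp)
      convert this using 1
      ext ω; simp
    have e : (fun ω => ∑ i ∈ Finset.range (n + 1 + 1), X i ω) =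
        (fun ω => ∑ i ∈ Finset.range (n + 1), X i ω) + X (n + 1) := by
      ext ω; simp [Finset.sum_range_succ]
    have : SigmaFinite (volume.withDensity (erlangPDF n) : Measure ℝ) := by
      rw [← ih]; infer_instance
    rw [e, hind.map_add_eq_map_conv_map (Finset.measurable_fun_sum _ fun i _ => hm i) (hm _), ih,
      (hX _).map_eq, expMeasure_one_eq, conv_withDensity_eq_lconvolution (measurable_erlangPDF _)
        (measurable_erlangPDF _), lconvolution_erlangPDF]

/-- The renewal measure of the standard exponential distribution is Lebesgue measure. -/
lemma tsum_withDensity_erlangPDF_Iio (h : ℝ) :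
    ∑' n, (volume.withDensity (erlangPDF n) : Measure ℝ) (Iio h) = ENNReal.ofReal h := by
  have h1 : ∀ n, (volume.withDensity (erlangPDF n) : Measure ℝ) (Iio h) =
      ∫⁻ x in Iio h, erlangPDF n x := fun n => withDensity_apply _ measurableSet_Iio
  simp_rw [h1]
  rw [← lintegral_tsum fun n => (measurable_erlangPDF n).aemeasurable]
  have h2 : ∀ x, ∑' n, erlangPDF n x = (Ici (0 : ℝ)).indicator 1 x := by
    intro x
    by_cases hx : 0 ≤ x
    · rw [tsum_erlangPDF hx, indicator_of_mem (mem_Ici.2 hx)]; rfl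
    · rw [indicator_of_notMem (by simpa using hx)]
      simp [erlangPDF, hx]
  simp_rw [h2]
  rw [lintegral_indicator_one measurableSet_Ici, Measure.restrict_apply measurableSet_Ici,
    Ici_inter_Iio, Real.volume_Ico, sub_zero]

/-- The expected number of marks in `C` before time `h` in a marked Poisson process. -/
lemma tsum_measure_sum_lt {E : Type*} [MeasurableSpace E] (κ : Measure E) [IsProbabilityMeasure κ]
    {C : Set E} (hC : MeasurableSet C) (h : ℝ) :
    ∑' n, (Measure.infinitePi fun _ : ℕ => (expMeasure 1).prod κ)
      {y | ∑ i ∈ Finset.range (n + 1), (y i).1 < h ∧ (y n).2 ∈ C} = ENNReal.ofReal h * κ C := by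
  set μ := Measure.infinitePi fun _ : ℕ => (expMeasure 1).prod κ
  have hi : iIndepFun (fun n (y : ℕ → ℝ × E) => y n) μ :=
    iIndepFun_infinitePi (X := fun _ x => x) (fun _ => measurable_id)
  have hi1 : iIndepFun (fun n (y : ℕ → ℝ × E) => (y n).1) μ :=
    iIndepFun_infinitePi (X := fun _ (x : ℝ × E) => x.1) (fun _ => measurable_fst)
  have hl : ∀ n, μ.map (fun y : ℕ → ℝ × E => y n) = (expMeasure 1).prod κ := fun n =>
    Measure.infinitePi_map_eval _ n
  have hl1 : ∀ n, HasLaw (fun y : ℕ → ℝ × E => (y n).1) (expMeasure 1) μ := fun n => by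
    refine ⟨Measurable.aemeasurable (by fun_prop), ?_⟩
    have : (fun y : ℕ → ℝ × E => (y n).1) = Prod.fst ∘ fun y => y n := rfl
    rw [this, ← Measure.map_map measurable_fst (by fun_prop), hl, Measure.map_fst_prod]
    simp
  have hn : ∀ n, μ {y | ∑ i ∈ Finset.range (n + 1), (y i).1 < h ∧ (y n).2 ∈ C} =
      (volume.withDensity (erlangPDF n) : Measure ℝ) (Iio h) * κ C := by
    intro n
    rw [← map_sum_eq_withDensity_erlangPDF hl1 (fun n => by fun_prop) hi1 n,
      Measure.map_apply (by fun_prop) measurableSet_Iio]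
    -- The last gap is left out of `S` because it shares coordinate `n` with the mark; within that
    -- coordinate gap and mark are independent by the product form.
    set S : (ℕ → ℝ × E) → ℝ := fun y => ∑ i ∈ Finset.range n, (y i).1 with hS
    have hSm : Measurable S := by fun_prop
    have hind : IndepFun S (fun y : ℕ → ℝ × E => y n) μ := by
      have h1 := hi.indepFun_finset (Finset.range n) {n} (by simp) (fun i => by fun_prop)
      have hψ : Measurable fun z : ({n} : Finset ℕ) → ℝ × E => z ⟨n, by simp⟩ :=
        measurable_pi_apply _
      have hφ : Measurable fun z : Finset.range n → ℝ × E => ∑ i, (z i).1 := by fun_prop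
      have := h1.comp hφ hψ
      convert this using 1
      · ext y
        exact (Finset.sum_coe_sort (Finset.range n) fun i => (y i).1).symm
      · rfl
    have hlaw := (indepFun_iff_map_prod_eq_prod_map_map hSm.aemeasurable
      (measurable_pi_apply n).aemeasurable).1 hind
    rw [hl n] at hlaw
    have hG : IsProbabilityMeasure (μ.map S) := Measure.isProbabilityMeasure_map hSm.aemeasurable
    set G := μ.map S
    -- Proved for every mark set: `D = C` gives the factorization, and `D = univ` identifies its
    -- first factor as the Erlang probability.
    have e1 : ∀ D : Set E, MeasurableSet D →
        μ {y | ∑ i ∈ Finset.range (n + 1), (y i).1 < h ∧ (y n).2 ∈ D} =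
        (G.prod (expMeasure 1)) {p | p.1 + p.2 < h} * κ D := by
      intro D hD
      have : {y : ℕ → ℝ × E | ∑ i ∈ Finset.range (n + 1), (y i).1 < h ∧ (y n).2 ∈ D} =
          (fun y => (S y, y n)) ⁻¹' {p | p.1 + p.2.1 < h ∧ p.2.2 ∈ D} := by
        ext y; simp [hS, Finset.sum_range_succ]
      have hms : MeasurableSet {p : ℝ × ℝ | p.1 + p.2 < h} :=
        measurableSet_lt (by fun_prop) (by fun_prop)
      have hms3 : MeasurableSet {p : ℝ × ℝ × E | p.1 + p.2.1 < h ∧ p.2.2 ∈ D} :=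
        (measurableSet_lt (f := fun p : ℝ × ℝ × E => p.1 + p.2.1) (g := fun _ => h)
          (by fun_prop) (by fun_prop)).inter (measurable_snd.comp measurable_snd hD)
      rw [this, ← Measure.map_apply (by fun_prop), hlaw, ← Measure.prod_prod,
        ← Measure.prodAssoc_prod, Measure.map_apply MeasurableEquiv.prodAssoc.measurable]
      · rfl
      · exact hms3
      · exact hms3
    rw [e1 C hC]
    have := e1 univ MeasurableSet.univ
    simp only [mem_univ, and_true, measure_univ, mul_one] at this
    rw [← this]; rfl
  simp_rw [hn]
  rw [ENNReal.tsum_mul_right, tsum_withDensity_erlangPDF_Iio h]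

end Upkeep

/-! ### Mean counts of agents: the Campbell measure -/

namespace Upkeep

open scoped ENNReal NNReal

namespace SystemProcess

variable {Ω : Type*} [MeasurableSpace Ω] {Θ : Type*} [MeasurableSpace Θ]

lemma measurable_arrivalsFrom (X : SystemProcess Ω Θ) (s : ℝ) : Measurable (X.arrivalsFrom s) := by
  refine Measure.measurable_of_measurable_coe _ fun A hA => ?_
  simp only [arrivalsFrom, Measure.sum_apply _ hA, Measure.dirac_apply' _ hA]
  refine Measurable.tsum fun n => measurable_one.indicator hA |>.comp ?_
  exact ((X.measurable_arrival n).sub_const s).prodMk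
    ((X.measurable_agentType n).prodMk (X.measurable_action n))

lemma measurable_pathFrom (X : SystemProcess Ω Θ) (s : ℝ) : Measurable (X.pathFrom s) :=
  (measurable_pi_lambda _ fun _ => X.measurable_state _).prodMk (X.measurable_arrivalsFrom s)

lemma IsStationary.lintegral_pathFrom {X : SystemProcess Ω Θ} {μ : Measure Ω}
    (hX : X.IsStationary μ) (s : ℝ)
    {Φ : (ℝ → MachineState) × Measure (ℝ × Θ × Action) → ℝ≥0∞} (hΦ : Measurable Φ) :
    ∫⁻ ω, Φ (X.pathFrom s ω) ∂μ = ∫⁻ ω, Φ (X.pathFrom 0 ω) ∂μ := by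
  rw [← lintegral_map hΦ (X.measurable_pathFrom s), hX s, lintegral_map hΦ (X.measurable_pathFrom 0)]

lemma stateBefore_unique {X : SystemProcess Ω Θ} {ω : Ω} {t : ℝ} {m m' : MachineState}
    (h : X.StateBefore ω t m) (h' : X.StateBefore ω t m') : m = m' := by
  obtain ⟨s, hs, hs'⟩ := (h.and h').exists
  exact hs.symm.trans hs'

lemma exists_stateBefore (X : SystemProcess Ω Θ) (ω : Ω) (t : ℝ) :
    ∃ m, X.StateBefore ω t m := X.state_leftLim ω t

lemma stateBefore_or (X : SystemProcess Ω Θ) (ω : Ω) (t : ℝ) :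
    X.StateBefore ω t .working ∨ X.StateBefore ω t .broken := by
  obtain ⟨m, hm⟩ := X.exists_stateBefore ω t
  cases m
  · exact Or.inl hm
  · exact Or.inr hm

lemma arrival_nonneg_iff (X : SystemProcess Ω Θ) (ω : Ω) (n : ℤ) : 0 ≤ X.arrival n ω ↔ 1 ≤ n := by
  constructor
  · intro h
    by_contra hn
    have : X.arrival n ω ≤ X.arrival 0 ω := (X.arrival_strictMono ω).monotone (by omega)
    linarith [X.arrival_zero_neg ω]
  · intro h
    exact (X.arrival_one_nonneg ω).trans ((X.arrival_strictMono ω).monotone h)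

lemma arrival_eq_sum_waitingTime (X : SystemProcess Ω Θ) (ω : Ω) (n : ℕ) :
    X.arrival (n + 1) ω = ∑ i ∈ Finset.range (n + 1), X.waitingTime i ω := by
  induction n with
  | zero => simp [waitingTime]
  | succ n ih =>
    rw [Finset.sum_range_succ, ← ih, waitingTime]
    push_cast
    rw [add_sub_cancel]
    ring_nf

lemma history_le (X : SystemProcess Ω Θ) : X.history ≤ ‹MeasurableSpace Ω› := by
  refine sup_le (iSup_le fun t => (X.measurable_state t).comap_le) (iSup_le fun n => ?_)
  exact ((X.measurable_arrival _).prodMk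
    ((X.measurable_agentType _).prodMk (X.measurable_action _))).comap_le

/-- The grid point in `(1 / N) ℤ` before the last one that does not exceed `t`. -/
noncomputable def grid (N : ℕ) (t : ℝ) : ℝ := (⌊N * t⌋ - 1 : ℝ) / N

/-- The offset `-1` in `grid` keeps the grid point strictly below `t` even if `t` itself lies on the
grid, so that the limit is from the left. -/
lemma tendsto_grid (t : ℝ) : Tendsto (fun N => grid N t) atTop (𝓝[<] t) := by
  have hb : ∀ᶠ N : ℕ in atTop, t - 2 / N ≤ grid N t ∧ grid N t < t := by
    filter_upwards [eventually_gt_atTop 0] with N hN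
    have hN' : (0 : ℝ) < N := by exact_mod_cast hN
    have h1 := Int.floor_le ((N : ℝ) * t)
    have h2 := Int.lt_floor_add_one ((N : ℝ) * t)
    unfold grid
    constructor
    · rw [le_div_iff₀ hN', sub_mul, div_mul_cancel₀ _ hN'.ne']
      linarith
    · rw [div_lt_iff₀ hN']
      linarith
  refine tendsto_nhdsWithin_iff.2 ⟨?_, hb.mono fun N h => h.2⟩
  refine tendsto_of_tendsto_of_tendsto_of_le_of_le' (g := fun N : ℕ => t - 2 / (N : ℝ)) ?_
    tendsto_const_nhds (hb.mono fun N h => h.1) (hb.mono fun N h => h.2.le)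
  simpa using tendsto_const_nhds.sub (tendsto_const_div_atTop_nhds_zero_nat (2 : ℝ))

/-- Turns the left limit into a condition on countably many times, which is measurable. The converse
holds because the left limit exists, so that its value can be read off along one sequence. -/
lemma stateBefore_iff_eventually_grid (X : SystemProcess Ω Θ) (ω : Ω) (s t : ℝ)
    (m : MachineState) :
    X.StateBefore ω (s + t) m ↔ ∀ᶠ N in atTop, X.state (s + grid N t) ω = m := by
  have ht : Tendsto (fun N => s + grid N t) atTop (𝓝[<] (s + t)) := by
    have := tendsto_nhdsWithin_iff.1 (tendsto_grid t)
    exact tendsto_nhdsWithin_iff.2 ⟨this.1.const_add s, this.2.mono fun N h => by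
      simpa using h⟩
  refine ⟨fun h => ht.eventually h, fun h => ?_⟩
  obtain ⟨m', hm'⟩ := X.exists_stateBefore ω (s + t)
  obtain ⟨N, h1, h2⟩ := ((ht.eventually hm').and h).exists
  rwa [← h2, h1]

/-- The measure on pairs of an agent and an outcome that gives every agent unit mass. -/
noncomputable def campbell (μ : Measure Ω) : Measure (ℤ × Ω) := Measure.count.prod μ

lemma campbell_apply (μ : Measure Ω) [SFinite μ] {S : Set (ℤ × Ω)} (hS : MeasurableSet S) :
    campbell μ S = ∑' n, μ {ω | (n, ω) ∈ S} := by
  rw [campbell, Measure.prod_apply hS, lintegral_count]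
  rfl

/-- The time of arrival, relative to `s`, of an agent, his type and action, and the path of
the state as seen from `s`. -/
def view (X : SystemProcess Ω Θ) (s : ℝ) (p : ℤ × Ω) : ℝ × (Θ × Action) × (ℝ → MachineState) :=
  (X.arrival p.1 p.2 - s, (X.agentType p.1 p.2, X.action p.1 p.2), fun t => X.state (s + t) p.2)

lemma measurable_arrival' (X : SystemProcess Ω Θ) :
    Measurable fun p : ℤ × Ω => X.arrival p.1 p.2 :=
  measurable_from_prod_countable_right X.measurable_arrival

lemma measurable_agentType' (X : SystemProcess Ω Θ) :
    Measurable fun p : ℤ × Ω => X.agentType p.1 p.2 :=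
  measurable_from_prod_countable_right X.measurable_agentType

lemma measurable_action' (X : SystemProcess Ω Θ) :
    Measurable fun p : ℤ × Ω => X.action p.1 p.2 :=
  measurable_from_prod_countable_right X.measurable_action

lemma measurable_view (X : SystemProcess Ω Θ) (s : ℝ) : Measurable (X.view s) :=
  (X.measurable_arrival'.sub_const s).prodMk ((X.measurable_agentType'.prodMk
    X.measurable_action').prodMk (measurable_pi_lambda _ fun t =>
      (X.measurable_state (s + t)).comp measurable_snd))

/-- Stationarity concerns the law of `pathFrom`, where agents carry no numbers. By Tonelli this
identity transfers it to the numbered agents that `campbell` counts. -/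
lemma lintegral_arrivalsFrom_indicator (X : SystemProcess Ω Θ) (μ : Measure Ω) [SFinite μ] (s : ℝ)
    {A : Set ℝ} {D : Set (Θ × Action)} {Y : Set (ℝ → MachineState)}
    (hA : MeasurableSet A) (hD : MeasurableSet D) (hY : MeasurableSet Y) :
    ∫⁻ ω, Y.indicator 1 (X.pathFrom s ω).1 * (X.pathFrom s ω).2 (A ×ˢ D) ∂μ =
      campbell μ (X.view s ⁻¹' (A ×ˢ D ×ˢ Y)) := by
  have hS : MeasurableSet (A ×ˢ D ×ˢ Y) := hA.prod (hD.prod hY)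
  rw [campbell_apply μ (X.measurable_view s hS)]
  have hn : ∀ n : ℤ, MeasurableSet {ω | (n, ω) ∈ X.view s ⁻¹' (A ×ˢ D ×ˢ Y)} := fun n =>
    measurable_prodMk_left (X.measurable_view s hS)
  simp_rw [← fun n => lintegral_indicator_one (μ := μ) (hn n)]
  rw [← lintegral_tsum fun n => (measurable_one.indicator (hn n)).aemeasurable]
  refine lintegral_congr fun ω => ?_
  simp only [pathFrom, arrivalsFrom, Measure.sum_apply _ (hA.prod hD),
    Measure.dirac_apply' _ (hA.prod hD)]
  rw [← ENNReal.tsum_mul_left]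
  refine tsum_congr fun n => ?_
  simp only [indicator, Pi.one_apply, mem_ofPred_eq, mem_preimage, view, mem_prod]
  by_cases h1 : (fun t => X.state (s + t) ω) ∈ Y <;>
    by_cases h2 : X.arrival n ω - s ∈ A <;>
    by_cases h3 : (X.agentType n ω, X.action n ω) ∈ D <;> simp [h1, h2, h3, view]

lemma IsStationary.campbell_view_prod {X : SystemProcess Ω Θ} {μ : Measure Ω} [SFinite μ]
    (hX : X.IsStationary μ) (s : ℝ)
    {A : Set ℝ} {D : Set (Θ × Action)} {Y : Set (ℝ → MachineState)}
    (hA : MeasurableSet A) (hD : MeasurableSet D) (hY : MeasurableSet Y) :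
    campbell μ (X.view s ⁻¹' (A ×ˢ D ×ˢ Y)) = campbell μ (X.view 0 ⁻¹' (A ×ˢ D ×ˢ Y)) := by
  rw [← X.lintegral_arrivalsFrom_indicator μ s hA hD hY,
    ← X.lintegral_arrivalsFrom_indicator μ 0 hA hD hY]
  refine hX.lintegral_pathFrom s
    (Φ := fun q => Y.indicator 1 q.1 * q.2 (A ×ˢ D)) ?_
  exact ((measurable_one.indicator hY).comp measurable_fst).mul
    ((Measure.measurable_coe (hA.prod hD)).comp measurable_snd)

/-- The expected number of future agents with given marks is independent of the history. -/
lemma campbell_future (X : SystemProcess Ω Θ) (μ : Measure Ω) [IsProbabilityMeasure μ]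
    {E : Type*} [MeasurableSpace E] (κ : Measure E) [IsProbabilityMeasure κ]
    {Z : ℕ → Ω → E} (hZ : ∀ n, Measurable (Z n))
    (hlaw : HasLaw (fun ω n => (X.waitingTime n ω, Z n ω))
      (Measure.infinitePi fun _ : ℕ => (expMeasure 1).prod κ) μ)
    {H : Set Ω} (hH : MeasurableSet H)
    (hind : ∀ S : Set (ℕ → ℝ × E), MeasurableSet S →
      μ (H ∩ (fun ω n => (X.waitingTime n ω, Z n ω)) ⁻¹' S) =
        μ H * μ ((fun ω n => (X.waitingTime n ω, Z n ω)) ⁻¹' S))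
    {C : Set E} (hC : MeasurableSet C) (h : ℝ) :
    campbell μ {p | X.arrival p.1 p.2 ∈ Ico 0 h ∧ p.2 ∈ H ∧ Z (p.1 - 1).toNat p.2 ∈ C} =
      μ H * (ENNReal.ofReal h * κ C) := by
  have hm : MeasurableSet {p : ℤ × Ω | X.arrival p.1 p.2 ∈ Ico 0 h ∧ p.2 ∈ H ∧
      Z (p.1 - 1).toNat p.2 ∈ C} := by
    refine (X.measurable_arrival' measurableSet_Ico).inter ((measurable_snd hH).inter ?_)
    exact (measurable_from_prod_countable_right (f := fun p : ℤ × Ω => Z (p.1 - 1).toNat p.2)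
      fun n => hZ (n - 1).toNat) hC
  rw [campbell_apply μ hm]
  have hinj : Function.Injective fun n : ℕ => (n + 1 : ℤ) := fun a b hab => by simpa using hab
  rw [← hinj.tsum_eq]
  · rw [← tsum_measure_sum_lt κ hC h, ← ENNReal.tsum_mul_left]
    refine tsum_congr fun n => ?_
    set S : Set (ℕ → ℝ × E) := {y | ∑ i ∈ Finset.range (n + 1), (y i).1 < h ∧ (y n).2 ∈ C} with hS
    have hSm : MeasurableSet S := by
      refine (measurableSet_lt (f := fun y : ℕ → ℝ × E => ∑ i ∈ Finset.range (n + 1), (y i).1)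
        (by fun_prop) measurable_const).inter ?_
      exact (measurable_snd.comp (measurable_pi_apply n)) hC
    rw [← hlaw.map_eq, Measure.map_apply_of_aemeasurable hlaw.aemeasurable hSm, ← hind S hSm]
    congr 1
    ext ω
    have h1 : (0 : ℝ) ≤ X.arrival (n + 1) ω := (X.arrival_nonneg_iff ω _).2 (by omega)
    simp only [mem_ofPred_eq, mem_Ico, h1, true_and, hS, mem_inter_iff, mem_preimage,
      ← arrival_eq_sum_waitingTime, add_sub_cancel_right, Int.toNat_natCast]
    tauto
  · intro n hn
    rw [Function.mem_support] at hn
    by_contra hn'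
    apply hn
    have : n < 1 := by
      by_contra h1
      exact hn' ⟨(n - 1).toNat, by simp; omega⟩
    convert measure_empty (μ := μ)
    ext ω
    simp only [mem_ofPred_eq, mem_Ico, mem_empty_iff_false, iff_false]
    rintro ⟨⟨h1, -⟩, -⟩
    rw [arrival_nonneg_iff] at h1
    omega

/-- Future waiting times and types are independent of the history and form a marked Poisson process,
so the history event enters only through its probability. -/
lemma IsAdmissible.campbell_history {X : SystemProcess Ω Θ} {μ : Measure Ω}
    [IsProbabilityMeasure μ] {lam : Measure Θ} [IsProbabilityMeasure lam] {ν : Measure ℝ}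
    (hX : X.IsAdmissible μ lam ν) {H : Set Ω} (hH : MeasurableSet[X.history] H)
    {B : Set Θ} (hB : MeasurableSet B) (h : ℝ) :
    campbell μ {p | X.arrival p.1 p.2 ∈ Ico 0 h ∧ p.2 ∈ H ∧ X.agentType p.1 p.2 ∈ B} =
      μ H * (ENNReal.ofReal h * lam B) := by
  rw [← X.campbell_future μ lam (Z := fun n => X.agentType (n + 1))
    (fun n => X.measurable_agentType _) hX.arrivals_law (X.history_le _ hH) ?_ hB h]
  · congr 1
    ext p
    simp only [mem_ofPred_eq, mem_Ico]
    constructor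
    · rintro ⟨⟨h1, h2⟩, h3, h4⟩
      have := (X.arrival_nonneg_iff _ _).1 h1
      refine ⟨⟨h1, h2⟩, h3, ?_⟩
      convert h4
      omega
    · rintro ⟨⟨h1, h2⟩, h3, h4⟩
      have := (X.arrival_nonneg_iff _ _).1 h1
      refine ⟨⟨h1, h2⟩, h3, ?_⟩
      convert h4
      omega
  · intro S hS
    exact (Indep_iff _ _ μ).1 hX.arrivals_indep _ _ hH ⟨S, hS, rfl⟩

/-! ### Arrivals see time averages -/

section Stationary

variable {X : SystemProcess Ω Θ} {μ : Measure Ω} [IsProbabilityMeasure μ]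
  {lam : Measure Θ} [IsProbabilityMeasure lam] {ν : Measure ℝ}

lemma IsAdmissible.campbell_Ico_zero (hX : X.IsAdmissible μ lam ν) (h : ℝ) :
    campbell μ {p | X.arrival p.1 p.2 ∈ Ico 0 h} = ENNReal.ofReal h := by
  simpa using hX.campbell_history (H := univ) MeasurableSet.univ (B := univ) MeasurableSet.univ h

lemma IsStationary.campbell_Ico (hst : X.IsStationary μ) (hX : X.IsAdmissible μ lam ν)
    (a b : ℝ) : campbell μ {p | X.arrival p.1 p.2 ∈ Ico a b} = ENNReal.ofReal (b - a) := by
  rw [← hX.campbell_Ico_zero (b - a)]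
  have := hst.campbell_view_prod a (A := Ico 0 (b - a)) (D := univ) (Y := univ)
    measurableSet_Ico MeasurableSet.univ MeasurableSet.univ
  convert this using 2
  · ext p; simp [view]
  · ext p; simp [view]

/-- Extends `campbell_view_prod` from rectangles to all measurable sets. The window `Ico a b` makes
the measures finite, so that rectangles determine them. -/
lemma IsStationary.campbell_view (hst : X.IsStationary μ) (hX : X.IsAdmissible μ lam ν)
    (s a b : ℝ) {Z : Set (ℝ × (Θ × Action) × (ℝ → MachineState))} (hZ : MeasurableSet Z) :
    campbell μ {p | X.arrival p.1 p.2 - s ∈ Ico a b ∧ X.view s p ∈ Z} =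
      campbell μ {p | X.arrival p.1 p.2 ∈ Ico a b ∧ X.view 0 p ∈ Z} := by
  have hw : ∀ s, MeasurableSet {p : ℤ × Ω | X.arrival p.1 p.2 - s ∈ Ico a b} := fun s =>
    (X.measurable_arrival'.sub_const s) measurableSet_Ico
  have key : ((campbell μ).restrict {p | X.arrival p.1 p.2 - s ∈ Ico a b}).map (X.view s) =
      ((campbell μ).restrict {p | X.arrival p.1 p.2 - 0 ∈ Ico a b}).map (X.view 0) := by
    have : IsFiniteMeasure
        ((campbell μ).restrict {p | X.arrival p.1 p.2 - s ∈ Ico a b}) := by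
      constructor
      have e : {p : ℤ × Ω | X.arrival p.1 p.2 - s ∈ Ico a b} =
          {p | X.arrival p.1 p.2 ∈ Ico (a + s) (b + s)} := by
        ext p; simp [le_sub_iff_add_le, sub_lt_iff_lt_add]
      rw [Measure.restrict_apply_univ, e, hst.campbell_Ico hX]
      exact ENNReal.ofReal_lt_top
    refine Measure.ext_prod₃ fun {A D Y} hA hD hY => ?_
    have hS := hA.prod (hD.prod hY)
    rw [Measure.map_apply (X.measurable_view _) hS, Measure.map_apply (X.measurable_view _) hS,
      Measure.restrict_apply (X.measurable_view _ hS),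
      Measure.restrict_apply (X.measurable_view _ hS)]
    have := hst.campbell_view_prod s (hA.inter (measurableSet_Ico (a := a) (b := b))) hD hY
    convert this using 2 <;>
    · ext p
      simp only [view, mem_inter_iff, mem_preimage, mem_prod, mem_ofPred_eq]
      tauto
  have := congrArg (fun m => m Z) key
  simp only [Measure.map_apply (X.measurable_view _) hZ,
    Measure.restrict_apply (X.measurable_view _ hZ)] at this
  convert this using 2
  · ext p
    simp [and_comm]
  · ext p
    simp [and_comm]

lemma measurableSet_pathBefore (m : MachineState) :
    MeasurableSet {z : ℝ × (Θ × Action) × (ℝ → MachineState) |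
      ∀ᶠ N in atTop, z.2.2 (grid N z.1) = m} := by
  have : ∀ N : ℕ, MeasurableSet {z : ℝ × (Θ × Action) × (ℝ → MachineState) |
      z.2.2 (grid N z.1) = m} := fun N => by
    -- Evaluation of an arbitrary path at a variable time is not measurable for the product
    -- σ-algebra, but grid points run through a countable set.
    have h1 : Measurable fun q : ℤ × (ℝ → MachineState) => q.2 ((q.1 - 1 : ℝ) / N) :=
      measurable_from_prod_countable_right fun k => measurable_pi_apply ((k - 1 : ℝ) / N)
    have h2 : Measurable fun z : ℝ × (Θ × Action) × (ℝ → MachineState) =>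
        (⌊(N : ℝ) * z.1⌋, z.2.2) :=
      (Int.measurable_floor.comp (measurable_fst.const_mul _)).prodMk
        (measurable_snd.comp measurable_snd)
    exact (h1.comp h2) (measurableSet_singleton m)
  simp only [eventually_atTop, ofPred_exists, ofPred_forall]
  exact MeasurableSet.iUnion fun n => MeasurableSet.iInter fun i => MeasurableSet.iInter fun _ =>
    this i

lemma view_mem_pathBefore (X : SystemProcess Ω Θ) (s : ℝ) (p : ℤ × Ω) (m : MachineState) :
    (∀ᶠ N in atTop, (X.view s p).2.2 (grid N (X.view s p).1) = m) ↔
      X.StateBefore p.2 (X.arrival p.1 p.2) m := by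
  have := X.stateBefore_iff_eventually_grid p.2 s (X.arrival p.1 p.2 - s) m
  rw [add_sub_cancel] at this
  rw [this]; rfl

lemma measurableSet_stateBefore (X : SystemProcess Ω Θ) (m : MachineState) :
    MeasurableSet {p : ℤ × Ω | X.StateBefore p.2 (X.arrival p.1 p.2) m} := by
  simp_rw [← X.view_mem_pathBefore 0]
  exact X.measurable_view 0 (measurableSet_pathBefore m)

/-- The expected number of agents who arrive in the first of `N` intervals of unit time
with a given mark, given states at the left neighbor of that interval and before the arrival. -/
lemma IsStationary.nsmul_campbell_first (hst : X.IsStationary μ) (hX : X.IsAdmissible μ lam ν)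
    {D : Set (Θ × Action)} (hD : MeasurableSet D) (m₀ m : MachineState) {N : ℕ} (hN : 0 < N) :
    N * campbell μ {p | X.arrival p.1 p.2 ∈ Ico (0 : ℝ) (1 / N) ∧
        (X.agentType p.1 p.2, X.action p.1 p.2) ∈ D ∧ X.state (-1 / N) p.2 = m₀ ∧
        X.StateBefore p.2 (X.arrival p.1 p.2) m} =
      campbell μ {p | X.arrival p.1 p.2 ∈ Ico (0 : ℝ) 1 ∧
        (X.agentType p.1 p.2, X.action p.1 p.2) ∈ D ∧
        X.state (grid N (X.arrival p.1 p.2)) p.2 = m₀ ∧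
        X.StateBefore p.2 (X.arrival p.1 p.2) m} := by
  have hN' : (0 : ℝ) < N := by exact_mod_cast hN
  set Z : Set (ℝ × (Θ × Action) × (ℝ → MachineState)) :=
    {z | z.2.1 ∈ D ∧ z.2.2 (-1 / N) = m₀ ∧ ∀ᶠ N in atTop, z.2.2 (grid N z.1) = m} with hZdef
  have hZ : MeasurableSet Z := by
    refine ((measurable_fst.comp measurable_snd) hD).inter (MeasurableSet.inter ?_
      (measurableSet_pathBefore m))
    have h1 : Measurable fun z : ℝ × (Θ × Action) × (ℝ → MachineState) => z.2.2 (-1 / N) :=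
      (measurable_pi_apply (-1 / N : ℝ)).comp (measurable_snd.comp measurable_snd)
    exact h1 (measurableSet_singleton m₀)
  -- Seen from time `k / N`, the `k`-th interval becomes the first one, and the grid point `(k - 1)
  -- / N` of its arrivals becomes `-1 / N`, which lies in the history.
  have hk : ∀ k : ℕ, campbell μ {p | X.arrival p.1 p.2 - k / N ∈ Ico (0 : ℝ) (1 / N) ∧
      X.view (k / N) p ∈ Z} =
      campbell μ {p | X.arrival p.1 p.2 ∈ Ico (0 : ℝ) (1 / N) ∧
        (X.agentType p.1 p.2, X.action p.1 p.2) ∈ D ∧ X.state (-1 / N) p.2 = m₀ ∧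
        X.StateBefore p.2 (X.arrival p.1 p.2) m} := by
    intro k
    rw [hst.campbell_view hX _ _ _ hZ]
    congr 1
    ext p
    simp only [hZdef, mem_ofPred_eq, view_mem_pathBefore]
    simp [view]
  have hmeas : ∀ k : ℕ, MeasurableSet {p : ℤ × Ω |
      X.arrival p.1 p.2 - k / N ∈ Ico (0 : ℝ) (1 / N) ∧ X.view (k / N) p ∈ Z} := fun k =>
    ((X.measurable_arrival'.sub_const _) measurableSet_Ico).inter (X.measurable_view _ hZ)
  have hfloor : ∀ (k : ℕ) (p : ℤ × Ω), X.arrival p.1 p.2 - k / N ∈ Ico (0 : ℝ) (1 / N) ↔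
      ⌊N * X.arrival p.1 p.2⌋ = (k : ℤ) := by
    intro k p
    rw [Int.floor_eq_iff, mem_Ico, sub_nonneg, div_le_iff₀ hN', sub_lt_iff_lt_add,
      ← add_div, lt_div_iff₀ hN', mul_comm, add_comm (1 : ℝ)]
    simp
  have hU : {p | X.arrival p.1 p.2 ∈ Ico (0 : ℝ) 1 ∧
        (X.agentType p.1 p.2, X.action p.1 p.2) ∈ D ∧
        X.state (grid N (X.arrival p.1 p.2)) p.2 = m₀ ∧
        X.StateBefore p.2 (X.arrival p.1 p.2) m} =
      ⋃ k ∈ Finset.range N, {p : ℤ × Ω |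
      X.arrival p.1 p.2 - k / N ∈ Ico (0 : ℝ) (1 / N) ∧ X.view (k / N) p ∈ Z} := by
    ext p
    simp only [mem_ofPred_eq, mem_iUnion, Finset.mem_range, exists_prop, hfloor, hZdef,
      view_mem_pathBefore]
    have hg : ∀ k : ℕ, ⌊N * X.arrival p.1 p.2⌋ = (k : ℤ) →
        ((X.view (k / N) p).2.2 (-1 / N) = X.state (grid N (X.arrival p.1 p.2)) p.2) := by
      intro k hk
      simp only [view, grid, hk]
      congr 1
      push_cast
      ring
    constructor
    · rintro ⟨⟨h0, h1⟩, hd, hs, hb⟩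
      obtain ⟨k, hk⟩ := Int.eq_ofNat_of_zero_le
        (Int.floor_nonneg.2 (mul_nonneg hN'.le h0) : 0 ≤ ⌊N * X.arrival p.1 p.2⌋)
      refine ⟨k, ?_, hk, hd, by rw [hg k hk, hs], hb⟩
      have : ⌊N * X.arrival p.1 p.2⌋ < (N : ℤ) := by
        rw [Int.floor_lt]
        push_cast
        nlinarith
      omega
    · rintro ⟨k, hkN, hk, hd, hs, hb⟩
      rw [hg k hk] at hs
      refine ⟨?_, hd, hs, hb⟩
      have h2 := Int.floor_eq_iff.1 hk
      have h3 : (k : ℝ) + 1 ≤ N := by exact_mod_cast hkN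
      simp only [Int.cast_natCast] at h2
      constructor
      · by_contra hneg
        push Not at hneg
        have : (0 : ℝ) ≤ k := by positivity
        nlinarith
      · by_contra hneg
        push Not at hneg
        nlinarith
  rw [hU, measure_biUnion_finset _ fun k _ => hmeas k]
  · simp_rw [hk]
    rw [Finset.sum_const, Finset.card_range, nsmul_eq_mul]
  · intro k _ l _ hkl
    refine Set.disjoint_left.2 fun p hp hp' => hkl ?_
    have h1 := (hfloor k p).1 hp.1
    have h2 := (hfloor l p).1 hp'.1
    rw [h1] at h2
    exact_mod_cast h2

/-- Arrivals see time averages: the number of arrivals that find the state `m` is approximated by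
that of the arrivals soon after a time when the state is `m`. -/
lemma IsStationary.tendsto_campbell_first (hst : X.IsStationary μ) (hX : X.IsAdmissible μ lam ν)
    {D : Set (Θ × Action)} (hD : MeasurableSet D) (m₀ m : MachineState) :
    Tendsto (fun N : ℕ => N * campbell μ {p | X.arrival p.1 p.2 ∈ Ico (0 : ℝ) (1 / N) ∧
        (X.agentType p.1 p.2, X.action p.1 p.2) ∈ D ∧ X.state (-1 / N) p.2 = m₀ ∧
        X.StateBefore p.2 (X.arrival p.1 p.2) m}) atTop
      (𝓝 (campbell μ {p | X.arrival p.1 p.2 ∈ Ico (0 : ℝ) 1 ∧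
        (X.agentType p.1 p.2, X.action p.1 p.2) ∈ D ∧
        X.StateBefore p.2 (X.arrival p.1 p.2) m₀ ∧
        X.StateBefore p.2 (X.arrival p.1 p.2) m})) := by
  have hmk : MeasurableSet {p : ℤ × Ω | (X.agentType p.1 p.2, X.action p.1 p.2) ∈ D} :=
    (X.measurable_agentType'.prodMk X.measurable_action') hD
  have hgrid : ∀ N : ℕ, MeasurableSet {p : ℤ × Ω |
      X.state (grid N (X.arrival p.1 p.2)) p.2 = m₀} := fun N => by
    have h1 : Measurable fun q : ℤ × Ω => X.state ((q.1 - 1 : ℝ) / N) q.2 :=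
      measurable_from_prod_countable_right fun k => X.measurable_state ((k - 1 : ℝ) / N)
    have h2 : Measurable fun p : ℤ × Ω => (⌊(N : ℝ) * X.arrival p.1 p.2⌋, p.2) :=
      (Int.measurable_floor.comp (X.measurable_arrival'.const_mul _)).prodMk measurable_snd
    exact (h1.comp h2) (measurableSet_singleton m₀)
  -- Dominated convergence: all sets lie among the arrivals in a unit of time, which have mass 1,
  -- and for a fixed agent the state at the grid points is eventually the left limit.
  have := tendsto_measure_of_tendsto_indicator (μ := campbell μ) atTop
    (As := fun N : ℕ => {p : ℤ × Ω | X.arrival p.1 p.2 ∈ Ico (0 : ℝ) 1 ∧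
        (X.agentType p.1 p.2, X.action p.1 p.2) ∈ D ∧
        X.state (grid N (X.arrival p.1 p.2)) p.2 = m₀ ∧
        X.StateBefore p.2 (X.arrival p.1 p.2) m})
    (A := {p : ℤ × Ω | X.arrival p.1 p.2 ∈ Ico (0 : ℝ) 1 ∧
        (X.agentType p.1 p.2, X.action p.1 p.2) ∈ D ∧
        X.StateBefore p.2 (X.arrival p.1 p.2) m₀ ∧
        X.StateBefore p.2 (X.arrival p.1 p.2) m})
    (B := {p : ℤ × Ω | X.arrival p.1 p.2 ∈ Ico (0 : ℝ) 1})
    (fun N => (X.measurable_arrival' measurableSet_Ico).inter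
      (hmk.inter ((hgrid N).inter (X.measurableSet_stateBefore m))))
    (X.measurable_arrival' measurableSet_Ico)
    (by rw [hX.campbell_Ico_zero]; exact ENNReal.ofReal_ne_top)
    (Eventually.of_forall fun N p hp => hp.1) ?_
  · refine this.congr' ?_
    filter_upwards [eventually_gt_atTop 0] with N hN
    exact (hst.nsmul_campbell_first hX hD m₀ m hN).symm
  · intro p
    obtain ⟨m', hm'⟩ := X.exists_stateBefore p.2 (X.arrival p.1 p.2)
    filter_upwards [(tendsto_grid (X.arrival p.1 p.2)).eventually hm'] with N hN
    simp only [hN]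
    have : m' = m₀ ↔ X.StateBefore p.2 (X.arrival p.1 p.2) m₀ :=
      ⟨fun h => h ▸ hm', fun h => stateBefore_unique hm' h⟩
    rw [this]

end Stationary

end SystemProcess

end Upkeep

/-! ### Frequencies of actions and the integrated simplex bounds -/

namespace Upkeep

open scoped ENNReal NNReal

namespace SystemProcess

variable {Ω : Type*} [MeasurableSpace Ω] {Θ : Type*} [MeasurableSpace Θ]

/-- The expected number of agents per unit of time with type and action in `D`. -/
noncomputable def freq (X : SystemProcess Ω Θ) (μ : Measure Ω) (D : Set (Θ × Action)) : ℝ≥0∞ :=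
  campbell μ {p | X.arrival p.1 p.2 ∈ Ico (0 : ℝ) 1 ∧ (X.agentType p.1 p.2, X.action p.1 p.2) ∈ D}

lemma ae_campbell {μ : Measure Ω} [SFinite μ] {P : ℤ → Ω → Prop} (h : ∀ᵐ ω ∂μ, ∀ n, P n ω) :
    ∀ᵐ p ∂campbell μ, P p.1 p.2 :=
  ((Measure.quasiMeasurePreserving_snd (μ := Measure.count) (ν := μ)).ae h).mono fun p hp => hp p.1

lemma campbell_mono_ae {μ : Measure Ω} [SFinite μ] {P : ℤ → Ω → Prop} (h : ∀ᵐ ω ∂μ, ∀ n, P n ω)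
    {S T : Set (ℤ × Ω)} (hST : ∀ p, P p.1 p.2 → p ∈ S → p ∈ T) : campbell μ S ≤ campbell μ T :=
  measure_mono_ae ((ae_campbell h).mono fun p hp => hST p hp)

section Stationary

variable {X : SystemProcess Ω Θ} {μ : Measure Ω} [IsProbabilityMeasure μ]
  {lam : Measure Θ} [IsProbabilityMeasure lam] {ν : Measure ℝ}

lemma IsStationary.campbell_shift (hst : X.IsStationary μ) (s : ℝ) {A : Set ℝ}
    (hA : MeasurableSet A) {D : Set (Θ × Action)} (hD : MeasurableSet D) :
    campbell μ {p | X.arrival p.1 p.2 - s ∈ A ∧ (X.agentType p.1 p.2, X.action p.1 p.2) ∈ D} =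
      campbell μ {p | X.arrival p.1 p.2 ∈ A ∧ (X.agentType p.1 p.2, X.action p.1 p.2) ∈ D} := by
  have := hst.campbell_view_prod s hA hD (Y := univ) MeasurableSet.univ
  convert this using 2
  · ext p; simp [view]
  · ext p; simp [view]

/-- As a function of the set of times, the mean count is translation invariant and finite on compact
sets, hence a multiple of Lebesgue measure; `freq` is the constant. -/
lemma IsStationary.campbell_mark (hst : X.IsStationary μ) (hX : X.IsAdmissible μ lam ν)
    {D : Set (Θ × Action)} (hD : MeasurableSet D) (T : ℝ) :
    campbell μ {p | X.arrival p.1 p.2 ∈ Ico 0 T ∧ (X.agentType p.1 p.2, X.action p.1 p.2) ∈ D} =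
      ENNReal.ofReal T * X.freq μ D := by
  set M : Measure ℝ := ((campbell μ).restrict
    {p | (X.agentType p.1 p.2, X.action p.1 p.2) ∈ D}).map fun p => X.arrival p.1 p.2 with hM
  have hMA : ∀ A, MeasurableSet A → M A = campbell μ {p | X.arrival p.1 p.2 ∈ A ∧
      (X.agentType p.1 p.2, X.action p.1 p.2) ∈ D} := fun A hA => by
    rw [hM, Measure.map_apply X.measurable_arrival' hA,
      Measure.restrict_apply (X.measurable_arrival' hA)]
    rfl
  have hinv : M.IsAddLeftInvariant := by
    refine ⟨fun s => ?_⟩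
    ext A hA
    rw [Measure.map_apply (measurable_const_add s) hA, hMA _ (measurable_const_add s hA),
      hMA _ hA, ← hst.campbell_shift (-s) hA hD]
    congr 1
    ext p
    simp [add_comm]
  have hfin : IsFiniteMeasureOnCompacts M := by
    refine ⟨fun K hK => ?_⟩
    obtain ⟨a, b, hab⟩ : ∃ a b : ℝ, K ⊆ Ico a b := by
      obtain ⟨r, hr⟩ := hK.isBounded.subset_closedBall 0
      refine ⟨-r, r + 1, fun x hx => ?_⟩
      have := hr hx
      rw [Metric.mem_closedBall, Real.dist_eq, sub_zero, abs_le] at this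
      exact ⟨this.1, by linarith [this.2]⟩
    refine (measure_mono hab).trans_lt ?_
    rw [hMA _ measurableSet_Ico]
    refine (measure_mono (t := {p | X.arrival p.1 p.2 ∈ Ico a b}) fun p hp => hp.1).trans_lt ?_
    rw [hst.campbell_Ico hX]
    exact ENNReal.ofReal_lt_top
  have hsm := Measure.isAddLeftInvariant_eq_smul M volume
  have h1 := hMA (Ico 0 1) measurableSet_Ico
  have hT := hMA (Ico 0 T) measurableSet_Ico
  rw [hsm, Measure.smul_apply, Real.volume_Ico] at h1 hT
  rw [freq, ← h1, ← hT]
  simp [ENNReal.smul_def, mul_comm]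

lemma IsStationary.expectedCount_eq (hst : X.IsStationary μ) (hX : X.IsAdmissible μ lam ν)
    {B : Set Θ} (hB : MeasurableSet B) (a : Action) (T : ℝ) :
    X.expectedCount μ T B a = ENNReal.ofReal T * X.freq μ (B ×ˢ {a}) := by
  have hD : MeasurableSet (B ×ˢ {a}) := hB.prod (measurableSet_singleton a)
  rw [← hst.campbell_mark hX hD T]
  have := X.lintegral_arrivalsFrom_indicator μ 0 (A := Ico 0 T) (D := B ×ˢ {a}) (Y := univ)
    measurableSet_Ico hD MeasurableSet.univ
  simp only [indicator_univ, Pi.one_apply, one_mul, pathFrom] at this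
  rw [expectedCount, this]
  congr 1
  ext p
  simp [view]

lemma freq_ne_top (hX : X.IsAdmissible μ lam ν) (D : Set (Θ × Action)) : X.freq μ D ≠ ∞ := by
  refine ((measure_mono (t := {p | X.arrival p.1 p.2 ∈ Ico (0 : ℝ) 1})
    fun p hp => hp.1).trans_lt ?_).ne
  rw [hX.campbell_Ico_zero]
  exact ENNReal.ofReal_lt_top

omit [IsProbabilityMeasure μ] in
lemma IsStationary.measure_state (hst : X.IsStationary μ) (m : MachineState) (t : ℝ) :
    μ {ω | X.state t ω = m} = μ {ω | X.state 0 ω = m} := by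
  have h : MeasurableSet {q : (ℝ → MachineState) × Measure (ℝ × Θ × Action) | q.1 0 = m} :=
    (measurable_pi_apply (X := fun _ : ℝ => MachineState) (0 : ℝ)).comp measurable_fst
      (measurableSet_singleton m)
  have := congrArg (fun M => M {q | q.1 0 = m}) (hst t)
  simp only [Measure.map_apply (X.measurable_pathFrom _) h] at this
  simpa [pathFrom] using this

lemma measurableSet_history_state (X : SystemProcess Ω Θ) {t : ℝ} (ht : t < 0) (m : MachineState) :
    MeasurableSet[X.history] {ω | X.state t ω = m} := by
  have h1 : MeasurableSpace.comap (X.state t) inferInstance ≤ X.history :=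
    (le_iSup (fun t : Set.Iio (0 : ℝ) => MeasurableSpace.comap (X.state t) inferInstance)
      ⟨t, ht⟩).trans le_sup_left
  exact h1 _ ⟨{m}, measurableSet_singleton m, rfl⟩

/-- Before the limit, the condition on the action and on the state at arrival can be dropped. What
remains is a count on the history event that the state is `m` at time `-1 / N`, which
`campbell_history` evaluates exactly. -/
lemma freq_le_of_stateBefore (hst : X.IsStationary μ) (hX : X.IsAdmissible μ lam ν)
    {a : Action} {m : MachineState}
    (ha : ∀ᵐ ω ∂μ, ∀ n, X.action n ω = a → X.StateBefore ω (X.arrival n ω) m)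
    {B : Set Θ} (hB : MeasurableSet B) :
    X.freq μ (B ×ˢ {a}) ≤ μ {ω | X.state 0 ω = m} * lam B := by
  have hD : MeasurableSet (B ×ˢ {a}) := hB.prod (measurableSet_singleton a)
  have hlim := hst.tendsto_campbell_first hX hD m m
  refine (campbell_mono_ae ha ?_).trans (le_of_tendsto hlim ?_)
  · rintro p hp ⟨h1, h2⟩
    exact ⟨h1, h2, hp h2.2, hp h2.2⟩
  · filter_upwards [eventually_gt_atTop 0] with N hN
    have hN' : (0 : ℝ) < N := by exact_mod_cast hN
    have h1 := hX.campbell_history (X.measurableSet_history_state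
      (t := -1 / N) (div_neg_of_neg_of_pos (by norm_num) hN') m) hB (1 / N)
    rw [hst.measure_state] at h1
    have h2 : (N : ℝ≥0∞) * ENNReal.ofReal (1 / N) = 1 := by
      rw [← ENNReal.ofReal_natCast, ← ENNReal.ofReal_mul hN'.le, mul_one_div_cancel hN'.ne',
        ENNReal.ofReal_one]
    have h3 : μ {ω | X.state 0 ω = m} * lam B = N * campbell μ {p | X.arrival p.1 p.2 ∈
        Ico (0 : ℝ) (1 / N) ∧ p.2 ∈ {ω | X.state (-1 / N) ω = m} ∧ X.agentType p.1 p.2 ∈ B} := by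
      rw [h1, mul_left_comm, ← mul_assoc (N : ℝ≥0∞), h2, one_mul]
    rw [h3]
    gcongr 1
    exact measure_mono fun p hp => ⟨hp.1, hp.2.2.1, hp.2.1.1⟩

end Stationary

end SystemProcess

/-- The uniform distribution on the unit interval. -/
noncomputable abbrev unif : Measure ℝ := volume.restrict (Set.Icc (0 : ℝ) 1)

instance : IsProbabilityMeasure unif := ⟨by simp [unif]⟩

lemma unif_Iio {c : ℝ} (h : c ∈ Icc (0 : ℝ) 1) : unif {u | u < c} = ENNReal.ofReal c := by
  have e : {u : ℝ | u < c} = Iio c := rfl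
  rw [unif, e, Measure.restrict_apply measurableSet_Iio]
  have : Iio c ∩ Icc 0 1 = Ico 0 c := by
    ext u
    simp only [mem_inter_iff, mem_Iio, mem_Icc, mem_Ico]
    constructor
    · rintro ⟨h1, h2, h3⟩
      exact ⟨h2, h1⟩
    · rintro ⟨h1, h2⟩
      exact ⟨h2, h1, h2.le.trans h.2⟩
  rw [this, Real.volume_Ico, sub_zero]

/-! ### Frequencies under a Markovian mechanism -/

namespace MarkovianMechanism

open SystemProcess

variable {Ω : Type*} [MeasurableSpace Ω] {Θ : Type*} [MeasurableSpace Θ]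

lemma prod_unif_lt (σ : MarkovianMechanism Θ) (lam : Measure Θ) [SFinite lam] (m : MachineState)
    {B : Set Θ} (hB : MeasurableSet B) :
    (lam.prod unif) {q | q.1 ∈ B ∧ q.2 < σ.prob (q.1, m)} =
      ∫⁻ θ in B, ENNReal.ofReal (σ.prob (θ, m)) ∂lam := by
  have hm : MeasurableSet {q : Θ × ℝ | q.1 ∈ B ∧ q.2 < σ.prob (q.1, m)} := by
    refine (measurable_fst hB).inter (measurableSet_lt measurable_snd ?_)
    exact σ.measurable_prob.comp (measurable_fst.prodMk measurable_const)
  rw [Measure.prod_apply hm, ← lintegral_indicator hB]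
  refine lintegral_congr fun θ => ?_
  by_cases hθ : θ ∈ B
  · rw [indicator_of_mem hθ, ← unif_Iio (σ.prob_mem _)]
    congr 1
    ext u
    simp [hθ]
  · rw [indicator_of_notMem hθ]
    convert measure_empty (μ := unif)
    ext u
    simp [hθ]

/-- The randomizations can be chosen to be measurable. -/
lemma IsCompatible.exists_measurable {σ : MarkovianMechanism Θ} {X : SystemProcess Ω Θ}
    {μ : Measure Ω} [IsProbabilityMeasure μ] {lam : Measure Θ} [IsProbabilityMeasure lam]
    (h : σ.IsCompatible X μ lam) :
    ∃ V : ℕ → Ω → ℝ, (∀ n, Measurable (V n)) ∧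
      HasLaw (fun ω n => (X.waitingTime n ω, (X.agentType (n + 1) ω, V n ω)))
        (Measure.infinitePi fun _ : ℕ => (expMeasure 1).prod (lam.prod unif)) μ ∧
      (∀ H : Set Ω, MeasurableSet[X.history] H → ∀ S : Set (ℕ → ℝ × Θ × ℝ), MeasurableSet S →
        μ (H ∩ (fun ω n => (X.waitingTime n ω, (X.agentType (n + 1) ω, V n ω))) ⁻¹' S) =
          μ H * μ ((fun ω n => (X.waitingTime n ω, (X.agentType (n + 1) ω, V n ω))) ⁻¹' S)) ∧
      ∀ᵐ ω ∂μ, ∀ n : ℕ,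
        (X.StateBefore ω (X.arrival (n + 1) ω) MachineState.working →
          (X.action (n + 1) ω = Action.usage ↔
            V n ω < σ.prob (X.agentType (n + 1) ω, MachineState.working))) ∧
        (X.StateBefore ω (X.arrival (n + 1) ω) MachineState.broken →
          (X.action (n + 1) ω = Action.contribution ↔
            V n ω < σ.prob (X.agentType (n + 1) ω, MachineState.broken))) := by
  obtain ⟨U, hlaw, hind, hact⟩ := h
  set Y : Ω → ℕ → (ℝ × Θ) × ℝ := fun ω n => (X.futureArrivals ω n, U n ω) with hY
  set Y' := hlaw.aemeasurable.mk Y with hY'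
  have hYm : Measurable Y' := hlaw.aemeasurable.measurable_mk
  have hae : Y =ᵐ[μ] Y' := hlaw.aemeasurable.ae_eq_mk
  set V : ℕ → Ω → ℝ := fun n ω => (Y' ω n).2 with hV
  have hVU : ∀ᵐ ω ∂μ, ∀ n, V n ω = U n ω := by
    filter_upwards [hae] with ω hω n
    rw [hV]
    simp only
    rw [← hω]
  set asc : (ℕ → (ℝ × Θ) × ℝ) → ℕ → ℝ × Θ × ℝ :=
    fun y n => MeasurableEquiv.prodAssoc (y n) with hasc
  have hascm : Measurable asc := measurable_pi_lambda _ fun n =>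
    MeasurableEquiv.prodAssoc.measurable.comp (measurable_pi_apply n)
  have hW : (fun ω n => (X.waitingTime n ω, (X.agentType (n + 1) ω, V n ω))) =ᵐ[μ]
      asc ∘ Y := by
    filter_upwards [hVU] with ω hω
    funext n
    simp [hasc, hY, MeasurableEquiv.prodAssoc, futureArrivals, hω]
  refine ⟨V, fun n => measurable_snd.comp ((measurable_pi_apply n).comp hYm), ?_, ?_, ?_⟩
  · refine HasLaw.congr ?_ hW
    refine HasLaw.comp ⟨hascm.aemeasurable, ?_⟩ hlaw
    rw [hasc, Measure.infinitePi_map_pi _ fun _ => MeasurableEquiv.prodAssoc.measurable]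
    simp_rw [Measure.prodAssoc_prod]
  · intro H hH S hS
    have e : (fun ω n => (X.waitingTime n ω, (X.agentType (n + 1) ω, V n ω))) ⁻¹' S =ᵐ[μ]
        Y ⁻¹' (asc ⁻¹' S) := by
      filter_upwards [hW] with ω hω
      exact congrArg (· ∈ S) hω
    rw [measure_congr e, measure_congr ((ae_eq_refl H).inter e)]
    exact (Indep_iff _ _ μ).1 hind _ _ hH ⟨_, hascm hS, rfl⟩
  · filter_upwards [hact, hVU] with ω h1 h2 n
    simpa only [h2] using h1 n

/-- The randomization joins the type as part of a mark that is independent of the history. Among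
arrivals soon after a time in state `m`, the mean count of those directed to act is exactly the
right-hand side. Direction and action differ only if the state changed to `m'` before the arrival,
and by `hlim'` such arrivals have vanishing frequency. -/
lemma freq_eq_of_randomization {σ : MarkovianMechanism Θ} {X : SystemProcess Ω Θ}
    {μ : Measure Ω} [IsProbabilityMeasure μ] {lam : Measure Θ} [IsProbabilityMeasure lam]
    {ν : Measure ℝ} (hst : X.IsStationary μ) (hX : X.IsAdmissible μ lam ν)
    {V : ℕ → Ω → ℝ} (hV : ∀ n, Measurable (V n))
    (hlaw : HasLaw (fun ω n => (X.waitingTime n ω, (X.agentType (n + 1) ω, V n ω)))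
        (Measure.infinitePi fun _ : ℕ => (expMeasure 1).prod (lam.prod unif)) μ)
    (hind : ∀ H : Set Ω, MeasurableSet[X.history] H → ∀ S : Set (ℕ → ℝ × Θ × ℝ), MeasurableSet S →
        μ (H ∩ (fun ω n => (X.waitingTime n ω, (X.agentType (n + 1) ω, V n ω))) ⁻¹' S) =
          μ H * μ ((fun ω n => (X.waitingTime n ω, (X.agentType (n + 1) ω, V n ω))) ⁻¹' S))
    {a : Action} {m m' : MachineState} (hmm : m ≠ m')
    (hm : ∀ ω t, X.StateBefore ω t m ∨ X.StateBefore ω t m')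
    (ha : ∀ᵐ ω ∂μ, ∀ n, X.action n ω = a → X.StateBefore ω (X.arrival n ω) m)
    (hact : ∀ᵐ ω ∂μ, ∀ n : ℕ, X.StateBefore ω (X.arrival (n + 1) ω) m →
      (X.action (n + 1) ω = a ↔ V n ω < σ.prob (X.agentType (n + 1) ω, m)))
    {B : Set Θ} (hB : MeasurableSet B) :
    X.freq μ (B ×ˢ {a}) =
      μ {ω | X.state 0 ω = m} * ∫⁻ θ in B, ENNReal.ofReal (σ.prob (θ, m)) ∂lam := by
  have hD : MeasurableSet (B ×ˢ {a}) := hB.prod (measurableSet_singleton a)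
  have hlim := hst.tendsto_campbell_first hX hD m m
  have hlim' := hst.tendsto_campbell_first hX (D := univ) MeasurableSet.univ m m'
  have hfreq : campbell μ {p | X.arrival p.1 p.2 ∈ Ico (0 : ℝ) 1 ∧
        (X.agentType p.1 p.2, X.action p.1 p.2) ∈ B ×ˢ {a} ∧
        X.StateBefore p.2 (X.arrival p.1 p.2) m ∧
        X.StateBefore p.2 (X.arrival p.1 p.2) m} = X.freq μ (B ×ˢ {a}) := by
    refine le_antisymm (measure_mono fun p hp => ⟨hp.1, hp.2.1⟩) (campbell_mono_ae ha ?_)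
    rintro p hp ⟨h1, h2⟩
    exact ⟨h1, h2, hp h2.2, hp h2.2⟩
  have hzero : campbell μ {p | X.arrival p.1 p.2 ∈ Ico (0 : ℝ) 1 ∧
        (X.agentType p.1 p.2, X.action p.1 p.2) ∈ univ ∧
        X.StateBefore p.2 (X.arrival p.1 p.2) m ∧
        X.StateBefore p.2 (X.arrival p.1 p.2) m'} = 0 := by
    convert measure_empty (μ := campbell μ)
    ext p
    simp only [mem_ofPred_eq, mem_empty_iff_false, iff_false]
    rintro ⟨-, -, h1, h2⟩
    exact hmm (stateBefore_unique h1 h2)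
  rw [hfreq] at hlim
  rw [hzero] at hlim'
  have hact' : ∀ᵐ ω ∂μ, ∀ n : ℤ, X.arrival n ω ∈ Ici (0 : ℝ) →
      X.StateBefore ω (X.arrival n ω) m →
      (X.action n ω = a ↔ V (n - 1).toNat ω < σ.prob (X.agentType n ω, m)) := by
    filter_upwards [hact] with ω hω n hn
    have h1 := (X.arrival_nonneg_iff ω n).1 hn
    have := hω (n - 1).toNat
    have e : (((n - 1).toNat : ℕ) : ℤ) + 1 = n := by omega
    rwa [e] at this
  -- The count of directed agents, whatever state they meet on arrival; it does not depend on `N`.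
  have hb : ∀ N : ℕ, 0 < N → N * campbell μ {p | X.arrival p.1 p.2 ∈ Ico (0 : ℝ) (1 / N) ∧
      X.state (-1 / N) p.2 = m ∧ X.agentType p.1 p.2 ∈ B ∧
      V (p.1 - 1).toNat p.2 < σ.prob (X.agentType p.1 p.2, m)} =
      μ {ω | X.state 0 ω = m} * ∫⁻ θ in B, ENNReal.ofReal (σ.prob (θ, m)) ∂lam := by
    intro N hN
    have hN' : (0 : ℝ) < N := by exact_mod_cast hN
    have hH := X.measurableSet_history_state
      (t := -1 / N) (div_neg_of_neg_of_pos (by norm_num) hN') m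
    have hC : MeasurableSet {q : Θ × ℝ | q.1 ∈ B ∧ q.2 < σ.prob (q.1, m)} := by
      refine (measurable_fst hB).inter (measurableSet_lt measurable_snd ?_)
      exact σ.measurable_prob.comp (measurable_fst.prodMk measurable_const)
    have h1 := X.campbell_future μ (lam.prod unif)
      (Z := fun n ω => (X.agentType (n + 1) ω, V n ω))
      (fun n => (X.measurable_agentType _).prodMk (hV n)) hlaw (X.history_le _ hH)
      (hind _ hH) hC (1 / N)
    rw [hst.measure_state, prod_unif_lt σ lam m hB] at h1
    have h2 : (N : ℝ≥0∞) * ENNReal.ofReal (1 / N) = 1 := by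
      rw [← ENNReal.ofReal_natCast, ← ENNReal.ofReal_mul hN'.le, mul_one_div_cancel hN'.ne',
        ENNReal.ofReal_one]
    rw [← one_mul (lintegral _ _), ← h2, mul_assoc (N : ℝ≥0∞), mul_left_comm, ← h1]
    congr 2
    ext p
    simp only [mem_ofPred_eq]
    refine and_congr_right fun hp => and_congr_right fun _ => ?_
    have h3 := (X.arrival_nonneg_iff _ _).1 hp.1
    have e : (((p.1 - 1).toNat : ℕ) : ℤ) + 1 = p.1 := by omega
    rw [e]
  apply le_antisymm
  · refine le_of_tendsto hlim ?_
    filter_upwards [eventually_gt_atTop 0] with N hN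
    rw [← hb N hN]
    gcongr 1
    refine campbell_mono_ae hact' ?_
    rintro p hp ⟨h1, ⟨h2, h3⟩, h4, h5⟩
    exact ⟨h1, h4, h2, (hp h1.1 h5).1 h3⟩
  -- A directed agent either meets the state `m` and acts, or meets `m'`; the second count tends to
  -- 0.
  · have hsum := hlim.add hlim'
    rw [add_zero] at hsum
    refine ge_of_tendsto hsum ?_
    filter_upwards [eventually_gt_atTop 0] with N hN
    rw [← hb N hN, ← mul_add]
    gcongr 1
    refine (campbell_mono_ae hact' ?_).trans (measure_union_le _ _)
    rintro p hp ⟨h1, h2, h3, h4⟩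
    rcases hm p.2 (X.arrival p.1 p.2) with h | h
    · exact Or.inl ⟨h1, ⟨h3, (hp h1.1 h).2 h4⟩, h2, h⟩
    · exact Or.inr ⟨h1, mem_univ _, h2, h⟩

end MarkovianMechanism

end Upkeep

/-! ### The renewal argument along a single path -/

namespace Upkeep

open scoped ENNReal NNReal

lemma exists_count_eq_of_lt_count {p : ℕ → Prop} [DecidablePred p] {i K : ℕ}
    (h : i < Nat.count p K) : ∃ k < K, p k ∧ Nat.count p k = i := by
  induction K with
  | zero => simp at h
  | succ K ih =>
    rw [Nat.count_succ] at h
    by_cases hi : i < Nat.count p K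
    · obtain ⟨k, hk, hp⟩ := ih hi
      exact ⟨k, by omega, hp⟩
    · split_ifs at h with hK
      · exact ⟨K, by omega, hK, by omega⟩
      · omega

/-- The renewal argument for partial sums `S` of lifespans that obey the law of large numbers. -/
lemma tendsto_count_sub_uptime {ρ D : ℝ} (hρ : 0 < ρ) {S w : ℕ → ℝ} {c : ℕ → ℕ}
    (hS : Tendsto (fun m => S m / m) atTop (𝓝 (1 / ρ))) (hc : Tendsto c atTop atTop)
    (hlow : ∀ n, S (c n - 1) ≤ w n) (hup : ∀ n, w n ≤ D + S (c n)) (hw : ∀ n, w n ≤ n) :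
    Tendsto (fun n : ℕ => (c n : ℝ) / n - ρ * (w n / n)) atTop (𝓝 0) := by
  -- The relative error of `ρ * S m` as an approximation of `m`.
  set e : ℕ → ℝ := fun m => ρ * (S m / m) - 1 with he
  have he0 : Tendsto e atTop (𝓝 0) := by
    have := (hS.const_mul ρ).sub_const 1
    rwa [mul_one_div_cancel hρ.ne', sub_self] at this
  have hSe : ∀ m : ℕ, 0 < m → ρ * S m = m * (1 + e m) := fun m hm => by
    have : (m : ℝ) ≠ 0 := by positivity
    simp only [he]; field_simp; ring
  have hc1 : Tendsto (fun n => c n - 1) atTop atTop := (tendsto_sub_atTop_nat 1).comp hc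
  have hec := he0.comp hc
  have hec1 := he0.comp hc1
  -- The terms account for the initial time `D`, the lifespan that may be incomplete at time `n`,
  -- and the errors `e` at `c n` and `c n - 1`; the factor `2 * ρ + 1` bounds `c n / n`.
  have hbound : Tendsto (fun n : ℕ => ρ * |D| / n + 1 / n + (2 * ρ + 1) *
      (|e (c n)| + |e (c n - 1)|)) atTop (𝓝 0) := by
    have h1 := tendsto_const_div_atTop_nhds_zero_nat (ρ * |D|)
    have h2 := tendsto_const_div_atTop_nhds_zero_nat (1 : ℝ)
    have h3 := (hec.abs.add hec1.abs).const_mul (2 * ρ + 1)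
    simpa using (h1.add h2).add h3
  refine squeeze_zero_norm' ?_ hbound
  filter_upwards [eventually_gt_atTop 0, hc.eventually_ge_atTop 2,
    hec1.eventually (Ioo_mem_nhds (show (-1 / 2 : ℝ) < 0 by norm_num) one_pos)] with n hn hcn hen
  have hn' : (1 : ℝ) ≤ n := by exact_mod_cast hn
  have hn0 : (0 : ℝ) < n := by linarith
  have h1 := hSe (c n - 1) (by omega)
  have h2 := hSe (c n) (by omega)
  have hcast : ((c n - 1 : ℕ) : ℝ) = c n - 1 := by rw [Nat.cast_sub (by omega)]; simp
  rw [hcast] at h1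
  have hcn' : (2 : ℝ) ≤ c n := by exact_mod_cast hcn
  simp only [Function.comp_apply] at hen
  set a := e (c n - 1)
  set b := e (c n)
  set C : ℝ := ((c n : ℕ) : ℝ)
  have hl := mul_le_mul_of_nonneg_left (hlow n) hρ.le
  have hu := mul_le_mul_of_nonneg_left (hup n) hρ.le
  have hwn := mul_le_mul_of_nonneg_left (hw n) hρ.le
  rw [h1] at hl
  rw [mul_add, h2] at hu
  -- As `1 + a > 1 / 2`, the lower bound on `w n` gives `C - 1 ≤ 2 * ρ * n`, and `1 ≤ n` absorbs the
  -- rest.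
  have hC : C ≤ (2 * ρ + 1) * n := by nlinarith [hen.1]
  have ha1 := neg_abs_le a
  have ha2 := le_abs_self a
  have hb2 := le_abs_self b
  have hD := le_abs_self D
  have e1 : C / n - ρ * (w n / n) = (C - ρ * w n) / n := by field_simp
  have e2 : ρ * |D| / n + 1 / n + (2 * ρ + 1) * (|b| + |a|) =
      (ρ * |D| + 1 + (2 * ρ + 1) * n * (|b| + |a|)) / n := by field_simp
  rw [e1, e2, Real.norm_eq_abs, abs_div, abs_of_pos hn0]
  gcongr
  have hCa : C * |a| ≤ (2 * ρ + 1) * n * |a| := by gcongr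
  have hCb : C * |b| ≤ (2 * ρ + 1) * n * |b| := by gcongr
  have hab : -(C - 1) * a ≤ C * |a| := by nlinarith [abs_nonneg a]
  have hbb : C * b ≤ C * |b| := by gcongr
  have hDD : ρ * D ≤ ρ * |D| := by gcongr
  have h3 := mul_nonneg (mul_nonneg (by positivity : 0 ≤ 2 * ρ + 1) hn0.le) (abs_nonneg a)
  have h4 := mul_nonneg (mul_nonneg (by positivity : 0 ≤ 2 * ρ + 1) hn0.le) (abs_nonneg b)
  have h5 := mul_nonneg hρ.le (abs_nonneg D)
  rw [abs_le]
  constructor <;> nlinarith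

namespace SystemProcess

variable {Ω : Type*} [MeasurableSpace Ω] {Θ : Type*} [MeasurableSpace Θ]

section Path

variable (X : SystemProcess Ω Θ) (ω : Ω)

/-- The machine works during the lifespan that starts with a contribution, and not only then if it
keeps working. -/
lemma working_of_lt_lifespan {i : ℕ} (h : X.Fixes ω (Nat.nth (X.Fixes ω) i)) {s : ℝ} (h0 : 0 ≤ s)
    (hs : s < X.lifespan i ω) :
    X.state (X.arrival (Nat.nth (X.Fixes ω) i + 1) ω + s) ω = .working := by
  rcases h0.eq_or_lt with rfl | h0
  · rw [add_zero]
    exact X.working_of_contribution ω _ h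
  · have : s ∉ {s : ℝ | 0 < s ∧
      X.state (X.arrival (Nat.nth (X.Fixes ω) i + 1) ω + s) ω = MachineState.broken} := by
      intro hmem
      exact absurd (csInf_le ⟨0, fun x hx => hx.1.le⟩ hmem) (not_le.2 hs)
    cases hst : X.state (X.arrival (Nat.nth (X.Fixes ω) i + 1) ω + s) ω with
    | working => rfl
    | broken => exact absurd ⟨h0, hst⟩ this

/-- Right-continuity at the end of the interval keeps the machine working a little longer, hence the
strict inequality. The hypothesis `hb` excludes the default value `sInf ∅ = 0`. -/
lemma lt_lifespan {i : ℕ} (hb : ∃ s, 0 < s ∧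
      X.state (X.arrival (Nat.nth (X.Fixes ω) i + 1) ω + s) ω = MachineState.broken)
    {s : ℝ} (hs : ∀ r ∈ Icc 0 s,
      X.state (X.arrival (Nat.nth (X.Fixes ω) i + 1) ω + r) ω = .working)
    (h0 : 0 ≤ s) : s < X.lifespan i ω := by
  set A := X.arrival (Nat.nth (X.Fixes ω) i + 1) ω
  have hr := X.state_rightCont ω (A + s)
  rw [hs s ⟨h0, le_rfl⟩] at hr
  obtain ⟨b, hb1, hb2⟩ := (mem_nhdsGT_iff_exists_Ioo_subset).1 hr
  have hb1 : A + s < b := hb1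
  have : b - A ≤ X.lifespan i ω := by
    refine le_csInf hb fun r hr' => ?_
    by_contra hlt
    push Not at hlt
    have hrw : X.state (A + r) ω = .working := by
      by_cases hrs : r ≤ s
      · exact hs r ⟨hr'.1.le, hrs⟩
      · exact hb2 ⟨by linarith, by linarith⟩
    rw [hr'.2] at hrw
    cases hrw
  linarith

lemma lifespan_nonneg (i : ℕ) : 0 ≤ X.lifespan i ω :=
  Real.sInf_nonneg fun _ hs => hs.1.le

/-- The number of agents who arrive during `[0, n)`. -/
noncomputable def arrivalCount (n : ℕ) : ℕ := sInf {k : ℕ | (n : ℝ) ≤ X.arrival (k + 1) ω}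

lemma lt_arrivalCount_iff (n k : ℕ) :
    k < X.arrivalCount ω n ↔ X.arrival (k + 1) ω < n := by
  have hne : {k : ℕ | (n : ℝ) ≤ X.arrival (k + 1) ω}.Nonempty := by
    have h1 := (X.arrival_tendsto_atTop ω).eventually_ge_atTop (n : ℝ)
    have h2 : Tendsto (fun k : ℕ => (k : ℤ) + 1) atTop atTop :=
      tendsto_atTop_add_const_right _ _ tendsto_natCast_atTop_atTop
    exact (h2.eventually h1).exists
  constructor
  · intro h
    by_contra hk
    have h1 : X.arrivalCount ω n ≤ k := Nat.sInf_le (not_lt.1 hk)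
    omega
  · intro h
    by_contra hk
    have h1 : (n : ℝ) ≤ X.arrival (X.arrivalCount ω n + 1) ω := Nat.sInf_mem hne
    have h2 := (X.arrival_strictMono ω).monotone
      (show (X.arrivalCount ω n : ℤ) + 1 ≤ k + 1 by exact_mod_cast Nat.succ_le_succ (not_lt.1 hk))
    linarith [h2, h1]

open Classical in
/-- The number of agents who arrive and contribute during `[0, n)`. -/
noncomputable def fixCount (n : ℕ) : ℕ := Nat.count (X.Fixes ω) (X.arrivalCount ω n)

lemma fixes_nth_of_lt_fixCount {n i : ℕ} (h : i < X.fixCount ω n) :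
    X.Fixes ω (Nat.nth (X.Fixes ω) i) ∧ X.arrival (Nat.nth (X.Fixes ω) i + 1) ω < n := by
  classical
  obtain ⟨k, hk, hf, rfl⟩ := exists_count_eq_of_lt_count h
  rw [Nat.nth_count hf]
  exact ⟨hf, (X.lt_arrivalCount_iff ω n k).1 hk⟩

lemma exists_lt_fixCount {n k : ℕ} (hk : X.Fixes ω k) (hn : X.arrival (k + 1) ω < n) :
    ∃ i < X.fixCount ω n, Nat.nth (X.Fixes ω) i = k := by
  classical
  exact ⟨Nat.count (X.Fixes ω) k, Nat.count_strict_mono hk ((X.lt_arrivalCount_iff ω n k).2 hn),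
    Nat.nth_count hk⟩

lemma nth_lt_nth_of_lt_fixCount {n i j : ℕ} (hij : i < j) (h : j < X.fixCount ω n) :
    Nat.nth (X.Fixes ω) i < Nat.nth (X.Fixes ω) j := by
  classical
  obtain ⟨k, hk, hf, rfl⟩ := exists_count_eq_of_lt_count h
  rw [Nat.nth_count hf]
  exact Nat.nth_lt_of_lt_count hij

lemma arrivalsFrom_contribution (n : ℕ) :
    X.arrivalsFrom 0 ω (Ico 0 (n : ℝ) ×ˢ univ ×ˢ {Action.contribution}) = X.fixCount ω n := by
  classical
  rw [arrivalsFrom, Measure.sum_apply _ (measurableSet_Ico.prod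
    (MeasurableSet.univ.prod (measurableSet_singleton _)))]
  have hinj : Function.Injective fun n : ℕ => (n + 1 : ℤ) := fun a b hab => by simpa using hab
  have hterm : ∀ k : ℤ, Measure.dirac (X.arrival k ω - 0, X.agentType k ω, X.action k ω)
      (Ico 0 (n : ℝ) ×ˢ univ ×ˢ {Action.contribution}) =
      if (0 ≤ X.arrival k ω ∧ X.arrival k ω < n) ∧ X.action k ω = .contribution
        then (1 : ℝ≥0∞) else 0 := fun k => by
    rw [Measure.dirac_apply' _ (measurableSet_Ico.prod
      (MeasurableSet.univ.prod (measurableSet_singleton _)))]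
    simp [indicator]
  simp_rw [hterm]
  rw [← hinj.tsum_eq]
  · rw [tsum_eq_sum (s := Finset.range (X.arrivalCount ω n))]
    · rw [fixCount, Nat.count_eq_card_filter_range, Finset.card_filter]
      push_cast
      refine Finset.sum_congr rfl fun k hk => ?_
      have h1 := (X.lt_arrivalCount_iff ω n k).1 (Finset.mem_range.1 hk)
      have h0 := (X.arrival_nonneg_iff ω (k + 1)).2 (by omega)
      by_cases h2 : X.action (k + 1) ω = .contribution <;> simp [h1, h0, Fixes, h2]
    · intro k hk
      have h1 := mt (X.lt_arrivalCount_iff ω n k).2 (mt Finset.mem_range.2 hk)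
      simp [h1]
  · intro k hk
    by_contra hk'
    apply hk
    have : ¬ (1 ≤ k) := fun h1 => hk' ⟨(k - 1).toNat, by simp; omega⟩
    rw [← X.arrival_nonneg_iff ω] at this
    simp [this]

/-- The length of time during `[0, n)` when the machine works. -/
noncomputable def workTime (n : ℕ) : ℝ≥0∞ :=
  volume {t : ℝ | t ∈ Ico 0 (n : ℝ) ∧ X.state t ω = .working}

lemma workTime_le (n : ℕ) : X.workTime ω n ≤ n := by
  refine (measure_mono (t := Ico 0 (n : ℝ)) fun t ht => ht.1).trans ?_
  simp

variable {X ω}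

/-- After the broken time `D`, every working time belongs to a life that started with a repair after
time `0`: the working times are covered by `[0, D)` and the lives of the repairs in `[0, n)`. -/
lemma workTime_le_of_breaks {D : ℝ} (hD0 : 0 ≤ D) (hD : X.state D ω = .broken)
    (hbr : ∀ t, X.state t ω = .working → ∃ s, t < s ∧ X.state s ω = .broken) (n : ℕ) :
    X.workTime ω n ≤ ENNReal.ofReal (D + ∑ i ∈ Finset.range (X.fixCount ω n), X.lifespan i ω) := by
  set A : ℕ → ℝ := fun i => X.arrival (Nat.nth (X.Fixes ω) i + 1) ω with hA
  have hsub : {t : ℝ | t ∈ Ico 0 (n : ℝ) ∧ X.state t ω = .working} ⊆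
      Ico 0 D ∪ ⋃ i ∈ Finset.range (X.fixCount ω n), Ico (A i) (A i + X.lifespan i ω) := by
    rintro t ⟨⟨ht0, htn⟩, htw⟩
    by_cases htD : t < D
    · exact Or.inl ⟨ht0, htD⟩
    push Not at htD
    refine Or.inr ?_
    -- The supremum `r` of the broken times up to `t` is the time of the repair: right-continuity
    -- makes the machine work at `r`, while the left limit at `r` is broken.
    set Bk := {s : ℝ | s ∈ Icc 0 t ∧ X.state s ω = .broken} with hBk
    have hne : Bk.Nonempty := ⟨D, ⟨hD0, htD⟩, hD⟩
    have hbdd : BddAbove Bk := ⟨t, fun s hs => hs.1.2⟩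
    set r := sSup Bk with hr
    have hr0 : 0 ≤ r := hD0.trans (le_csSup hbdd ⟨⟨hD0, htD⟩, hD⟩)
    have hrt : r ≤ t := csSup_le hne fun s hs => hs.1.2
    have hafter : ∀ s, r < s → s ≤ t → X.state s ω = .working := by
      intro s hs hst
      cases h : X.state s ω with
      | working => rfl
      | broken => exact absurd (le_csSup hbdd ⟨⟨hr0.trans hs.le, hst⟩, h⟩) (not_le.2 hs)
    have hrw : X.state r ω = .working := by
      cases h : X.state r ω with
      | working => rfl
      | broken =>
        have hlt : r < t := lt_of_le_of_ne hrt fun e => by rw [e, htw] at h; cases h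
        have h1 := X.state_rightCont ω r
        have h2 : ∀ᶠ s in 𝓝[>] r, s ≤ t := by
          filter_upwards [Ioo_mem_nhdsGT hlt] with s hs using hs.2.le
        obtain ⟨s, ⟨h3, h4⟩, h5⟩ := ((h1.and h2).and self_mem_nhdsWithin).exists
        rw [h, hafter s h5 h4] at h3
        cases h3
    have hbefore : ∀ᶠ s in 𝓝[<] r, X.state s ω = .broken := by
      obtain ⟨m, hm⟩ := X.state_leftLim ω r
      cases m with
      | broken => exact hm
      | working =>
        exfalso
        obtain ⟨l, hl, hl'⟩ := (mem_nhdsLT_iff_exists_Ioo_subset).1 hm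
        obtain ⟨s, hs, hls⟩ := exists_lt_of_lt_csSup hne (show l < sSup Bk from hl)
        have hsr : s ≤ r := le_csSup hbdd hs
        have hsr' : s ≠ r := fun e => by
          have := hs.2
          rw [e, hrw] at this
          cases this
        have := hl' ⟨hls, lt_of_le_of_ne hsr hsr'⟩
        have h2 := hs.2
        simp only [mem_ofPred_eq] at this
        rw [this] at h2
        cases h2
    obtain ⟨k, hk, hka⟩ := X.contribution_of_fixed ω r hbefore hrw
    have hk1 := (X.arrival_nonneg_iff ω k).1 (hk ▸ hr0)
    obtain ⟨k', rfl⟩ : ∃ k' : ℕ, k = k' + 1 := ⟨(k - 1).toNat, by omega⟩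
    obtain ⟨i, hi, hik⟩ := X.exists_lt_fixCount ω (k := k') hka
      (by rw [hk]; exact lt_of_le_of_lt hrt htn)
    simp only [mem_iUnion, Finset.mem_range]
    have hAi : A i = r := by rw [hA]; simp only; rw [hik, hk]
    refine ⟨i, hi, hAi ▸ hrt, ?_⟩
    have hwork : ∀ s ∈ Icc 0 (t - r), X.state (A i + s) ω = .working := by
      rintro s ⟨hs0, hs1⟩
      rw [hAi]
      rcases hs0.eq_or_lt with rfl | hs0
      · rwa [add_zero]
      · exact hafter _ (by linarith) (by linarith)
    have := X.lt_lifespan ω (i := i) (s := t - r) ?_ hwork (by linarith)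
    · rw [hAi]; linarith
    · obtain ⟨s, hs, hs'⟩ := hbr (A i) (by rw [hAi]; exact hrw)
      refine ⟨s - A i, by linarith, ?_⟩
      rw [← hs']
      congr 1
      simp [hA]
  refine (measure_mono hsub).trans ((measure_union_le _ _).trans ?_)
  rw [ENNReal.ofReal_add hD0 (Finset.sum_nonneg fun i _ => X.lifespan_nonneg ω i)]
  refine add_le_add (by simp) ((measure_biUnion_finset_le _ _).trans ?_)
  rw [ENNReal.ofReal_sum_of_nonneg fun i _ => X.lifespan_nonneg ω i]
  gcongr with i
  simp

/-- Otherwise the later contributor would encounter a working machine. -/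
lemma add_lifespan_le_arrival
    (hcb : ∀ n, X.action n ω = .contribution → X.StateBefore ω (X.arrival n ω) .broken)
    {i j n : ℕ} (hij : i < j) (hj : j < X.fixCount ω n) :
    X.arrival (Nat.nth (X.Fixes ω) i + 1) ω + X.lifespan i ω ≤
      X.arrival (Nat.nth (X.Fixes ω) j + 1) ω := by
  by_contra hlt
  push Not at hlt
  have hi := X.fixes_nth_of_lt_fixCount ω (hij.trans hj)
  have hjj := X.fixes_nth_of_lt_fixCount ω hj
  have hAA : X.arrival (Nat.nth (X.Fixes ω) i + 1) ω < X.arrival (Nat.nth (X.Fixes ω) j + 1) ω :=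
    X.arrival_strictMono ω (by have := X.nth_lt_nth_of_lt_fixCount ω hij hj; omega)
  have h1 : X.StateBefore ω (X.arrival (Nat.nth (X.Fixes ω) j + 1) ω) .working := by
    filter_upwards [Ioo_mem_nhdsLT hAA] with s hs
    have := X.working_of_lt_lifespan ω hi.1 (s := s - X.arrival (Nat.nth (X.Fixes ω) i + 1) ω)
      (by linarith [hs.1]) (by linarith [hs.2])
    rwa [add_sub_cancel] at this
  have := stateBefore_unique h1 (hcb _ hjj.1)
  cases this

/-- Only the last life that starts in `[0, n)` can extend beyond `n`. The others are disjoint and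
end before the next repair; natural subtraction covers the case without repairs. -/
lemma le_workTime
    (hcb : ∀ n, X.action n ω = .contribution → X.StateBefore ω (X.arrival n ω) .broken) (n : ℕ) :
    ENNReal.ofReal (∑ i ∈ Finset.range (X.fixCount ω n - 1), X.lifespan i ω) ≤ X.workTime ω n := by
  set A : ℕ → ℝ := fun i => X.arrival (Nat.nth (X.Fixes ω) i + 1) ω with hA
  rw [ENNReal.ofReal_sum_of_nonneg fun i _ => X.lifespan_nonneg ω i]
  have h1 : ∀ i, ENNReal.ofReal (X.lifespan i ω) = volume (Ico (A i) (A i + X.lifespan i ω)) :=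
    fun i => by simp
  simp_rw [h1]
  rw [← measure_biUnion_finset _ fun i _ => measurableSet_Ico]
  · refine measure_mono (iUnion₂_subset fun i hi t ht => ?_)
    rw [Finset.mem_range] at hi
    have hi1 : i + 1 < X.fixCount ω n := by omega
    have h2 := add_lifespan_le_arrival hcb (Nat.lt_succ_self i) hi1
    have h3 := X.fixes_nth_of_lt_fixCount ω hi1
    have h4 := X.fixes_nth_of_lt_fixCount ω (i := i) (n := n) (by omega)
    have h5 : 0 ≤ A i := (X.arrival_nonneg_iff ω _).2 (by omega)
    refine ⟨⟨h5.trans ht.1, (ht.2.trans_le h2).trans h3.2⟩, ?_⟩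
    have := X.working_of_lt_lifespan ω h4.1 (s := t - A i) (by linarith [ht.1]) (by linarith [ht.2])
    rwa [add_sub_cancel] at this
  · have key : ∀ i j, i < j → j < X.fixCount ω n →
        Disjoint (Ico (A i) (A i + X.lifespan i ω)) (Ico (A j) (A j + X.lifespan j ω)) := by
      intro i j hij hj
      have := add_lifespan_le_arrival hcb hij hj
      exact Set.disjoint_left.2 fun t h h' => absurd (h.2.trans_le this) (not_lt.2 h'.1)
    intro i hi j hj hij
    simp only [Finset.coe_range, mem_Iio] at hi hj
    rcases lt_or_gt_of_ne hij with h | h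
    · exact key i j h (by omega)
    · exact (key j i h (by omega)).symm

lemma tendsto_fixCount (h : {n | X.Fixes ω n}.Infinite) :
    Tendsto (X.fixCount ω) atTop atTop := by
  classical
  refine tendsto_atTop.2 fun m => ?_
  have h1 : Tendsto (fun n : ℕ => (n : ℝ)) atTop atTop := tendsto_natCast_atTop_atTop
  filter_upwards [h1.eventually_gt_atTop (X.arrival (Nat.nth (X.Fixes ω) m + 1) ω)] with n hn
  have h2 := (X.lt_arrivalCount_iff ω n _).2 hn
  rw [fixCount]
  have h3 := Nat.count_monotone (X.Fixes ω) h2.le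
  rwa [Nat.count_nth_of_infinite h] at h3

lemma exists_fixCount_le (h : ¬ {n | X.Fixes ω n}.Infinite) : ∃ M, ∀ n, X.fixCount ω n ≤ M := by
  classical
  rw [not_infinite] at h
  refine ⟨h.toFinset.card, fun n => ?_⟩
  rw [fixCount, Nat.count_eq_card_filter_range]
  refine Finset.card_le_card fun k hk => ?_
  rw [Finite.mem_toFinset]
  exact (Finset.mem_filter.1 hk).2

/-- With infinitely many repairs this is the renewal argument. With finitely many, both the repairs
and, by `workTime_le_of_breaks`, the total uptime are bounded, so that both averages vanish. -/
lemma tendsto_fixCount_sub_workTime {ρ : ℝ} (hρ : 0 < ρ)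
    (hbr : ∀ t, X.state t ω = .working → ∃ s, t < s ∧ X.state s ω = .broken)
    (hcb : ∀ n, X.action n ω = .contribution → X.StateBefore ω (X.arrival n ω) .broken)
    (hlln : {n | X.Fixes ω n}.Infinite →
      Tendsto (fun m : ℕ => (∑ i ∈ Finset.range m, X.lifespan i ω) / m) atTop (𝓝 (1 / ρ))) :
    Tendsto (fun n : ℕ => (X.fixCount ω n : ℝ) / n - ρ * ((X.workTime ω n).toReal / n)) atTop
      (𝓝 0) := by
  obtain ⟨D, hD0, hD⟩ : ∃ D, 0 ≤ D ∧ X.state D ω = .broken := by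
    cases h : X.state 0 ω with
    | broken => exact ⟨0, le_rfl, h⟩
    | working =>
      obtain ⟨s, hs, hs'⟩ := hbr 0 h
      exact ⟨s, hs.le, hs'⟩
  have hS0 : ∀ m, 0 ≤ ∑ i ∈ Finset.range m, X.lifespan i ω := fun m =>
    Finset.sum_nonneg fun i _ => X.lifespan_nonneg ω i
  have hfin : ∀ n, X.workTime ω n ≠ ∞ := fun n =>
    ((X.workTime_le ω n).trans_lt (ENNReal.natCast_lt_top n)).ne
  have hup : ∀ n, (X.workTime ω n).toReal ≤
      D + ∑ i ∈ Finset.range (X.fixCount ω n), X.lifespan i ω := fun n =>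
    ENNReal.toReal_le_of_le_ofReal (add_nonneg hD0 (hS0 _)) (workTime_le_of_breaks hD0 hD hbr n)
  by_cases hF : {n | X.Fixes ω n}.Infinite
  · refine tendsto_count_sub_uptime (D := D) hρ (hlln hF) (tendsto_fixCount hF) (fun n => ?_) hup
      (fun n => ?_)
    · exact (ENNReal.ofReal_le_iff_le_toReal (hfin n)).1 (le_workTime hcb n)
    · simpa using ENNReal.toReal_mono (ENNReal.natCast_ne_top n) (X.workTime_le ω n)
  · obtain ⟨M, hM⟩ := exists_fixCount_le hF
    have h1 : Tendsto (fun n : ℕ => (X.fixCount ω n : ℝ) / n) atTop (𝓝 0) := by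
      refine squeeze_zero (fun n => by positivity) (fun n => ?_)
        (tendsto_const_div_atTop_nhds_zero_nat (M : ℝ))
      gcongr
      exact hM n
    have h2 : Tendsto (fun n : ℕ => (X.workTime ω n).toReal / n) atTop (𝓝 0) := by
      refine squeeze_zero (fun n => by positivity) (fun n => ?_)
        (tendsto_const_div_atTop_nhds_zero_nat
          (D + ∑ i ∈ Finset.range M, X.lifespan i ω))
      gcongr
      refine (hup n).trans ?_
      gcongr
      · exact fun _ _ _ => X.lifespan_nonneg ω _
      · exact hM n
    simpa using h1.sub (h2.const_mul ρ)

end Path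

end SystemProcess

end Upkeep

/-! ### Balance between uptime and repairs -/

namespace Upkeep

open scoped ENNReal NNReal

namespace SystemProcess

variable {Ω : Type*} [MeasurableSpace Ω] {Θ : Type*} [MeasurableSpace Θ]

/-- Joint measurability in time and outcome, for Tonelli in `lintegral_workTime`. By
right-continuity the state is the eventual value along grid points that approach the time from the
right. -/
lemma measurableSet_state_prod (X : SystemProcess Ω Θ) (m : MachineState) :
    MeasurableSet {q : ℝ × Ω | X.state q.1 q.2 = m} := by
  set g : ℕ → ℝ → ℝ := fun N t => (⌊(N : ℝ) * t⌋ + 1 : ℝ) / N with hg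
  have hgt : ∀ t, Tendsto (fun N => g N t) atTop (𝓝[>] t) := by
    intro t
    have hb : ∀ᶠ N : ℕ in atTop, t < g N t ∧ g N t ≤ t + 1 / N := by
      filter_upwards [eventually_gt_atTop 0] with N hN
      have hN' : (0 : ℝ) < N := by exact_mod_cast hN
      have h1 := Int.floor_le ((N : ℝ) * t)
      have h2 := Int.lt_floor_add_one ((N : ℝ) * t)
      simp only [hg]
      constructor
      · rw [lt_div_iff₀ hN']
        linarith
      · rw [div_le_iff₀ hN', add_mul, div_mul_cancel₀ _ hN'.ne']
        linarith
    refine tendsto_nhdsWithin_iff.2 ⟨?_, hb.mono fun N h => h.1⟩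
    refine tendsto_of_tendsto_of_tendsto_of_le_of_le' (h := fun N : ℕ => t + 1 / (N : ℝ))
      tendsto_const_nhds ?_ (hb.mono fun N h => h.1.le) (hb.mono fun N h => h.2)
    simpa using tendsto_const_nhds.add (tendsto_const_div_atTop_nhds_zero_nat (1 : ℝ))
  have hmeas : ∀ N : ℕ, MeasurableSet {q : ℝ × Ω | X.state (g N q.1) q.2 = m} := fun N => by
    have h1 : Measurable fun q : ℤ × Ω => X.state ((q.1 + 1 : ℝ) / N) q.2 :=
      measurable_from_prod_countable_right fun k => X.measurable_state ((k + 1 : ℝ) / N)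
    have h2 : Measurable fun p : ℝ × Ω => (⌊(N : ℝ) * p.1⌋, p.2) :=
      (Int.measurable_floor.comp (measurable_fst.const_mul _)).prodMk measurable_snd
    exact (h1.comp h2) (measurableSet_singleton m)
  have : {q : ℝ × Ω | X.state q.1 q.2 = m} =
      {q | ∀ᶠ N in atTop, X.state (g N q.1) q.2 = m} := by
    ext q
    have h := (hgt q.1).eventually (X.state_rightCont q.2 q.1)
    constructor
    · intro hq
      exact h.mono fun N hN => hN.trans hq
    · intro hq
      obtain ⟨N, h1, h2⟩ := (h.and hq).exists
      exact h1.symm.trans h2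
  rw [this]
  simp only [eventually_atTop, ofPred_exists, ofPred_forall]
  exact MeasurableSet.iUnion fun n => MeasurableSet.iInter fun i => MeasurableSet.iInter fun _ =>
    hmeas i

lemma measurable_workTime (X : SystemProcess Ω Θ) (n : ℕ) : Measurable fun ω => X.workTime ω n := by
  have hm : MeasurableSet {q : Ω × ℝ | q.2 ∈ Ico 0 (n : ℝ) ∧ X.state q.2 q.1 = .working} :=
    (measurable_snd measurableSet_Ico).inter
      (measurable_swap (X.measurableSet_state_prod .working))
  exact measurable_measure_prodMk_left hm

/-- Writes the number of repairs as a sum over unit intervals; under stationarity the summands are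
identically distributed. -/
lemma natCast_fixCount (X : SystemProcess Ω Θ) (ω : Ω) (n : ℕ) :
    (X.fixCount ω n : ℝ≥0∞) = ∑ k ∈ Finset.range n,
      X.arrivalsFrom k ω (Ico (0 : ℝ) 1 ×ˢ (univ : Set Θ) ×ˢ {Action.contribution}) := by
  have hD : MeasurableSet ((univ : Set Θ) ×ˢ {Action.contribution}) :=
    MeasurableSet.univ.prod (measurableSet_singleton _)
  rw [← arrivalsFrom_contribution]
  induction n with
  | zero => simp
  | succ n ih =>
    have hbox : MeasurableSet (Ico (0 : ℝ) 1 ×ˢ (univ : Set Θ) ×ˢ {Action.contribution}) :=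
      measurableSet_Ico.prod hD
    have hbox' : MeasurableSet (Ico (n : ℝ) ((n + 1 : ℕ) : ℝ) ×ˢ (univ : Set Θ) ×ˢ
      {Action.contribution}) := measurableSet_Ico.prod hD
    have hsh : X.arrivalsFrom n ω (Ico (0 : ℝ) 1 ×ˢ (univ : Set Θ) ×ˢ {Action.contribution}) =
        X.arrivalsFrom 0 ω (Ico (n : ℝ) ((n + 1 : ℕ) : ℝ) ×ˢ (univ : Set Θ) ×ˢ
          {Action.contribution}) := by
      rw [arrivalsFrom, arrivalsFrom, Measure.sum_apply _ hbox, Measure.sum_apply _ hbox']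
      refine tsum_congr fun j => ?_
      rw [Measure.dirac_apply' _ hbox, Measure.dirac_apply' _ hbox']
      have : (X.arrival j ω - n, X.agentType j ω, X.action j ω) ∈
          Ico (0 : ℝ) 1 ×ˢ (univ : Set Θ) ×ˢ {Action.contribution} ↔
          (X.arrival j ω - 0, X.agentType j ω, X.action j ω) ∈
          Ico (n : ℝ) ((n + 1 : ℕ) : ℝ) ×ˢ (univ : Set Θ) ×ˢ {Action.contribution} := by
        simp [sub_lt_iff_lt_add, add_comm]
      by_cases h : (X.arrival j ω - n, X.agentType j ω, X.action j ω) ∈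
          Ico (0 : ℝ) 1 ×ˢ (univ : Set Θ) ×ˢ {Action.contribution}
      · rw [indicator_of_mem h, indicator_of_mem (this.1 h)]; rfl
      · rw [indicator_of_notMem h, indicator_of_notMem (mt this.2 h)]
    rw [Finset.sum_range_succ, ← ih, hsh, ← measure_union _ hbox', ← union_prod,
      Ico_union_Ico_eq_Ico (by positivity) (by exact_mod_cast n.le_succ)]
    refine Disjoint.set_prod_left ?_ _ _
    exact Set.disjoint_left.2 fun t h h' => absurd h.2 (not_lt.2 h'.1)

lemma arrivalsFrom_unit_ne_top (X : SystemProcess Ω Θ) (ω : Ω) (k : ℕ) :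
    X.arrivalsFrom k ω (Ico (0 : ℝ) 1 ×ˢ (univ : Set Θ) ×ˢ {Action.contribution}) ≠ ∞ := by
  have h := ENNReal.natCast_ne_top (X.fixCount ω (k + 1))
  rw [X.natCast_fixCount, Finset.sum_range_succ] at h
  exact (ENNReal.add_ne_top.1 h).2

section Stationary

variable {X : SystemProcess Ω Θ} {μ : Measure Ω} [IsProbabilityMeasure μ]
  {lam : Measure Θ} [IsProbabilityMeasure lam] {ν : Measure ℝ}

lemma IsStationary.lintegral_workTime (hst : X.IsStationary μ) (n : ℕ) :
    ∫⁻ ω, X.workTime ω n ∂μ = n * μ {ω | X.state 0 ω = .working} := by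
  have hm : MeasurableSet {q : Ω × ℝ | q.2 ∈ Ico 0 (n : ℝ) ∧ X.state q.2 q.1 = .working} :=
    (measurable_snd measurableSet_Ico).inter
      (measurable_swap (X.measurableSet_state_prod .working))
  have h1 := Measure.prod_apply (μ := μ) (ν := (volume : Measure ℝ)) hm
  have h2 := Measure.prod_apply_symm (μ := μ) (ν := (volume : Measure ℝ)) hm
  have h3 : ∫⁻ ω, X.workTime ω n ∂μ = ∫⁻ ω, volume (Prod.mk ω ⁻¹'
      {q : Ω × ℝ | q.2 ∈ Ico 0 (n : ℝ) ∧ X.state q.2 q.1 = .working}) ∂μ := rfl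
  rw [h3, ← h1, h2]
  have h4 : ∀ t : ℝ, μ ((fun ω => (ω, t)) ⁻¹'
      {q : Ω × ℝ | q.2 ∈ Ico 0 (n : ℝ) ∧ X.state q.2 q.1 = .working}) =
      (Ico 0 (n : ℝ)).indicator (fun _ => μ {ω | X.state 0 ω = .working}) t := by
    intro t
    by_cases ht : t ∈ Ico 0 (n : ℝ)
    · rw [indicator_of_mem ht, ← hst.measure_state .working t]
      congr 1
      ext ω
      simp only [mem_preimage, mem_ofPred_eq, ht, true_and]
    · rw [indicator_of_notMem ht]
      convert measure_empty (μ := μ)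
      ext ω
      simp only [mem_preimage, mem_ofPred_eq, ht, false_and, mem_empty_iff_false]
  simp_rw [h4]
  rw [lintegral_indicator_const measurableSet_Ico, mul_comm]
  simp

omit [IsProbabilityMeasure lam] in
lemma ae_tendsto_lifespan_average [IsProbabilityMeasure ν] (hν : Integrable (fun l => l) ν)
    (hX : X.IsAdmissible μ lam ν) :
    ∀ᵐ ω ∂μ, {n | X.Fixes ω n}.Infinite →
      Tendsto (fun m : ℕ => (∑ i ∈ Finset.range m, X.lifespan i ω) / m) atTop
        (𝓝 (∫ l, l ∂ν)) := by
  set F := {ω | {n | X.Fixes ω n}.Infinite} with hF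
  have hFm : MeasurableSet F := by
    have : F = {ω | ∃ᶠ n in atTop, X.Fixes ω n} := by
      ext ω
      exact (Nat.frequently_atTop_iff_infinite (p := X.Fixes ω)).symm
    rw [this]
    simp only [frequently_atTop, ofPred_exists, ofPred_forall, ofPred_and]
    exact MeasurableSet.iInter fun a => MeasurableSet.iUnion fun b =>
      (MeasurableSet.const _).inter (X.measurable_action _ (measurableSet_singleton _))
  by_cases h0 : μ F = 0
  · filter_upwards [measure_eq_zero_iff_ae_notMem.1 h0] with ω hω hω'
    exact absurd hω' hω
  have hlaw := hX.lifespans_law h0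
  have hP : IsProbabilityMeasure (cond μ F) := cond_isProbabilityMeasure h0
  have hone : ∀ i, HasLaw (fun ω => X.lifespan i ω) ν (cond μ F) := fun i => by
    have := (measurePreserving_eval_infinitePi (fun _ : ℕ => ν) i).hasLaw.comp hlaw
    exact this
  have hind : iIndepFun (fun i ω => X.lifespan i ω) (cond μ F) := by
    rw [iIndepFun_iff_map_fun_eq_infinitePi_map₀ hlaw.aemeasurable, hlaw.map_eq]
    exact congrArg Measure.infinitePi (funext fun i => (hone i).map_eq.symm)
  have hid : ∀ i, IdentDistrib (X.lifespan i) (X.lifespan 0) (cond μ F) (cond μ F) := fun i =>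
    ⟨(hone i).aemeasurable, (hone 0).aemeasurable, (hone i).map_eq.trans (hone 0).map_eq.symm⟩
  have hint : Integrable (X.lifespan 0) (cond μ F) := by
    have h1 := (hone 0).map_eq
    rw [← h1] at hν
    exact hν.comp_aemeasurable (hone 0).aemeasurable
  have hsl := strong_law_ae_real X.lifespan hint (fun i j hij => hind.indepFun hij) hid
  have hmean : ∫ ω, X.lifespan 0 ω ∂(cond μ F) = ∫ l, l ∂ν := by
    rw [← (hone 0).map_eq, integral_map (f := fun l : ℝ => l) (hone 0).aemeasurable (by fun_prop)]
  -- Almost surely under the conditional law means almost surely on `F` under `μ`.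
  rw [hmean, ProbabilityTheory.cond, Measure.ae_ennreal_smul_measure_iff (by simp), ae_restrict_iff' hFm] at hsl
  exact hsl

/-- The balance between the uptime and the frequency of repairs. -/
lemma IsStationary.balance [IsProbabilityMeasure ν] (hst : X.IsStationary μ)
    (hX : X.IsAdmissible μ lam ν) {ρ : ℝ} (hρ : 0 < ρ) (hν : Integrable (fun l => l) ν)
    (hmean : ∫ l, l ∂ν = 1 / ρ) :
    ρ * μ.real {ω | X.state 0 ω = .working} =
      (X.freq μ (univ ×ˢ {Action.contribution})).toReal := by
  set q := μ.real {ω | X.state 0 ω = .working} with hq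
  set f := (X.freq μ (univ ×ˢ {Action.contribution})).toReal with hf
  have hD : MeasurableSet ((univ : Set Θ) ×ˢ {Action.contribution}) :=
    MeasurableSet.univ.prod (measurableSet_singleton _)
  have hbox : MeasurableSet (Ico (0 : ℝ) 1 ×ˢ (univ : Set Θ) ×ˢ {Action.contribution}) :=
    measurableSet_Ico.prod hD
  have hgm : ∀ s : ℝ, Measurable fun ω =>
      X.arrivalsFrom s ω (Ico (0 : ℝ) 1 ×ˢ (univ : Set Θ) ×ˢ {Action.contribution}) := fun s =>
    (Measure.measurable_coe hbox).comp (X.measurable_arrivalsFrom s)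
  set Nr : ℕ → Ω → ℝ := fun k ω =>
    (X.arrivalsFrom k ω (Ico (0 : ℝ) 1 ×ˢ (univ : Set Θ) ×ˢ {Action.contribution})).toReal with hNr
  have hNm : ∀ k, Measurable (Nr k) := fun k => (hgm k).ennreal_toReal
  have hlin : ∀ s : ℝ, ∫⁻ ω, X.arrivalsFrom s ω
      (Ico (0 : ℝ) 1 ×ˢ (univ : Set Θ) ×ˢ {Action.contribution}) ∂μ =
      X.freq μ (univ ×ˢ {Action.contribution}) := by
    intro s
    have h1 := hst.lintegral_pathFrom s (Φ := fun z =>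
      z.2 (Ico (0 : ℝ) 1 ×ˢ (univ : Set Θ) ×ˢ {Action.contribution}))
      ((Measure.measurable_coe hbox).comp measurable_snd)
    simp only [pathFrom] at h1
    rw [h1]
    have h2 := hst.expectedCount_eq hX (B := univ) MeasurableSet.univ .contribution 1
    rw [ENNReal.ofReal_one, one_mul] at h2
    exact h2
  have hid : ∀ k, IdentDistrib (Nr k) (Nr 0) μ μ := by
    intro k
    refine ⟨(hNm k).aemeasurable, (hNm 0).aemeasurable, ?_⟩
    set Φ : (ℝ → MachineState) × Measure (ℝ × Θ × Action) → ℝ := fun z =>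
      (z.2 (Ico (0 : ℝ) 1 ×ˢ (univ : Set Θ) ×ˢ {Action.contribution})).toReal with hΦ
    have hΦm : Measurable Φ :=
      ((Measure.measurable_coe hbox).comp measurable_snd).ennreal_toReal
    have h1 : ∀ k, Nr k = Φ ∘ X.pathFrom k := fun k => rfl
    rw [h1, h1, ← Measure.map_map hΦm (X.measurable_pathFrom _), hst,
      ← Measure.map_map hΦm (X.measurable_pathFrom _), hst ((0 : ℕ) : ℝ)]
  have hNint : ∀ k, Integrable (Nr k) μ := fun k =>
    integrable_toReal_of_lintegral_ne_top (hgm _).aemeasurable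
      (by rw [hlin]; exact freq_ne_top hX _)
  have hNE : ∀ k, ∫ ω, Nr k ω ∂μ = f := fun k => by
    rw [integral_toReal (hgm _).aemeasurable, hlin]
    exact ae_lt_top (hgm _) (by rw [hlin]; exact freq_ne_top hX _)
  have hsum : ∀ n ω, (X.fixCount ω n : ℝ) = ∑ k ∈ Finset.range n, Nr k ω := by
    intro n ω
    rw [← ENNReal.toReal_natCast, X.natCast_fixCount, ENNReal.toReal_sum]
    exact fun k _ => X.arrivalsFrom_unit_ne_top ω k
  -- The repairs per unit of time have no uniform bound, but averages of identically distributed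
  -- integrable variables are uniformly integrable.
  have hui1 : UniformIntegrable
      (fun n => (∑ i ∈ Finset.range n, Nr i) / ((n : ℕ) : Ω → ℝ)) 1 μ :=
    uniformIntegrable_average_real le_rfl (MemLp.uniformIntegrable_of_identDistrib (j := 0) le_rfl
      ENNReal.one_ne_top (memLp_one_iff_integrable.2 (hNint 0)) hid)
  set w : ℕ → Ω → ℝ := fun n ω => ρ * ((X.workTime ω n).toReal / n) with hw
  have hwm : ∀ n, Measurable (w n) := fun n =>
    ((X.measurable_workTime n).ennreal_toReal.div_const _).const_mul _
  have hwb : ∀ n ω, ‖w n ω‖ ≤ ρ := by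
    intro n ω
    rw [Real.norm_of_nonneg (by positivity)]
    refine mul_le_of_le_one_right hρ.le (div_le_one_of_le₀ ?_ (by positivity))
    simpa using ENNReal.toReal_mono (ENNReal.natCast_ne_top n) (X.workTime_le ω n)
  have hui2 : UnifIntegrable w 1 μ := by
    intro ε hε
    obtain ⟨δ, hδ, h⟩ := unifIntegrable_const (ι := ℕ) (μ := μ) (g := fun _ : Ω => ρ) le_rfl
      ENNReal.one_ne_top (memLp_const ρ) hε
    refine ⟨δ, hδ, fun n s hs hμs => (eLpNorm_mono fun ω => ?_).trans (h n s hs hμs)⟩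
    by_cases hω : ω ∈ s
    · rw [indicator_of_mem hω, indicator_of_mem hω, Real.norm_of_nonneg hρ.le]
      exact hwb n ω
    · simp [hω]
  set g : ℕ → Ω → ℝ := (fun n => (∑ i ∈ Finset.range n, Nr i) / ((n : ℕ) : Ω → ℝ)) - w with hg
  have hgω : ∀ n ω, g n ω = (X.fixCount ω n : ℝ) / n - ρ * ((X.workTime ω n).toReal / n) := by
    intro n ω
    simp [hg, hw, hsum]
  have hui : UnifIntegrable g 1 μ := hui1.unifIntegrable.sub hui2 le_rfl
    hui1.aestronglyMeasurable fun n => (hwm n).aestronglyMeasurable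
  have hgm : ∀ n, AEStronglyMeasurable (g n) μ := fun n =>
    (hui1.aestronglyMeasurable n).sub (hwm n).aestronglyMeasurable
  have hlim : ∀ᵐ ω ∂μ, Tendsto (fun n => g n ω) atTop (𝓝 0) := by
    filter_upwards [hX.breaks, hX.contribution_broken, ae_tendsto_lifespan_average hν hX]
      with ω h1 h2 h3
    rw [hmean] at h3
    simp_rw [hgω]
    exact tendsto_fixCount_sub_workTime hρ h1 h2 h3
  have hL1 := tendsto_Lp_finite_of_tendsto_ae (g := fun _ => (0 : ℝ)) le_rfl ENNReal.one_ne_top hgm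
    MemLp.zero' hui hlim
  have hgint : ∀ n, Integrable (g n) μ := fun n => by
    refine Integrable.sub (memLp_one_iff_integrable.1 (hui1.memLp n)) ?_
    exact Integrable.of_bound (hwm n).aestronglyMeasurable ρ (Eventually.of_forall (hwb n))
  -- The mean does not depend on `n`, so the convergence of `g n` to 0 in mean forces it to be 0.
  have hE : ∀ n : ℕ, 0 < n → ∫ ω, g n ω ∂μ = f - ρ * q := by
    intro n hn
    have hn' : (n : ℝ) ≠ 0 := by positivity
    have hWT : ∫ ω, (X.workTime ω n).toReal ∂μ = n * q := by
      have hlt := hst.lintegral_workTime n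
      rw [integral_toReal (X.measurable_workTime n).aemeasurable
        (Eventually.of_forall fun ω => (X.workTime_le ω n).trans_lt (ENNReal.natCast_lt_top n)),
        hlt, ENNReal.toReal_mul, ENNReal.toReal_natCast]
      rfl
    have h1 : ∀ ω, g n ω = (∑ k ∈ Finset.range n, Nr k ω) / n - w n ω := by
      intro ω
      rw [hgω, hsum]
    simp_rw [h1]
    rw [integral_sub, integral_div, integral_finsetSum _ fun k _ => hNint k]
    · simp_rw [hNE, hw]
      rw [integral_const_mul, integral_div, hWT]
      simp only [Finset.sum_const, Finset.card_range, nsmul_eq_mul]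
      field_simp
    · exact (integrable_finsetSum _ fun k _ => hNint k).div_const _
    · exact Integrable.of_bound (hwm n).aestronglyMeasurable ρ (Eventually.of_forall (hwb n))
  have hconv : Tendsto (fun n => ∫ ω, g n ω ∂μ) atTop (𝓝 0) := by
    have := tendsto_integral_of_L1' (fun _ : Ω => (0 : ℝ)) aestronglyMeasurable_const
      (Eventually.of_forall hgint) hL1
    simpa using this
  have hconst : Tendsto (fun n => ∫ ω, g n ω ∂μ) atTop (𝓝 (f - ρ * q)) := by
    refine tendsto_const_nhds.congr' ?_
    filter_upwards [eventually_gt_atTop 0] with n hn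
    exact (hE n hn).symm
  have := tendsto_nhds_unique hconv hconst
  linarith

end Stationary

end SystemProcess

end Upkeep

/-! ### Densities, reduced forms and the inducing mechanism -/

namespace Upkeep

open scoped ENNReal NNReal

/-- A measure that is dominated by a multiple of `lam` has a density with the same bound. -/
lemma exists_density_of_le {Θ : Type*} [MeasurableSpace Θ] {lam M : Measure Θ}
    [IsProbabilityMeasure lam] {c : ℝ} (hc : 0 ≤ c)
    (h : ∀ B, MeasurableSet B → M B ≤ ENNReal.ofReal c * lam B) :
    ∃ R : Θ → ℝ, Measurable R ∧ (∀ θ, 0 ≤ R θ ∧ R θ ≤ c) ∧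
      ∀ B, MeasurableSet B → M B = ENNReal.ofReal (∫ θ in B, R θ ∂lam) := by
  have hac : M ≪ lam := Measure.AbsolutelyContinuous.mk fun B hB h0 => by
    have := h B hB
    rwa [h0, mul_zero, nonpos_iff_eq_zero] at this
  have hfin : IsFiniteMeasure M := ⟨(h univ MeasurableSet.univ).trans_lt (by simp)⟩
  set f := M.rnDeriv lam with hf
  have hfm : Measurable f := Measure.measurable_rnDeriv M lam
  have hfB : ∀ B, MeasurableSet B → M B = ∫⁻ θ in B, f θ ∂lam := fun B hB => by
    rw [Measure.setLIntegral_rnDeriv hac]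
  have hfc : f ≤ᵐ[lam] fun _ => ENNReal.ofReal c := by
    refine ae_le_of_forall_setLIntegral_le_of_sigmaFinite hfm fun B hB _ => ?_
    rw [← hfB B hB, setLIntegral_const]
    exact h B hB
  -- The truncation at `c` changes the derivative only on a null set and makes the bound hold at
  -- every `θ`.
  refine ⟨fun θ => (min (f θ) (ENNReal.ofReal c)).toReal,
    (hfm.min measurable_const).ennreal_toReal, fun θ => ⟨ENNReal.toReal_nonneg, ?_⟩, ?_⟩
  · exact ENNReal.toReal_le_of_le_ofReal hc (min_le_right _ _)
  · intro B hB
    have hlt : ∀ θ, min (f θ) (ENNReal.ofReal c) < ∞ := fun θ =>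
      (min_le_right _ _).trans_lt ENNReal.ofReal_lt_top
    rw [integral_toReal (hfm.min measurable_const).aemeasurable (Eventually.of_forall hlt),
      ENNReal.ofReal_toReal, hfB B hB]
    · refine setLIntegral_congr_fun_ae hB ?_
      filter_upwards [hfc] with θ hθ _
      rw [min_eq_left hθ]
    · refine ((setLIntegral_mono' hB fun θ _ => min_le_right _ _).trans_lt ?_).ne
      rw [setLIntegral_const]
      exact ENNReal.mul_lt_top ENNReal.ofReal_lt_top (measure_lt_top _ _)

namespace SystemProcess

variable {Ω : Type*} [MeasurableSpace Ω] {Θ : Type*} [MeasurableSpace Θ]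

lemma exists_measure_freq (X : SystemProcess Ω Θ) (μ : Measure Ω) (a : Action) :
    ∃ M : Measure Θ, ∀ B, MeasurableSet B → M B = X.freq μ (B ×ˢ {a}) := by
  refine ⟨((campbell μ).restrict {p | X.arrival p.1 p.2 ∈ Ico (0 : ℝ) 1 ∧
    X.action p.1 p.2 = a}).map fun p => X.agentType p.1 p.2, fun B hB => ?_⟩
  rw [Measure.map_apply X.measurable_agentType' hB,
    Measure.restrict_apply (X.measurable_agentType' hB), freq]
  congr 1
  ext p
  simp only [mem_inter_iff, mem_preimage, mem_ofPred_eq, mem_prod, mem_singleton_iff]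
  tauto

section Stationary

variable {X : SystemProcess Ω Θ} {μ : Measure Ω} [IsProbabilityMeasure μ]
  {lam : Measure Θ} [IsProbabilityMeasure lam] {ν : Measure ℝ}

omit [IsProbabilityMeasure μ] in
lemma ofReal_measureReal_eq [IsFiniteMeasure μ] (A : Set Ω) :
    ENNReal.ofReal (μ.real A) = μ A := ENNReal.ofReal_toReal (measure_ne_top _ _)

lemma measureReal_broken (X : SystemProcess Ω Θ) (μ : Measure Ω) [IsProbabilityMeasure μ] :
    μ.real {ω | X.state 0 ω = .broken} = 1 - μ.real {ω | X.state 0 ω = .working} := by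
  have hs : MeasurableSet {ω | X.state 0 ω = .working} :=
    X.measurable_state 0 (measurableSet_singleton _)
  rw [← probReal_compl_eq_one_sub hs]
  congr 1
  ext ω
  simp only [mem_ofPred_eq, mem_compl_iff]
  cases X.state 0 ω <;> simp

lemma IsStationary.isReducedForm (hst : X.IsStationary μ) (hX : X.IsAdmissible μ lam ν)
    {R P : Θ → ℝ} (hR : Measurable R) (hP : Measurable P)
    (hR1 : ∀ θ, R θ ∈ Icc (0 : ℝ) 1) (hP1 : ∀ θ, P θ ∈ Icc (0 : ℝ) 1)
    (hRf : ∀ B, MeasurableSet B →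
      X.freq μ (B ×ˢ {Action.usage}) = ENNReal.ofReal (∫ θ in B, R θ ∂lam))
    (hPf : ∀ B, MeasurableSet B →
      X.freq μ (B ×ˢ {Action.contribution}) = ENNReal.ofReal (∫ θ in B, P θ ∂lam)) :
    X.IsReducedForm μ lam R P (μ.real {ω | X.state 0 ω = .working}) where
  measurable_usage := hR
  measurable_contribution := hP
  usage_mem := hR1
  contribution_mem := hP1
  uptime t := by rw [measureReal_def, hst.measure_state, measureReal_def]
  usage_freq T hT B hB := by
    rw [hst.expectedCount_eq hX hB, hRf B hB, ENNReal.ofReal_mul hT.le]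
  contribution_freq T hT B hB := by
    rw [hst.expectedCount_eq hX hB, hPf B hB, ENNReal.ofReal_mul hT.le]

lemma freq_usage_le (hst : X.IsStationary μ) (hX : X.IsAdmissible μ lam ν)
    {B : Set Θ} (hB : MeasurableSet B) : X.freq μ (B ×ˢ {Action.usage}) ≤
      ENNReal.ofReal (μ.real {ω | X.state 0 ω = .working}) * lam B := by
  rw [ofReal_measureReal_eq]
  exact freq_le_of_stateBefore hst hX hX.usage_working hB

lemma freq_contribution_le (hst : X.IsStationary μ) (hX : X.IsAdmissible μ lam ν)
    {B : Set Θ} (hB : MeasurableSet B) : X.freq μ (B ×ˢ {Action.contribution}) ≤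
      ENNReal.ofReal (1 - μ.real {ω | X.state 0 ω = .working}) * lam B := by
  rw [← measureReal_broken, ofReal_measureReal_eq]
  exact freq_le_of_stateBefore hst hX hX.contribution_broken hB

/-- The integrals of a reduced form are the frequencies, so balance is inherited from
`IsStationary.balance`. The bounds on the integrals over all measurable sets give pointwise bounds
outside a null set, which is all that integrals can determine. -/
lemma IsReducedForm.balance_and_bounds [IsProbabilityMeasure ν] (hst : X.IsStationary μ)
    (hX : X.IsAdmissible μ lam ν) {ρ : ℝ} (hρ : 0 < ρ) (hν : Integrable (fun l => l) ν)
    (hmean : ∫ l, l ∂ν = 1 / ρ) {R P : Θ → ℝ} {Q : ℝ} (h : X.IsReducedForm μ lam R P Q) :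
    Balance lam ρ P Q ∧ ∀ᵐ θ ∂lam, SimplexBounds R P Q θ := by
  have hR := fun B hB => h.usage_freq 1 one_pos B hB
  have hP := fun B hB => h.contribution_freq 1 one_pos B hB
  simp only [one_mul] at hR hP
  have hfR : ∀ B, MeasurableSet B →
      X.freq μ (B ×ˢ {Action.usage}) = ENNReal.ofReal (∫ θ in B, R θ ∂lam) := fun B hB => by
    rw [← hR B hB, hst.expectedCount_eq hX hB]; simp
  have hfP : ∀ B, MeasurableSet B →
      X.freq μ (B ×ˢ {Action.contribution}) = ENNReal.ofReal (∫ θ in B, P θ ∂lam) := fun B hB => by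
    rw [← hP B hB, hst.expectedCount_eq hX hB]; simp
  have hQ : μ.real {ω | X.state 0 ω = .working} = Q := h.uptime 0
  have hQ1 : Q ≤ 1 := hQ ▸ measureReal_le_one
  have hQ0 : 0 ≤ Q := hQ ▸ measureReal_nonneg
  have hiR : Integrable R lam := Integrable.of_bound h.measurable_usage.aestronglyMeasurable 1
    (Eventually.of_forall fun θ => by
      rw [Real.norm_of_nonneg (h.usage_mem θ).1]; exact (h.usage_mem θ).2)
  have hiP : Integrable P lam := Integrable.of_bound
    h.measurable_contribution.aestronglyMeasurable 1
    (Eventually.of_forall fun θ => by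
      rw [Real.norm_of_nonneg (h.contribution_mem θ).1]; exact (h.contribution_mem θ).2)
  have hbd : ∀ (F : Θ → ℝ) (c : ℝ), 0 ≤ c → Integrable F lam →
      (∀ B, MeasurableSet B → ENNReal.ofReal (∫ θ in B, F θ ∂lam) ≤ ENNReal.ofReal c * lam B) →
      F ≤ᵐ[lam] fun _ => c := by
    intro F c hc hF hB
    refine ae_le_of_forall_setIntegral_le hF (integrable_const c) fun B hBm _ => ?_
    have := hB B hBm
    rw [← ofReal_measureReal_eq, ← ENNReal.ofReal_mul hc,
      ENNReal.ofReal_le_ofReal_iff (by positivity)] at this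
    rw [setIntegral_const, smul_eq_mul, mul_comm]
    exact this
  refine ⟨?_, ?_⟩
  · rw [Balance, ← hQ, hst.balance hX hρ hν hmean, hfP univ MeasurableSet.univ,
      ENNReal.toReal_ofReal, setIntegral_univ]
    exact integral_nonneg fun θ => (h.contribution_mem θ).1
  · filter_upwards [hbd R Q hQ0 hiR fun B hB => by
        rw [← hfR B hB, ← hQ]; exact freq_usage_le hst hX hB,
      hbd P (1 - Q) (by linarith) hiP fun B hB => by
        rw [← hfP B hB, ← hQ]; exact freq_contribution_le hst hX hB] with θ h1 h2
    exact ⟨h1, h2⟩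

lemma IsStationary.exists_isReducedForm [IsProbabilityMeasure ν] (hst : X.IsStationary μ)
    (hX : X.IsAdmissible μ lam ν) {ρ : ℝ} (hρ : 0 < ρ) (hν : Integrable (fun l => l) ν)
    (hmean : ∫ l, l ∂ν = 1 / ρ) :
    ∃ (R P : Θ → ℝ) (Q : ℝ), X.IsReducedForm μ lam R P Q ∧
      Balance lam ρ P Q ∧ ∀ θ, SimplexBounds R P Q θ := by
  set Q := μ.real {ω | X.state 0 ω = .working} with hQ
  have hQ1 : Q ≤ 1 := measureReal_le_one
  have hQ0 : 0 ≤ Q := measureReal_nonneg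
  obtain ⟨M, hM⟩ := X.exists_measure_freq μ .usage
  obtain ⟨M', hM'⟩ := X.exists_measure_freq μ .contribution
  obtain ⟨R, hRm, hR, hRf⟩ := exists_density_of_le (lam := lam) (M := M) hQ0
    fun B hB => by rw [hM B hB]; exact freq_usage_le hst hX hB
  obtain ⟨P, hPm, hP, hPf⟩ := exists_density_of_le (lam := lam) (M := M')
    (by linarith : 0 ≤ 1 - Q)
    fun B hB => by rw [hM' B hB]; exact freq_contribution_le hst hX hB
  have hred : X.IsReducedForm μ lam R P Q := hst.isReducedForm hX hRm hPm
    (fun θ => ⟨(hR θ).1, (hR θ).2.trans hQ1⟩)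
    (fun θ => ⟨(hP θ).1, (hP θ).2.trans (by linarith)⟩)
    (fun B hB => by rw [← hM B hB, hRf B hB]) (fun B hB => by rw [← hM' B hB, hPf B hB])
  exact ⟨R, P, Q, hred, (hred.balance_and_bounds hst hX hρ hν hmean).1,
    fun θ => ⟨(hR θ).2, (hP θ).2⟩⟩

end Stationary

end SystemProcess

open Classical in
/-- The mechanism that directs agents who find a working machine to use it with probability
`R / Q` and those who find a broken one to fix it with probability `P / (1 - Q)`. -/
noncomputable def inducingMechanism {Θ : Type*} [MeasurableSpace Θ] {R P : Θ → ℝ} {Q : ℝ}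
    (hR : Measurable R) (hP : Measurable P) (hR0 : ∀ θ, 0 ≤ R θ) (hP0 : ∀ θ, 0 ≤ P θ)
    (hQ0 : 0 ≤ Q) (hQ1 : Q ≤ 1) (h : ∀ θ, SimplexBounds R P Q θ) : MarkovianMechanism Θ where
  -- The convention `x / 0 = 0` does no harm: `Q = 0` forces `R = 0`, while `Q = 1` forces `P = 0`,
  -- which contradicts balance when `0 < ρ`.
  prob x := if x.2 = .working then R x.1 / Q else P x.1 / (1 - Q)
  measurable_prob := Measurable.ite (measurable_snd (measurableSet_singleton MachineState.working))
    ((hR.comp measurable_fst).div_const _) ((hP.comp measurable_fst).div_const _)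
  prob_mem x := by
    split_ifs
    · exact ⟨div_nonneg (hR0 _) hQ0, div_le_one_of_le₀ (h _).1 hQ0⟩
    · exact ⟨div_nonneg (hP0 _) (by linarith), div_le_one_of_le₀ (h _).2 (by linarith)⟩

/-- All stationary admissible processes that are compatible with the inducing mechanism have the
given reduced form. -/
lemma isReducedForm_of_isCompatible {Ω : Type*} [MeasurableSpace Ω] {Θ : Type*}
    [MeasurableSpace Θ] {X : SystemProcess Ω Θ} {μ : Measure Ω} [IsProbabilityMeasure μ]
    {lam : Measure Θ} [IsProbabilityMeasure lam] {ν : Measure ℝ} [IsProbabilityMeasure ν]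
    {ρ : ℝ} (hρ : 0 < ρ) (hν : Integrable (fun l => l) ν) (hmean : ∫ l, l ∂ν = 1 / ρ)
    {R P : Θ → ℝ} {Q : ℝ} (hR : Measurable R) (hP : Measurable P)
    (hR1 : ∀ θ, R θ ∈ Icc (0 : ℝ) 1) (hP1 : ∀ θ, P θ ∈ Icc (0 : ℝ) 1) (hQ : Q ∈ Icc (0 : ℝ) 1)
    (hbal : Balance lam ρ P Q) (h : ∀ θ, SimplexBounds R P Q θ)
    (hst : X.IsStationary μ) (hX : X.IsAdmissible μ lam ν)
    (hcomp : (inducingMechanism hR hP (fun θ => (hR1 θ).1) (fun θ => (hP1 θ).1) hQ.1 hQ.2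
      h).IsCompatible X μ lam) :
    X.IsReducedForm μ lam R P Q := by
  obtain ⟨V, hV, hlaw, hind, hact⟩ := hcomp.exists_measurable
  set σ := inducingMechanism hR hP (fun θ => (hR1 θ).1) (fun θ => (hP1 θ).1) hQ.1 hQ.2 h with hσ
  have hσW : ∀ θ, σ.prob (θ, .working) = R θ / Q := fun θ => by simp [hσ, inducingMechanism]
  have hσB : ∀ θ, σ.prob (θ, .broken) = P θ / (1 - Q) := fun θ => by simp [hσ, inducingMechanism]
  set q := μ.real {ω | X.state 0 ω = .working} with hq
  have hint : ∀ (F : Θ → ℝ) (c : ℝ), Measurable F → (∀ θ, F θ ∈ Icc (0 : ℝ) 1) → 0 ≤ c →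
      ∀ B, ∫⁻ θ in B, ENNReal.ofReal (F θ / c) ∂lam =
        ENNReal.ofReal ((∫ θ in B, F θ ∂lam) / c) := by
    intro F c hF hF1 hc B
    rw [← integral_div, ofReal_integral_eq_lintegral_ofReal]
    · refine Integrable.div_const (Integrable.of_bound hF.aestronglyMeasurable 1
        (Eventually.of_forall fun θ => ?_)) _
      rw [Real.norm_of_nonneg (hF1 θ).1]; exact (hF1 θ).2
    · exact Eventually.of_forall fun θ => div_nonneg (hF1 θ).1 hc
  have hW : ∀ B, MeasurableSet B → X.freq μ (B ×ˢ {Action.usage}) =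
      ENNReal.ofReal (q * ((∫ θ in B, R θ ∂lam) / Q)) := by
    intro B hB
    rw [MarkovianMechanism.freq_eq_of_randomization (σ := σ) hst hX hV hlaw hind
      (m := .working) (m' := .broken) (by simp) X.stateBefore_or
      hX.usage_working (hact.mono fun ω hω n => (hω n).1) hB,
      ENNReal.ofReal_mul measureReal_nonneg, SystemProcess.ofReal_measureReal_eq]
    simp_rw [hσW]
    rw [hint R Q hR hR1 hQ.1]
  have hB : ∀ B, MeasurableSet B → X.freq μ (B ×ˢ {Action.contribution}) =
      ENNReal.ofReal ((1 - q) * ((∫ θ in B, P θ ∂lam) / (1 - Q))) := by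
    intro B hB
    rw [MarkovianMechanism.freq_eq_of_randomization (σ := σ) hst hX hV hlaw hind
      (m := .broken) (m' := .working) (by simp) (fun ω t => (X.stateBefore_or ω t).symm)
      hX.contribution_broken (hact.mono fun ω hω n => (hω n).2) hB,
      ← X.measureReal_broken μ,
      ENNReal.ofReal_mul measureReal_nonneg, SystemProcess.ofReal_measureReal_eq]
    simp_rw [hσB]
    rw [hint P (1 - Q) hP hP1 (by linarith [hQ.2])]
  have hq1 : q ≤ 1 := measureReal_le_one
  have hq0 : 0 ≤ q := measureReal_nonneg
  have hPint : ∀ B : Set Θ, 0 ≤ ∫ θ in B, P θ ∂lam := fun B =>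
    integral_nonneg fun θ => (hP1 θ).1
  have hRint : ∀ B : Set Θ, 0 ≤ ∫ θ in B, R θ ∂lam := fun B =>
    integral_nonneg fun θ => (hR1 θ).1
  have hQ1 : Q < 1 := by
    refine lt_of_le_of_ne hQ.2 fun e => ?_
    have hP0 : ∀ θ, P θ = 0 := fun θ => le_antisymm (by have := (h θ).2; linarith) (hP1 θ).1
    rw [Balance] at hbal
    simp only [hP0, integral_zero, e, mul_one] at hbal
    linarith
  -- Contributions have frequency `(1 - q) * ρ * Q / (1 - Q)`, and the balance condition of the
  -- process sets this equal to `ρ * q`; the only solution is `Q`.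
  have hqQ : q = Q := by
    have h1 := hst.balance hX hρ hν hmean
    rw [hB univ MeasurableSet.univ, setIntegral_univ, ← (hbal : ρ * Q = _),
      ENNReal.toReal_ofReal (mul_nonneg (by linarith)
        (div_nonneg (mul_nonneg hρ.le hQ.1) (by linarith)))] at h1
    have h2 : 1 - Q ≠ 0 := by linarith
    change ρ * q = _ at h1
    field_simp at h1
    nlinarith
  rw [← hqQ]
  refine hst.isReducedForm hX hR hP hR1 hP1 (fun B hBm => ?_) (fun B hBm => ?_)
  · rw [hW B hBm, hqQ]
    congr 1
    rcases hQ.1.eq_or_lt with e | hQpos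
    · have hR0 : ∀ θ, R θ = 0 := fun θ => le_antisymm (by have := (h θ).1; linarith) (hR1 θ).1
      simp [hR0]
    · field_simp
  · rw [hB B hBm, hqQ]
    congr 1
    have h2 : 1 - Q ≠ 0 := by linarith
    field_simp

end Upkeep

/-! ### Deterministic construction of the states from a configuration of agents -/

namespace Upkeep
open scoped ENNReal NNReal

lemma exists_le_lt_of_strictMono {f : ℤ → ℝ} (hf : StrictMono f) (htop : Tendsto f atTop atTop)
    (hbot : Tendsto f atBot atBot) (t : ℝ) : ∃ m, f m ≤ t ∧ t < f (m + 1) := by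
  obtain ⟨b, hb⟩ := (htop.eventually_gt_atTop t).exists
  obtain ⟨m, hm⟩ := (hbot.eventually_le_atBot t).exists
  obtain ⟨k, hk, hmax⟩ := Int.exists_greatest_of_bdd (P := fun k => f k ≤ t)
    ⟨b, fun z hz => (hf.lt_iff_lt.1 (hz.trans_lt hb)).le⟩ ⟨m, hm⟩
  refine ⟨k, hk, not_le.1 fun h => ?_⟩
  have := hmax _ h
  omega

lemma exists_lt_le_of_strictMono {f : ℤ → ℝ} (hf : StrictMono f) (htop : Tendsto f atTop atTop)
    (hbot : Tendsto f atBot atBot) (t : ℝ) : ∃ m, f m < t ∧ t ≤ f (m + 1) := by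
  obtain ⟨m, h1, h2⟩ := exists_le_lt_of_strictMono hf htop hbot t
  rcases h1.lt_or_eq with h | h
  · exact ⟨m, h, h2.le⟩
  · exact ⟨m - 1, h ▸ hf (by omega), by simp [h]⟩

/-- A configuration of agents: arrival time, type, randomization, and the lifespan that starts if
the agent fixes the machine. -/
abbrev Configuration (Θ : Type*) := ℤ → ℝ × Θ × ℝ × ℝ

namespace Configuration

variable {Θ : Type*} [MeasurableSpace Θ] (σ : MarkovianMechanism Θ) (c : Configuration Θ)

/-- The time at which the machine breaks if agent `n` fixes it. -/
abbrev lifeEnd (n : ℤ) : ℝ := (c n).1 + (c n).2.2.2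

/-- Every life that could have started before agent `m` has ended when this agent arrives. -/
def Regenerates (m : ℤ) : Prop := ∀ j < m, c.lifeEnd j < (c m).1

/-- The mechanism directs agent `n` to fix a broken machine. -/
def Volunteers (n : ℤ) : Prop := (c n).2.2.1 < σ.prob ((c n).2.1, .broken)

open Classical in
/-- The end of the last life that has started before the arrival of agent `m + i`, if the machine
is broken when agent `m` arrives. -/
noncomputable def lastEnd (m : ℤ) : ℕ → ℝ
  -- Any value below the arrival of agent `m` encodes that he finds the machine broken.
  | 0 => (c m).1 - 1
  | i + 1 => if c.Volunteers σ (m + i) ∧ lastEnd m i < (c (m + i)).1 then c.lifeEnd (m + i)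
      else lastEnd m i

/-- Agent `n` fixes the machine. -/
def Repairs (n : ℤ) : Prop :=
  -- Any regenerating agent up to `n` may start the recursion; for regular configurations they all
  -- agree by `IsRegular.lastEnd_lt_iff`.
  c.Volunteers σ n ∧ ∃ i : ℕ, c.Regenerates (n - i) ∧ c.lastEnd σ (n - i) i < (c n).1

/-- The machine works at time `t`. -/
def WorksAt (t : ℝ) : Prop := ∃ n, c.Repairs σ n ∧ (c n).1 ≤ t ∧ t < c.lifeEnd n

/-- The machine works just before time `t`. -/
def WorksBefore (t : ℝ) : Prop := ∃ n, c.Repairs σ n ∧ (c n).1 < t ∧ t ≤ c.lifeEnd n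

open Classical in
/-- The state of the machine at time `t`. -/
noncomputable def stateAt (t : ℝ) : MachineState := if c.WorksAt σ t then .working else .broken

open Classical in
/-- The action of agent `n`. -/
noncomputable def actionOf (n : ℤ) : Action :=
  if c.Repairs σ n then .contribution
  else if c.WorksBefore σ (c n).1 ∧ (c n).2.2.1 < σ.prob ((c n).2.1, .working) then .usage
  else .abstention

/-- Regularity of a configuration. -/
structure IsRegular : Prop where
  strictMono : StrictMono fun n => (c n).1
  tendsto_atTop : Tendsto (fun n => (c n).1) atTop atTop
  tendsto_atBot : Tendsto (fun n => (c n).1) atBot atBot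
  lifespan_pos : ∀ n, 0 < (c n).2.2.2
  regenerates : ∀ N, ∃ m ≤ N, c.Regenerates m

variable {σ c}

section LastEnd

lemma IsRegular.lastEnd_le_succ (hc : c.IsRegular) (m : ℤ) (i : ℕ) :
    c.lastEnd σ m i ≤ c.lastEnd σ m (i + 1) := by
  rw [lastEnd]
  split_ifs with h
  · have := hc.lifespan_pos (m + i); simp only [lifeEnd]; linarith [h.2]
  · exact le_rfl

lemma IsRegular.lifeEnd_le_lastEnd (hc : c.IsRegular) {m : ℤ} {i j : ℕ} (hij : j < i)
    (h : c.Volunteers σ (m + j) ∧ c.lastEnd σ m j < (c (m + j)).1) :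
    c.lifeEnd (m + j) ≤ c.lastEnd σ m i := by
  have := (monotone_nat_of_le_succ (hc.lastEnd_le_succ (σ := σ) m)) (show j + 1 ≤ i from hij)
  rw [lastEnd, if_pos h] at this
  exact this

lemma lastEnd_cases (σ : MarkovianMechanism Θ) (c : Configuration Θ) (m : ℤ) (i : ℕ) :
    c.lastEnd σ m i < (c m).1 ∨ ∃ j < i, (c.Volunteers σ (m + j) ∧
      c.lastEnd σ m j < (c (m + j)).1) ∧ c.lastEnd σ m i = c.lifeEnd (m + j) := by
  induction i with
  | zero => left; simp [lastEnd]
  | succ i ih =>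
    rw [lastEnd]
    split_ifs with h
    · exact Or.inr ⟨i, by omega, h, rfl⟩
    · rcases ih with ih | ⟨j, hj, h1, h2⟩
      · exact Or.inl ih
      · exact Or.inr ⟨j, by omega, h1, h2⟩

/-- Coupling of the recursions from two regenerations. At the later one both machines are broken.
They stay broken until the next volunteer, who fixes both, and from then on they coincide. -/
lemma IsRegular.lastEnd_add (hc : c.IsRegular) (m : ℤ) (d i : ℕ) (h : c.Regenerates (m + d)) :
    c.lastEnd σ m (d + i) = c.lastEnd σ (m + d) i ∨
      (c.lastEnd σ m (d + i) < (c (m + d + i)).1 ∧ c.lastEnd σ (m + d) i < (c (m + d + i)).1) := by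
  induction i with
  | zero =>
    right
    simp only [lastEnd, Nat.cast_zero, add_zero, sub_lt_self_iff, zero_lt_one, and_true]
    rcases lastEnd_cases σ c m d with h1 | ⟨j, hj, -, h2⟩
    · exact h1.trans_le (hc.strictMono.monotone (show m ≤ m + d by omega))
    · rw [h2]; exact h _ (by omega)
  | succ i ih =>
    rw [← add_assoc, lastEnd, lastEnd, Nat.cast_add, ← add_assoc]
    have hlt : (c (m + d + i)).1 < (c (m + d + (i + 1 : ℕ))).1 := hc.strictMono (by omega)
    rcases ih with ih | ⟨h1, h2⟩
    · left; rw [ih]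
    · by_cases hv : c.Volunteers σ (m + d + i)
      · left; simp [hv, h1, h2]
      · right; simp only [hv, false_and, if_false]
        exact ⟨h1.trans hlt, h2.trans hlt⟩

lemma IsRegular.lastEnd_lt_iff (hc : c.IsRegular) {m m' : ℤ} {i i' : ℕ} (h : c.Regenerates m)
    (h' : c.Regenerates m') (heq : m + i = m' + i') :
    c.lastEnd σ m i < (c (m + i)).1 ↔ c.lastEnd σ m' i' < (c (m + i)).1 := by
  wlog hm : m ≤ m' generalizing m m' i i'
  · rw [heq]; exact (this h' h heq.symm (by omega)).symm
  obtain ⟨d, rfl⟩ := Int.le.dest hm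
  obtain rfl : i = d + i' := by omega
  rcases hc.lastEnd_add (σ := σ) m d i' h' with h1 | ⟨h1, h2⟩
  · rw [h1]
  · rw [heq]; simp [h1, h2]

lemma IsRegular.repairs_iff (hc : c.IsRegular) {m : ℤ} {i : ℕ} (h : c.Regenerates m) :
    c.Repairs σ (m + i) ↔ c.Volunteers σ (m + i) ∧ c.lastEnd σ m i < (c (m + i)).1 := by
  refine and_congr_right fun _ => ⟨?_, fun hl => ⟨i, by simpa using h, by simpa using hl⟩⟩
  rintro ⟨j, hj, hl⟩
  exact (hc.lastEnd_lt_iff h hj (by omega)).2 hl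

lemma IsRegular.lifeEnd_lt (hc : c.IsRegular) {m n : ℤ} (hm : c.Repairs σ m) (hn : c.Repairs σ n)
    (hmn : m < n) : c.lifeEnd m < (c n).1 := by
  obtain ⟨k, hk, hreg⟩ := hc.regenerates m
  obtain ⟨i, rfl⟩ := Int.le.dest hk
  obtain ⟨j, rfl⟩ := Int.le.dest (hk.trans hmn.le)
  rw [hc.repairs_iff hreg] at hm hn
  exact (hc.lifeEnd_le_lastEnd (by omega) hm).trans_lt hn.2

/-- A volunteer is turned away only if `lastEnd` is not below his arrival; it is then the end of an
actual life that has started before him. -/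
lemma IsRegular.worksBefore_of_not_repairs (hc : c.IsRegular) {n : ℤ} (hv : c.Volunteers σ n)
    (hn : ¬ c.Repairs σ n) : c.WorksBefore σ (c n).1 := by
  obtain ⟨k, hk, hreg⟩ := hc.regenerates n
  obtain ⟨i, rfl⟩ := Int.le.dest hk
  rw [hc.repairs_iff hreg, not_and, not_lt] at hn
  have hle := hn hv
  rcases lastEnd_cases σ c k i with h1 | ⟨j, hj, h1, h2⟩
  · have : (c k).1 ≤ (c (k + i)).1 := hc.strictMono.monotone (by omega)
    linarith
  · exact ⟨k + j, (hc.repairs_iff hreg).2 h1, hc.strictMono (by omega), h2 ▸ hle⟩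

end LastEnd

section Path

lemma IsRegular.lt_iff (hc : c.IsRegular) {m n : ℤ} : (c m).1 < (c n).1 ↔ m < n :=
  hc.strictMono.lt_iff_lt

lemma IsRegular.le_iff (hc : c.IsRegular) {m n : ℤ} : (c m).1 ≤ (c n).1 ↔ m ≤ n :=
  hc.strictMono.le_iff_le

lemma IsRegular.exists_le_lt (hc : c.IsRegular) (t : ℝ) : ∃ m, (c m).1 ≤ t ∧ t < (c (m + 1)).1 :=
  exists_le_lt_of_strictMono hc.strictMono hc.tendsto_atTop hc.tendsto_atBot t

lemma IsRegular.exists_lt_le (hc : c.IsRegular) (t : ℝ) : ∃ m, (c m).1 < t ∧ t ≤ (c (m + 1)).1 :=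
  exists_lt_le_of_strictMono hc.strictMono hc.tendsto_atTop hc.tendsto_atBot t

lemma IsRegular.not_worksAt_lifeEnd (hc : c.IsRegular) {n : ℤ} (hn : c.Repairs σ n) :
    ¬ c.WorksAt σ (c.lifeEnd n) := by
  rintro ⟨m, hm, h1, h2⟩
  have := hc.lifespan_pos n
  rcases lt_trichotomy m n with h | rfl | h
  · have := hc.lifeEnd_lt hm hn h
    simp only [lifeEnd] at *; linarith
  · exact h2.false
  · have := hc.lifeEnd_lt hn hm h
    linarith

lemma IsRegular.worksAt_right (hc : c.IsRegular) (t : ℝ) :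
    ∀ᶠ s in 𝓝[>] t, (c.WorksAt σ s ↔ c.WorksAt σ t) := by
  by_cases h : c.WorksAt σ t
  · obtain ⟨n, hn, h1, h2⟩ := h
    filter_upwards [Ioo_mem_nhdsGT h2] with s hs
    exact ⟨fun _ => ⟨n, hn, h1, h2⟩, fun _ => ⟨n, hn, h1.trans hs.1.le, hs.2⟩⟩
  · obtain ⟨m, h1, h2⟩ := hc.exists_le_lt t
    filter_upwards [Ioo_mem_nhdsGT h2] with s hs
    refine ⟨fun ⟨n, hn, h3, h4⟩ => absurd ⟨n, hn, ?_, hs.1.trans h4⟩ h, fun h' => absurd h' h⟩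
    have := hc.lt_iff.1 (h3.trans_lt hs.2)
    exact (hc.le_iff.2 (by omega)).trans h1

lemma worksAt_of_worksBefore {t : ℝ} (h : c.WorksBefore σ t) : ∀ᶠ s in 𝓝[<] t, c.WorksAt σ s := by
  obtain ⟨n, hn, h1, h2⟩ := h
  filter_upwards [Ioo_mem_nhdsLT h1] with s hs
  exact ⟨n, hn, hs.1.le, hs.2.trans_le h2⟩

/-- Only agents who arrive before `t` matter. The life of the last of them who repairs has ended
before `t`, and earlier lives ended before that repair. -/
lemma IsRegular.not_worksAt_of_not_worksBefore (hc : c.IsRegular) {t : ℝ}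
    (h : ¬ c.WorksBefore σ t) : ∀ᶠ s in 𝓝[<] t, ¬ c.WorksAt σ s := by
  obtain ⟨m, h1, h2⟩ := hc.exists_lt_le t
  by_cases hex : ∃ n ≤ m, c.Repairs σ n
  · obtain ⟨k, ⟨hkm, hk⟩, hmax⟩ := Int.exists_greatest_of_bdd
      (P := fun n => n ≤ m ∧ c.Repairs σ n) ⟨m, fun z hz => hz.1⟩ (by simpa using hex)
    have hlt : c.lifeEnd k < t := not_le.1 fun hle =>
      h ⟨k, hk, (hc.le_iff.2 hkm).trans_lt h1, hle⟩
    filter_upwards [Ioo_mem_nhdsLT h1, Ioo_mem_nhdsLT hlt] with s hs hs'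
    rintro ⟨n, hn, h3, h4⟩
    have hnm : n < m + 1 := hc.lt_iff.1 (h3.trans_lt (hs.2.trans_le h2))
    rcases (hmax n ⟨by omega, hn⟩).lt_or_eq with hlt' | rfl
    · have := hc.lifeEnd_lt hn hk hlt'
      have := hc.lifespan_pos k
      have := hs'.1
      simp only [lifeEnd] at *; linarith
    · exact (hs'.1.trans h4).false
  · filter_upwards [Ioo_mem_nhdsLT h1] with s hs
    rintro ⟨n, hn, h3, h4⟩
    have hnm : n < m + 1 := hc.lt_iff.1 (h3.trans_lt (hs.2.trans_le h2))
    exact hex ⟨n, by omega, hn⟩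

lemma stateAt_eq_working {t : ℝ} : c.stateAt σ t = .working ↔ c.WorksAt σ t := by
  simp [stateAt]

lemma stateAt_eq_broken {t : ℝ} : c.stateAt σ t = .broken ↔ ¬ c.WorksAt σ t := by
  simp [stateAt]

lemma actionOf_eq_contribution {n : ℤ} : c.actionOf σ n = .contribution ↔ c.Repairs σ n := by
  unfold actionOf; split_ifs <;> simp [*]

lemma actionOf_eq_usage {n : ℤ} : c.actionOf σ n = .usage ↔ ¬ c.Repairs σ n ∧
    c.WorksBefore σ (c n).1 ∧ (c n).2.2.1 < σ.prob ((c n).2.1, .working) := by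
  unfold actionOf; split_ifs <;> simp [*]

lemma IsRegular.eventually_stateAt_working_iff (hc : c.IsRegular) {t : ℝ} :
    (∀ᶠ s in 𝓝[<] t, c.stateAt σ s = .working) ↔ c.WorksBefore σ t := by
  simp only [stateAt_eq_working]
  refine ⟨fun h => ?_, worksAt_of_worksBefore⟩
  by_contra h'
  obtain ⟨s, h1, h2⟩ := (h.and (hc.not_worksAt_of_not_worksBefore h')).exists
  exact h2 h1

lemma IsRegular.eventually_stateAt_broken_iff (hc : c.IsRegular) {t : ℝ} :
    (∀ᶠ s in 𝓝[<] t, c.stateAt σ s = .broken) ↔ ¬ c.WorksBefore σ t := by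
  simp only [stateAt_eq_broken]
  refine ⟨fun h h' => ?_, hc.not_worksAt_of_not_worksBefore⟩
  obtain ⟨s, h1, h2⟩ := (h.and (worksAt_of_worksBefore h')).exists
  exact h1 h2

lemma IsRegular.not_worksBefore_of_repairs (hc : c.IsRegular) {n : ℤ} (hn : c.Repairs σ n) :
    ¬ c.WorksBefore σ (c n).1 := by
  rintro ⟨m, hm, h1, h2⟩
  exact (h2.trans_lt (hc.lifeEnd_lt hm hn (hc.lt_iff.1 h1))).false

lemma IsRegular.repairs_iff_volunteers (hc : c.IsRegular) {n : ℤ} (h : ¬ c.WorksBefore σ (c n).1) :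
    c.Repairs σ n ↔ c.Volunteers σ n :=
  ⟨fun h => h.1, fun hv => by_contra fun hn => h (hc.worksBefore_of_not_repairs hv hn)⟩

end Path

/-! ### Invariance under translation in time and renumbering of agents -/

section Invariance

/-- The configuration seen from time `s`. -/
def translate (s : ℝ) (c : Configuration Θ) : Configuration Θ := fun n => ((c n).1 - s, (c n).2)

lemma lifeEnd_translate (s : ℝ) (n : ℤ) : (c.translate s).lifeEnd n = c.lifeEnd n - s := by
  simp only [translate, lifeEnd]; ring

lemma regenerates_translate (s : ℝ) (n : ℤ) :
    (c.translate s).Regenerates n ↔ c.Regenerates n := by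
  simp only [Regenerates, lifeEnd_translate, translate, sub_lt_sub_iff_right]

lemma volunteers_translate (s : ℝ) (n : ℤ) :
    (c.translate s).Volunteers σ n ↔ c.Volunteers σ n := Iff.rfl

lemma lastEnd_translate (s : ℝ) (m : ℤ) (i : ℕ) :
    (c.translate s).lastEnd σ m i = c.lastEnd σ m i - s := by
  classical
  induction i with
  | zero => simp only [lastEnd, translate]; ring
  | succ i ih =>
    have h : ((c.translate s).Volunteers σ (m + i) ∧
        (c.translate s).lastEnd σ m i < (c.translate s (m + i)).1) ↔
        (c.Volunteers σ (m + i) ∧ c.lastEnd σ m i < (c (m + i)).1) := by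
      rw [ih, volunteers_translate]; simp only [translate, sub_lt_sub_iff_right]
    rw [lastEnd, lastEnd, lifeEnd_translate, if_congr h rfl ih]
    split_ifs <;> rfl

lemma repairs_translate (s : ℝ) (n : ℤ) : (c.translate s).Repairs σ n ↔ c.Repairs σ n := by
  simp only [Repairs, volunteers_translate, regenerates_translate, lastEnd_translate]
  simp only [translate, sub_lt_sub_iff_right]

lemma worksBefore_translate (s t : ℝ) :
    (c.translate s).WorksBefore σ (t - s) ↔ c.WorksBefore σ t := by
  simp only [WorksBefore, repairs_translate, lifeEnd_translate]
  simp only [translate, sub_lt_sub_iff_right, sub_le_sub_iff_right]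

lemma worksAt_translate (s t : ℝ) :
    (c.translate s).WorksAt σ (t - s) ↔ c.WorksAt σ t := by
  simp only [WorksAt, repairs_translate, lifeEnd_translate]
  simp only [translate, sub_lt_sub_iff_right, sub_le_sub_iff_right]

lemma stateAt_translate (s t : ℝ) : (c.translate s).stateAt σ t = c.stateAt σ (s + t) := by
  rw [stateAt, stateAt, ← worksAt_translate (c := c) s (s + t), add_sub_cancel_left]

lemma actionOf_translate (s : ℝ) (n : ℤ) : (c.translate s).actionOf σ n = c.actionOf σ n := by
  unfold actionOf
  rw [repairs_translate, show (c.translate s n).1 = (c n).1 - s from rfl, worksBefore_translate]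
  rfl

/-- Renumbering the agents. -/
def reindex (k : ℤ) (c : Configuration Θ) : Configuration Θ := fun n => c (n + k)

lemma regenerates_reindex (k m : ℤ) : (c.reindex k).Regenerates m ↔ c.Regenerates (m + k) :=
  ⟨fun h j hj => by simpa [reindex, lifeEnd] using h (j - k) (by omega),
    fun h j hj => h (j + k) (by omega)⟩

lemma lastEnd_reindex (k m : ℤ) (i : ℕ) :
    (c.reindex k).lastEnd σ m i = c.lastEnd σ (m + k) i := by
  classical
  induction i with
  | zero => rfl
  | succ i ih =>
    have h : c.reindex k (m + i) = c (m + k + i) := congrArg c (by ring)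
    rw [lastEnd, lastEnd, ih]
    refine if_congr ?_ ?_ rfl
    · simp only [Volunteers, h]
    · simp only [lifeEnd, h]

lemma repairs_reindex (k n : ℤ) : (c.reindex k).Repairs σ n ↔ c.Repairs σ (n + k) := by
  have : ∀ i : ℕ, n - i + k = n + k - i := fun i => by ring
  simp only [Repairs, regenerates_reindex, lastEnd_reindex, this]
  rfl

lemma worksAt_reindex (k : ℤ) (t : ℝ) : (c.reindex k).WorksAt σ t ↔ c.WorksAt σ t := by
  simp only [WorksAt, repairs_reindex]
  exact (Equiv.addRight k).exists_congr_left.trans (by simp [reindex, lifeEnd])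

lemma worksBefore_reindex (k : ℤ) (t : ℝ) :
    (c.reindex k).WorksBefore σ t ↔ c.WorksBefore σ t := by
  simp only [WorksBefore, repairs_reindex]
  exact (Equiv.addRight k).exists_congr_left.trans (by simp [reindex, lifeEnd])

lemma actionOf_reindex (k n : ℤ) : (c.reindex k).actionOf σ n = c.actionOf σ (n + k) := by
  unfold actionOf
  rw [repairs_reindex, worksBefore_reindex]
  rfl

variable (σ) in
/-- The path of the system that a configuration generates. -/
noncomputable def path (c : Configuration Θ) : (ℝ → MachineState) × Measure (ℝ × Θ × Action) :=
  (c.stateAt σ, Measure.sum fun n => Measure.dirac ((c n).1, (c n).2.1, c.actionOf σ n))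

lemma path_reindex (k : ℤ) : (c.reindex k).path σ = c.path σ := by
  classical
  refine Prod.ext (funext fun t => ?_) ?_
  · exact if_congr (worksAt_reindex k t) rfl rfl
  · simp only [path, actionOf_reindex]
    exact Measure.ext fun s hs => by
      rw [Measure.sum_apply _ hs, Measure.sum_apply _ hs]
      exact (Equiv.addRight k).tsum_eq (fun n =>
        (Measure.dirac ((c n).1, (c n).2.1, c.actionOf σ n)) s)

end Invariance

/-! ### Measurability in the configuration -/

section Measurability

lemma measurable_time (n : ℤ) : Measurable fun c : Configuration Θ => (c n).1 := by fun_prop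

lemma measurableSet_volunteers (σ : MarkovianMechanism Θ) (n : ℤ) :
    MeasurableSet {c : Configuration Θ | c.Volunteers σ n} := by
  have h := σ.measurable_prob
  exact measurableSet_lt (by fun_prop) (by fun_prop)

lemma measurable_lifeEnd (n : ℤ) : Measurable fun c : Configuration Θ => c.lifeEnd n := by
  unfold lifeEnd; fun_prop

lemma measurableSet_regenerates (m : ℤ) :
    MeasurableSet {c : Configuration Θ | c.Regenerates m} := by
  simp only [Regenerates, ofPred_forall]
  exact MeasurableSet.iInter fun j => MeasurableSet.iInter fun _ =>
    measurableSet_lt (measurable_lifeEnd j) (by fun_prop)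

lemma measurable_lastEnd (σ : MarkovianMechanism Θ) (m : ℤ) (i : ℕ) :
    Measurable fun c : Configuration Θ => c.lastEnd σ m i := by
  induction i with
  | zero => simp only [lastEnd]; fun_prop
  | succ i ih =>
    simp only [lastEnd]
    exact Measurable.ite ((measurableSet_volunteers σ _).inter (measurableSet_lt ih (by fun_prop)))
      (measurable_lifeEnd _) ih

lemma measurableSet_repairs (σ : MarkovianMechanism Θ) (n : ℤ) :
    MeasurableSet {c : Configuration Θ | c.Repairs σ n} := by
  have : {c : Configuration Θ | c.Repairs σ n} = {c | c.Volunteers σ n} ∩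
      ⋃ i : ℕ, {c | c.Regenerates (n - i)} ∩ {c | c.lastEnd σ (n - i) i < (c n).1} := by
    ext c; simp [Repairs]
  rw [this]
  exact (measurableSet_volunteers σ n).inter (MeasurableSet.iUnion fun i =>
    (measurableSet_regenerates _).inter (measurableSet_lt (measurable_lastEnd σ _ i) (measurable_time n)))

lemma measurableSet_worksAt (σ : MarkovianMechanism Θ) (t : ℝ) :
    MeasurableSet {c : Configuration Θ | c.WorksAt σ t} := by
  simp only [WorksAt, ofPred_exists]
  exact MeasurableSet.iUnion fun n => (measurableSet_repairs σ n).inter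
    ((measurableSet_le (measurable_time n) measurable_const).inter
      (measurableSet_lt measurable_const (measurable_lifeEnd n)))

lemma measurableSet_worksBefore_arrival (σ : MarkovianMechanism Θ) (k : ℤ) :
    MeasurableSet {c : Configuration Θ | c.WorksBefore σ (c k).1} := by
  simp only [WorksBefore, ofPred_exists]
  exact MeasurableSet.iUnion fun n => (measurableSet_repairs σ n).inter
    ((measurableSet_lt (measurable_time n) (measurable_time k)).inter
      (measurableSet_le (measurable_time k) (measurable_lifeEnd n)))

lemma measurable_stateAt (σ : MarkovianMechanism Θ) (t : ℝ) :
    Measurable fun c : Configuration Θ => c.stateAt σ t :=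
  Measurable.ite (measurableSet_worksAt σ t) measurable_const measurable_const

lemma measurable_actionOf (σ : MarkovianMechanism Θ) (n : ℤ) :
    Measurable fun c : Configuration Θ => c.actionOf σ n := by
  have h := σ.measurable_prob
  have h' : MeasurableSet {c : Configuration Θ |
      (c n).2.2.1 < σ.prob ((c n).2.1, .working)} := measurableSet_lt (by fun_prop) (by fun_prop)
  exact Measurable.ite (measurableSet_repairs σ n) measurable_const (Measurable.ite
    ((measurableSet_worksBefore_arrival σ n).inter h') measurable_const measurable_const)

lemma measurable_path (σ : MarkovianMechanism Θ) :
    Measurable fun c : Configuration Θ => c.path σ := by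
  refine Measurable.prodMk (measurable_pi_lambda _ fun t => measurable_stateAt σ t) ?_
  refine Measure.measurable_of_measurable_coe _ fun s hs => ?_
  simp only [Measure.sum_apply _ hs]
  refine Measurable.tsum fun n => ?_
  have h : Measurable fun c : Configuration Θ => ((c n).1, (c n).2.1, c.actionOf σ n) := by
    have := measurable_actionOf σ n
    fun_prop
  exact (Measure.measurable_coe hs).comp (Measure.measurable_dirac.comp h)

end Measurability

end Configuration

end Upkeep

/-! ### Dependence on the past, and the process that a random configuration generates -/

namespace Upkeep
open scoped ENNReal NNReal

namespace Configuration

variable {Θ : Type*} [MeasurableSpace Θ] {σ : MarkovianMechanism Θ} {c c' : Configuration Θ}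

section Congruence

lemma regenerates_congr {m : ℤ} (h : ∀ j < m, c j = c' j) (hm : (c m).1 = (c' m).1) :
    c.Regenerates m ↔ c'.Regenerates m := by
  refine forall_congr' fun j => forall_congr' fun hj => ?_
  rw [lifeEnd, lifeEnd, h j hj, hm]

lemma lastEnd_congr {m : ℤ} {i : ℕ} (h : ∀ j < m + i, c j = c' j)
    (hm : (c (m + i)).1 = (c' (m + i)).1) : c.lastEnd σ m i = c'.lastEnd σ m i := by
  classical
  induction i with
  | zero => simp only [lastEnd]; simpa using hm
  | succ i ih =>
    push_cast at h
    have h1 : c (m + i) = c' (m + i) := h _ (by omega)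
    have h2 := ih (fun j hj => h j (by omega)) (congrArg Prod.fst h1)
    rw [lastEnd, lastEnd]
    refine if_congr ?_ ?_ h2
    · rw [Volunteers, Volunteers, h1, h2]
    · rw [lifeEnd, lifeEnd, h1]

/-- Whether agent `n` repairs the machine does not depend on the later agents, nor on the lifespan
that this repair would start. -/
lemma repairs_congr {n : ℤ} (h : ∀ j < n, c j = c' j) (ht : (c n).1 = (c' n).1)
    (hθ : (c n).2.1 = (c' n).2.1) (hu : (c n).2.2.1 = (c' n).2.2.1) :
    c.Repairs σ n ↔ c'.Repairs σ n := by
  rw [Repairs, Repairs, Volunteers, Volunteers, hθ, hu]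
  refine and_congr_right fun _ => exists_congr fun i => ?_
  rw [lastEnd_congr (c := c) (c' := c') (m := n - i) (i := i)
    (fun j hj => h j (by omega)) (by rwa [sub_add_cancel]), ht]
  refine and_congr_left fun _ => regenerates_congr (fun j hj => h j (by omega)) ?_
  rcases Nat.eq_zero_or_pos i with rfl | hi
  · simpa using ht
  · exact congrArg _ (h _ (by omega))

/-- At a time when no agent with a positive number has arrived in either configuration, the common
agents determine the state. This will make the history a function of the past gaps and marks. -/
lemma worksAt_congr (h : ∀ j ≤ 0, c j = c' j) {t : ℝ} (hc : ∀ j, 0 < j → t < (c j).1)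
    (hc' : ∀ j, 0 < j → t < (c' j).1) : c.WorksAt σ t ↔ c'.WorksAt σ t := by
  refine exists_congr fun n => ?_
  rcases le_or_gt n 0 with hn | hn
  · rw [repairs_congr (c := c) (c' := c') (fun j hj => h j (by omega)) (by rw [h n hn])
      (by rw [h n hn]) (by rw [h n hn]), lifeEnd, lifeEnd, h n hn]
  · exact iff_of_false (fun h' => (hc n hn).not_ge h'.2.1) (fun h' => (hc' n hn).not_ge h'.2.1)

lemma worksBefore_congr (h : ∀ j ≤ 0, c j = c' j) {t : ℝ} (hc : ∀ j, 0 < j → t < (c j).1)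
    (hc' : ∀ j, 0 < j → t < (c' j).1) : c.WorksBefore σ t ↔ c'.WorksBefore σ t := by
  refine exists_congr fun n => ?_
  rcases le_or_gt n 0 with hn | hn
  · rw [repairs_congr (c := c) (c' := c') (fun j hj => h j (by omega)) (by rw [h n hn])
      (by rw [h n hn]) (by rw [h n hn]), lifeEnd, lifeEnd, h n hn]
  · exact iff_of_false (fun h' => (hc n hn).not_gt h'.2.1) (fun h' => (hc' n hn).not_gt h'.2.1)

lemma stateAt_congr (h : ∀ j ≤ 0, c j = c' j) {t : ℝ} (hc : ∀ j, 0 < j → t < (c j).1)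
    (hc' : ∀ j, 0 < j → t < (c' j).1) : c.stateAt σ t = c'.stateAt σ t := by
  classical
  exact if_congr (worksAt_congr h hc hc') rfl rfl

lemma actionOf_congr (h : ∀ j ≤ 0, c j = c' j) {n : ℤ} (hn : n ≤ 0)
    (hc : ∀ j, 0 < j → (c n).1 < (c j).1) (hc' : ∀ j, 0 < j → (c n).1 < (c' j).1) :
    c.actionOf σ n = c'.actionOf σ n := by
  classical
  unfold actionOf
  refine if_congr (repairs_congr (fun j hj => h j (by omega)) (by rw [h n hn])
      (by rw [h n hn]) (by rw [h n hn])) rfl (if_congr ?_ rfl rfl)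
  rw [worksBefore_congr h hc hc', h n hn]

end Congruence

/-- If there were a last repair, a volunteer who arrives after its life has ended would find the
machine broken and repair it; if there were none, every volunteer would. -/
lemma IsRegular.exists_repairs_ge (hc : c.IsRegular) (h : ∀ N, ∃ n ≥ N, c.Volunteers σ n) (N : ℤ) :
    ∃ n ≥ N, c.Repairs σ n := by
  by_contra! hN
  by_cases hex : ∃ n, c.Repairs σ n
  · obtain ⟨k, hk, hmax⟩ := Int.exists_greatest_of_bdd (P := fun n => c.Repairs σ n)
      ⟨N, fun z hz => le_of_not_gt fun h => hN z h.le hz⟩ hex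
    obtain ⟨b, hb⟩ := (hc.tendsto_atTop.eventually_gt_atTop (c.lifeEnd k)).exists
    obtain ⟨n, hn, hv⟩ := h (max b N)
    obtain ⟨m, hm, h1, h2⟩ :=
      hc.worksBefore_of_not_repairs hv (hN n ((le_max_right _ _).trans hn))
    have h3 : (c b).1 ≤ (c n).1 := hc.le_iff.2 ((le_max_left _ _).trans hn)
    rcases (hmax m hm).lt_or_eq with h4 | rfl
    · have := hc.lifeEnd_lt hm hk h4
      have := hc.lifespan_pos k
      simp only [lifeEnd] at *; linarith
    · linarith
  · push Not at hex
    obtain ⟨n, hn, hv⟩ := h N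
    obtain ⟨m, hm, -⟩ := hc.worksBefore_of_not_repairs hv (hN n hn)
    exact hex m hm

variable {Ω : Type*} [MeasurableSpace Ω]

variable (σ) in
/-- The system process that is generated by a random regular configuration. -/
noncomputable def process (C : Ω → Configuration Θ) (hC : Measurable C)
    (hreg : ∀ ω, (C ω).IsRegular) (h0 : ∀ ω, (C ω 0).1 < 0) (h1 : ∀ ω, 0 ≤ (C ω 1).1) :
    SystemProcess Ω Θ where
  state t ω := (C ω).stateAt σ t
  arrival n ω := (C ω n).1
  agentType n ω := (C ω n).2.1
  action n ω := (C ω).actionOf σ n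
  measurable_state t := (measurable_stateAt σ t).comp hC
  measurable_arrival n := by fun_prop
  measurable_agentType n := by fun_prop
  measurable_action n := (measurable_actionOf σ n).comp hC
  arrival_strictMono ω := (hreg ω).strictMono
  arrival_zero_neg := h0
  arrival_one_nonneg := h1
  arrival_tendsto_atTop ω := (hreg ω).tendsto_atTop
  arrival_tendsto_atBot ω := (hreg ω).tendsto_atBot
  state_rightCont ω t := by
    classical
    filter_upwards [(hreg ω).worksAt_right t] with s hs
    exact if_congr hs rfl rfl
  state_leftLim ω t := by
    by_cases h : (C ω).WorksBefore σ t
    · exact ⟨.working, (hreg ω).eventually_stateAt_working_iff.2 h⟩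
    · exact ⟨.broken, (hreg ω).eventually_stateAt_broken_iff.2 h⟩
  working_of_contribution ω n h := by
    have := (hreg ω).lifespan_pos n
    exact stateAt_eq_working.2 ⟨n, actionOf_eq_contribution.1 h, le_rfl, by
      simp only [lifeEnd]; linarith⟩
  contribution_of_fixed ω t hb hw := by
    rw [(hreg ω).eventually_stateAt_broken_iff] at hb
    obtain ⟨n, hn, h2, h3⟩ := stateAt_eq_working.1 hw
    rcases h2.lt_or_eq with h | h
    · exact absurd ⟨n, hn, h, h3.le⟩ hb
    · exact ⟨n, h, actionOf_eq_contribution.2 hn⟩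

section GeneratedProcess

variable {C : Ω → Configuration Θ} {hC : Measurable C} {hreg : ∀ ω, (C ω).IsRegular}
  {h0 : ∀ ω, (C ω 0).1 < 0} {h1 : ∀ ω, 0 ≤ (C ω 1).1}

lemma stateBefore_working_iff {ω : Ω} {t : ℝ} :
    (process σ C hC hreg h0 h1).StateBefore ω t .working ↔ (C ω).WorksBefore σ t :=
  (hreg ω).eventually_stateAt_working_iff

lemma stateBefore_broken_iff {ω : Ω} {t : ℝ} :
    (process σ C hC hreg h0 h1).StateBefore ω t .broken ↔ ¬ (C ω).WorksBefore σ t :=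
  (hreg ω).eventually_stateAt_broken_iff

lemma pathFrom_process (s : ℝ) (ω : Ω) :
    (process σ C hC hreg h0 h1).pathFrom s ω = ((C ω).translate s).path σ := by
  refine Prod.ext (funext fun t => ((C ω).stateAt_translate s t).symm) ?_
  simp only [path, actionOf_translate]
  rfl

lemma process_breaks (ω : Ω) (t : ℝ)
    (h : (process σ C hC hreg h0 h1).state t ω = .working) :
    ∃ s, t < s ∧ (process σ C hC hreg h0 h1).state s ω = .broken := by
  obtain ⟨n, hn, h2, h3⟩ := stateAt_eq_working.1 h
  exact ⟨_, h3, stateAt_eq_broken.2 ((hreg ω).not_worksAt_lifeEnd hn)⟩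

lemma process_usage_working (ω : Ω) (n : ℤ)
    (h : (process σ C hC hreg h0 h1).action n ω = .usage) :
    (process σ C hC hreg h0 h1).StateBefore ω ((process σ C hC hreg h0 h1).arrival n ω) .working :=
  stateBefore_working_iff.2 (actionOf_eq_usage.1 h).2.1

lemma process_contribution_broken (ω : Ω) (n : ℤ)
    (h : (process σ C hC hreg h0 h1).action n ω = .contribution) :
    (process σ C hC hreg h0 h1).StateBefore ω ((process σ C hC hreg h0 h1).arrival n ω) .broken :=
  stateBefore_broken_iff.2 ((hreg ω).not_worksBefore_of_repairs (actionOf_eq_contribution.1 h))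

lemma process_compatible (ω : Ω) (n : ℤ) :
    ((process σ C hC hreg h0 h1).StateBefore ω
        ((process σ C hC hreg h0 h1).arrival n ω) .working →
      ((process σ C hC hreg h0 h1).action n ω = .usage ↔
        (C ω n).2.2.1 < σ.prob ((process σ C hC hreg h0 h1).agentType n ω, .working))) ∧
    ((process σ C hC hreg h0 h1).StateBefore ω
        ((process σ C hC hreg h0 h1).arrival n ω) .broken →
      ((process σ C hC hreg h0 h1).action n ω = .contribution ↔
        (C ω n).2.2.1 < σ.prob ((process σ C hC hreg h0 h1).agentType n ω, .broken))) := by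
  rw [stateBefore_working_iff, stateBefore_broken_iff]
  refine ⟨fun h => ?_, fun h => ?_⟩
  · refine actionOf_eq_usage.trans ⟨fun h' => h'.2.2, fun h' => ⟨fun hn => ?_, h, h'⟩⟩
    exact (hreg ω).not_worksBefore_of_repairs hn h
  · exact actionOf_eq_contribution.trans ((hreg ω).repairs_iff_volunteers h)

lemma fixes_process (ω : Ω) (n : ℕ) :
    (process σ C hC hreg h0 h1).Fixes ω n ↔ (C ω).Repairs σ (n + 1) :=
  actionOf_eq_contribution

/-- The potential lifespan of a repairing agent is realized: his life keeps the machine working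
until its end, and at its end no other life covers that time. -/
lemma lifespan_process {ω : Ω} (i : ℕ)
    (h : {n | (process σ C hC hreg h0 h1).Fixes ω n}.Infinite) :
    (process σ C hC hreg h0 h1).lifespan i ω =
      (C ω (Nat.nth ((process σ C hC hreg h0 h1).Fixes ω) i + 1)).2.2.2 := by
  have hn := (fixes_process ω _).1 (Nat.nth_mem_of_infinite h i)
  set n : ℤ := (Nat.nth ((process σ C hC hreg h0 h1).Fixes ω) i : ℤ) + 1 with hn_def
  refine IsLeast.csInf_eq ⟨⟨(hreg ω).lifespan_pos n,
    stateAt_eq_broken.2 ((hreg ω).not_worksAt_lifeEnd hn)⟩, fun s hs => ?_⟩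
  by_contra! hlt
  refine stateAt_eq_broken.1 hs.2 ⟨n, hn, ?_, ?_⟩
  · change (C ω n).1 ≤ (C ω n).1 + s
    linarith [hs.1]
  · change (C ω n).1 + s < _
    simp only [lifeEnd]; linarith

end GeneratedProcess

end Configuration

end Upkeep

/-! ### Resampling one coordinate of an i.i.d. family -/

namespace Upkeep
open scoped ENNReal NNReal

section Resample

variable {ι E F : Type*} [MeasurableSpace E] [MeasurableSpace F] [DecidableEq ι]

/-- Resampling one coordinate of an i.i.d. family by means of an additional randomization. -/
lemma measurePreserving_update_infinitePi (κ : Measure E) [IsProbabilityMeasure κ]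
    (η : Measure F) [IsProbabilityMeasure η] {f : F × E → E} (hf : Measurable f)
    (hmap : (η.prod κ).map f = κ) (i : ι) :
    MeasurePreserving (fun q : F × (ι → E) => Function.update q.2 i (f (q.1, q.2 i)))
      (η.prod (Measure.infinitePi fun _ : ι => κ)) (Measure.infinitePi fun _ : ι => κ) := by
  have hm : Measurable fun q : F × (ι → E) => Function.update q.2 i (f (q.1, q.2 i)) := by
    refine measurable_pi_iff.2 fun j => ?_
    by_cases h : j = i
    · subst h; simp only [Function.update_self]; fun_prop
    · simp only [Function.update_of_ne h]; fun_prop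
  refine ⟨hm, Measure.eq_infinitePi _ fun s t ht => ?_⟩
  have hs : MeasurableSet (Set.pi (s : Set ι) t) := .pi s.countable_toSet fun j _ => ht j
  rw [Measure.map_apply hm hs, Measure.prod_apply (hm hs)]
  by_cases hi : i ∈ s
  · have h1 : ∀ x, (Measure.infinitePi fun _ : ι => κ) (Prod.mk x ⁻¹'
        ((fun q : F × (ι → E) => Function.update q.2 i (f (q.1, q.2 i))) ⁻¹' Set.pi s t)) =
        κ ((fun y => f (x, y)) ⁻¹' t i) * ∏ j ∈ s.erase i, κ (t j) := by
      intro x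
      have h2 : Prod.mk x ⁻¹' ((fun q : F × (ι → E) =>
          Function.update q.2 i (f (q.1, q.2 i))) ⁻¹' Set.pi s t) =
          Set.pi s (Function.update t i ((fun y => f (x, y)) ⁻¹' t i)) := by
        ext ω
        simp only [mem_preimage, Set.mem_pi, Finset.mem_coe]
        refine forall_congr' fun j => forall_congr' fun _ => ?_
        by_cases h : j = i
        · subst h; simp
        · simp [h]
      rw [h2, Measure.infinitePi_pi, ← Finset.mul_prod_erase _ _ hi, Function.update_self]
      · congr 1
        exact Finset.prod_congr rfl fun j hj => by
          rw [Function.update_of_ne (Finset.ne_of_mem_erase hj)]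
      · intro j _
        by_cases h : j = i
        · subst h; simp only [Function.update_self]; exact (hf.comp measurable_prodMk_left) (ht _)
        · simpa [h] using ht j
    simp_rw [h1]
    have h3 : Measurable fun x => κ ((fun y => f (x, y)) ⁻¹' t i) :=
      measurable_measure_prodMk_left (hf (ht i))
    rw [lintegral_mul_const _ h3, ← Finset.mul_prod_erase _ _ hi]
    congr 1
    conv_rhs => rw [← hmap]
    rw [Measure.map_apply hf (ht i), Measure.prod_apply (hf (ht i))]
    rfl
  · have h1 : ∀ x, Prod.mk x ⁻¹' ((fun q : F × (ι → E) =>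
        Function.update q.2 i (f (q.1, q.2 i))) ⁻¹' Set.pi s t) = Set.pi s t := by
      intro x
      ext ω
      simp only [mem_preimage, Set.mem_pi, Finset.mem_coe]
      refine forall_congr' fun j => forall_congr' fun hj => ?_
      rw [Function.update_of_ne (ne_of_mem_of_not_mem hj hi)]
    simp_rw [h1]
    rw [lintegral_const, measure_univ, mul_one, Measure.infinitePi_pi _ fun j _ => ht j]

lemma lintegral_prod_prod {A B C : Type*} [MeasurableSpace A] [MeasurableSpace B]
    [MeasurableSpace C] (α : Measure A) (β : Measure B) (γ : Measure C) [SFinite α] [SFinite β]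
    [SFinite γ] {F : (A × B) × C → ℝ≥0∞} (hF : Measurable F) :
    ∫⁻ q, F q ∂((α.prod β).prod γ) = ∫⁻ a, ∫⁻ z, F ((a, z.1), z.2) ∂(β.prod γ) ∂α := by
  rw [lintegral_prod _ hF.aemeasurable, lintegral_prod _ hF.lintegral_prod_right'.aemeasurable]
  refine lintegral_congr fun a => ?_
  rw [lintegral_prod _ (Measurable.aemeasurable (by fun_prop))]

end Resample

/-! ### Palm inversion for the Poisson process -/

section Palm

/-- The age and the residual lifetime of the interval that covers the origin are independent
exponential variables. -/
lemma lintegral_exp_add {G : ℝ × ℝ → ℝ≥0∞} (hG : Measurable G) :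
    ∫⁻ a, ∫⁻ e, G (a, a + e) ∂(expMeasure 1) ∂(expMeasure 1) =
      ∫⁻ e, (∫⁻ t in Ioc 0 e, G (t, e)) ∂(expMeasure 1) := by
  have hd := measurable_erlangPDF 0
  have hset : MeasurableSet {p : ℝ × ℝ | p.2 ∈ Ioc 0 p.1} := by
    have h1 : MeasurableSet {p : ℝ × ℝ | 0 < p.2} :=
      measurableSet_lt measurable_const measurable_snd
    have h2 : MeasurableSet {p : ℝ × ℝ | p.2 ≤ p.1} := measurableSet_le measurable_snd measurable_fst
    exact h1.inter h2
  have hI : Measurable fun p : ℝ × ℝ => (Ioc 0 p.1).indicator (fun t => G (t, p.1)) p.2 :=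
    Measurable.indicator (f := fun p : ℝ × ℝ => G (p.2, p.1)) (by fun_prop) hset
  rw [expMeasure_one_eq, lintegral_withDensity_eq_lintegral_mul _ hd (by
    rw [← expMeasure_one_eq]; exact Measurable.lintegral_prod_right (by fun_prop))]
  have h1 : ∀ e : ℝ, ∫⁻ t in Ioc 0 e, G (t, e) =
      ∫⁻ t, (Ioc 0 e).indicator (fun t => G (t, e)) t := fun e =>
    (lintegral_indicator measurableSet_Ioc _).symm
  simp_rw [h1]
  rw [lintegral_withDensity_eq_lintegral_mul _ hd hI.lintegral_prod_right]
  have h2 : ∀ a, (erlangPDF 0 * fun a => ∫⁻ e, G (a, a + e) ∂volume.withDensity (erlangPDF 0)) a =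
      ∫⁻ e, erlangPDF 0 a * (erlangPDF 0 (e - a) * G (a, e)) := by
    intro a
    rw [Pi.mul_apply, lintegral_withDensity_eq_lintegral_mul _ hd (by fun_prop),
      ← lintegral_const_mul _ (by fun_prop),
      ← lintegral_add_left_eq_self (fun e => erlangPDF 0 a * (erlangPDF 0 (e - a) * G (a, e))) a]
    simp
  simp_rw [h2]
  rw [lintegral_lintegral_swap (Measurable.aemeasurable (by fun_prop))]
  refine lintegral_congr fun e => ?_
  rw [Pi.mul_apply, ← lintegral_const_mul _ (Measurable.indicator (by fun_prop) measurableSet_Ioc)]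
  refine lintegral_congr_ae ?_
  have h0 : ∀ᵐ a : ℝ, a ≠ 0 := by simp [ae_iff]
  filter_upwards [h0] with a ha
  simp only [erlangPDF, indicator_apply, mem_Ici, mem_Ioc]
  -- With `e` now the total length, the densities of the age and of the residual multiply to `exp
  -- (-e)`, which does not depend on the age: given the total, the age is spread uniformly.
  by_cases h3 : 0 < a ∧ a ≤ e
  · rw [if_pos h3.1.le, if_pos (by linarith), if_pos h3, if_pos (by linarith), ← mul_assoc,
      ← ENNReal.ofReal_mul (by positivity)]
    congr 2
    simp only [pow_zero, Nat.factorial_zero, Nat.cast_one, div_one, one_mul, ← Real.exp_add]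
    congr 1; ring
  · rw [if_neg h3, mul_zero]
    by_cases h4 : 0 ≤ a
    · have : ¬ 0 ≤ e - a := fun h => h3 ⟨lt_of_le_of_ne h4 ha.symm, by linarith⟩
      rw [if_neg this]; simp
    · rw [if_neg h4]; simp

variable {M : Type*} [MeasurableSpace M]

/-- The arrival times that correspond to a sequence of gaps, when agent `0` arrives at time `0`. -/
noncomputable def arrivalTime (ω : ℤ → ℝ × M) (n : ℤ) : ℝ :=
  -- One of the two sums is always empty.
  ∑ j ∈ Finset.Ico 0 n, (ω j).1 - ∑ j ∈ Finset.Ico n 0, (ω j).1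

lemma arrivalTime_zero (ω : ℤ → ℝ × M) : arrivalTime ω 0 = 0 := by simp [arrivalTime]

lemma arrivalTime_add_one (ω : ℤ → ℝ × M) (n : ℤ) :
    arrivalTime ω (n + 1) = arrivalTime ω n + (ω n).1 := by
  unfold arrivalTime
  rcases le_or_gt 0 n with h | h
  · rw [← Finset.insert_Ico_right_eq_Ico_add_one h, Finset.sum_insert (by simp),
      Finset.Ico_eq_empty_of_le (a := n + 1) (by omega), Finset.Ico_eq_empty_of_le (a := n) h]
    simp; ring
  · rw [← Finset.insert_Ico_add_one_left_eq_Ico h, Finset.sum_insert (by simp),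
      Finset.Ico_eq_empty_of_le (b := n + 1) (by omega), Finset.Ico_eq_empty_of_le (b := n) h.le]
    simp

lemma measurable_arrivalTime (n : ℤ) : Measurable fun ω : ℤ → ℝ × M => arrivalTime ω n := by
  unfold arrivalTime; fun_prop

/-- A sequence is determined by its increments. -/
lemma eq_arrivalTime {ω : ℤ → ℝ × M} {f : ℤ → ℝ} (h : ∀ n, f (n + 1) = f n + (ω n).1) (n : ℤ) :
    f n = f 0 + arrivalTime ω n := by
  induction n using Int.induction_on with
  | zero => simp [arrivalTime_zero]
  | succ i ih => rw [h, ih, arrivalTime_add_one]; ring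
  | pred i ih =>
    have h1 := h (-i - 1)
    have h2 := arrivalTime_add_one ω (-i - 1)
    rw [sub_add_cancel] at h1 h2
    linarith

/-- Renumbering of a two-sided sequence. -/
def shift {E : Type*} (k : ℤ) (ω : ℤ → E) : ℤ → E := fun j => ω (j + k)

lemma arrivalTime_shift (k n : ℤ) (ω : ℤ → ℝ × M) :
    arrivalTime (shift k ω) n = arrivalTime ω (n + k) - arrivalTime ω k := by
  have := eq_arrivalTime (ω := shift k ω) (f := fun n => arrivalTime ω (n + k)) (fun n => by
    simp only [shift]
    rw [← arrivalTime_add_one]; congr 1; ring) n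
  simp only [zero_add] at this
  linarith

lemma measurePreserving_shift {E : Type*} [MeasurableSpace E] (κ : Measure E)
    [IsProbabilityMeasure κ] (k : ℤ) :
    MeasurePreserving (shift k) (Measure.infinitePi fun _ : ℤ => κ)
      (Measure.infinitePi fun _ : ℤ => κ) :=
  ⟨by unfold shift; fun_prop, Measure.map_infinitePi_infinitePi_of_inj (add_left_injective k)⟩

/-- Extend the gap from agent `0` to agent `1` by the age `p.1`. -/
def palmMap (p : ℝ × (ℤ → ℝ × M)) : ℝ × (ℤ → ℝ × M) :=
  (p.1, Function.update p.2 0 (p.1 + (p.2 0).1, (p.2 0).2))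

lemma measurable_palmMap : Measurable (palmMap (M := M)) := by
  refine measurable_fst.prodMk (measurable_pi_iff.2 fun j => ?_)
  by_cases h : j = 0
  · subst h; simp only [Function.update_self]; fun_prop
  · simp only [Function.update_of_ne h]; fun_prop

/-- Replacing coordinate `i` by an independent copy preserves the law, which allows its gap to be
integrated separately from everything else. -/
lemma lintegral_infinitePi_eq (κ : Measure M) [IsProbabilityMeasure κ] (i : ℤ)
    {F : (ℤ → ℝ × M) → ℝ≥0∞} (hF : Measurable F) :
    ∫⁻ ω, F ω ∂(Measure.infinitePi fun _ : ℤ => (expMeasure 1).prod κ) =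
      ∫⁻ e, ∫⁻ z, F (Function.update z.2 i (e, z.1))
        ∂(κ.prod (Measure.infinitePi fun _ : ℤ => (expMeasure 1).prod κ)) ∂(expMeasure 1) := by
  have h := measurePreserving_update_infinitePi (ι := ℤ) ((expMeasure 1).prod κ)
    ((expMeasure 1).prod κ) measurable_fst (by rw [Measure.map_fst_prod]; simp) i
  rw [← h.lintegral_comp hF, lintegral_prod_prod]
  exact hF.comp h.measurable

/-- Adding an independent exponential age to gap `0` amounts to weighting by the length of the gap
and placing the origin uniformly in it. As the mean gap is 1, no normalization appears. The reason
is `lintegral_exp_add`, applied to this gap with all other data integrated out. -/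
lemma lintegral_palmMap (κ : Measure M) [IsProbabilityMeasure κ]
    {H : ℝ × (ℤ → ℝ × M) → ℝ≥0∞} (hH : Measurable H) :
    ∫⁻ p, H (palmMap p)
        ∂((expMeasure 1).prod (Measure.infinitePi fun _ : ℤ => (expMeasure 1).prod κ)) =
      ∫⁻ ω, (∫⁻ t in Ioc 0 (ω 0).1, H (t, ω))
        ∂(Measure.infinitePi fun _ : ℤ => (expMeasure 1).prod κ) := by
  set π := Measure.infinitePi fun _ : ℤ => (expMeasure 1).prod κ with hπ
  have hupd : Measurable fun q : (ℝ × M) × (ℤ → ℝ × M) => Function.update q.2 0 q.1 :=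
    (measurePreserving_update_infinitePi (ι := ℤ) ((expMeasure 1).prod κ)
      ((expMeasure 1).prod κ) measurable_fst (by rw [Measure.map_fst_prod]; simp) 0).measurable
  have hG : Measurable fun q : (ℝ × ℝ) × (M × (ℤ → ℝ × M)) =>
      H (q.1.1, Function.update q.2.2 0 (q.1.2, q.2.1)) :=
    hH.comp ((by fun_prop : Measurable fun q : (ℝ × ℝ) × (M × (ℤ → ℝ × M)) => q.1.1).prodMk
      (hupd.comp (by fun_prop : Measurable fun q : (ℝ × ℝ) × (M × (ℤ → ℝ × M)) =>
        ((q.1.2, q.2.1), q.2.2))))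
  rw [lintegral_prod (fun p => H (palmMap p)) (hH.comp measurable_palmMap).aemeasurable]
  have h1 : ∀ a, ∫⁻ ω, H (palmMap (a, ω)) ∂π = ∫⁻ e, ∫⁻ z,
      H (a, Function.update z.2 0 (a + e, z.1)) ∂(κ.prod π) ∂(expMeasure 1) := by
    intro a
    rw [lintegral_infinitePi_eq κ 0 (F := fun ω => H (palmMap (a, ω)))
      ((hH.comp measurable_palmMap).comp measurable_prodMk_left)]
    simp only [palmMap, Function.update_idem, Function.update_self, ← hπ]
  simp_rw [h1]
  rw [lintegral_exp_add (G := fun p => ∫⁻ z, H (p.1, Function.update z.2 0 (p.2, z.1)) ∂(κ.prod π))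
    hG.lintegral_prod_right', lintegral_infinitePi_eq κ 0 (F := fun ω => ∫⁻ t in Ioc 0 (ω 0).1,
      H (t, ω))]
  · refine lintegral_congr fun e => ?_
    simp only [Function.update_self]
    rw [lintegral_lintegral_swap]
    exact (hG.comp (by fun_prop : Measurable fun q : ℝ × (M × (ℤ → ℝ × M)) =>
      ((q.1, e), q.2))).aemeasurable
  · have hset : MeasurableSet {p : (ℤ → ℝ × M) × ℝ | p.2 ∈ Ioc 0 (p.1 0).1} := by
      have h1 : MeasurableSet {p : (ℤ → ℝ × M) × ℝ | 0 < p.2} :=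
        measurableSet_lt measurable_const measurable_snd
      have h2 : MeasurableSet {p : (ℤ → ℝ × M) × ℝ | p.2 ≤ (p.1 0).1} :=
        measurableSet_le measurable_snd (by fun_prop)
      exact h1.inter h2
    have hI : Measurable fun p : (ℤ → ℝ × M) × ℝ =>
        (Ioc 0 (p.1 0).1).indicator (fun t => H (t, p.1)) p.2 :=
      Measurable.indicator (f := fun p : (ℤ → ℝ × M) × ℝ => H (p.2, p.1)) (by fun_prop) hset
    simp_rw [← lintegral_indicator measurableSet_Ioc]
    exact hI.lintegral_prod_right

/-- The indicator function of the interval between the arrivals of agents `k` and `k + 1`. -/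
noncomputable def gapIndicator (k : ℤ) (p : ℝ × (ℤ → ℝ × M)) : ℝ≥0∞ :=
  (Ioc (arrivalTime p.2 k) (arrivalTime p.2 (k + 1))).indicator (fun _ => 1) p.1

lemma measurable_gapIndicator (k : ℤ) : Measurable (gapIndicator (M := M) k) := by
  have h1 : MeasurableSet {p : ℝ × (ℤ → ℝ × M) | arrivalTime p.2 k < p.1} :=
    measurableSet_lt ((measurable_arrivalTime k).comp measurable_snd) measurable_fst
  have h2 : MeasurableSet {p : ℝ × (ℤ → ℝ × M) | p.1 ≤ arrivalTime p.2 (k + 1)} :=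
    measurableSet_le measurable_fst ((measurable_arrivalTime _).comp measurable_snd)
  exact Measurable.indicator (f := fun _ : ℝ × (ℤ → ℝ × M) => (1 : ℝ≥0∞)) measurable_const
    (h1.inter h2)

lemma tsum_gapIndicator {ω : ℤ → ℝ × M} (h1 : StrictMono (arrivalTime ω))
    (h2 : Tendsto (arrivalTime ω) atTop atTop) (h3 : Tendsto (arrivalTime ω) atBot atBot) (u : ℝ) :
    ∑' k, gapIndicator k (u, ω) = 1 := by
  obtain ⟨m, h4, h5⟩ := exists_lt_le_of_strictMono h1 h2 h3 u
  rw [tsum_eq_single m]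
  · have h6 : u ∈ Ioc (arrivalTime ω m) (arrivalTime ω (m + 1)) := ⟨h4, h5⟩
    exact indicator_of_mem h6 _
  · intro k hk
    refine indicator_of_notMem (s := Ioc (arrivalTime ω k) (arrivalTime ω (k + 1)))
      (fun h => hk ?_) _
    have h6 := h1.lt_iff_lt.1 (h.1.trans_le h5)
    have h7 := h1.lt_iff_lt.1 (h4.trans_le h.2)
    omega

lemma setLIntegral_Ioc_eq (ω : ℤ → ℝ × M) (f : ℝ → ℝ≥0∞) :
    ∫⁻ t in Ioc 0 (ω 0).1, f t = ∫⁻ t, gapIndicator 0 (t, ω) * f t := by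
  have h1 := arrivalTime_add_one ω 0
  rw [zero_add, arrivalTime_zero, zero_add] at h1
  rw [← lintegral_indicator measurableSet_Ioc]
  refine lintegral_congr fun t => ?_
  simp only [gapIndicator, arrivalTime_zero, zero_add, h1, indicator_apply, ite_mul, one_mul,
    zero_mul]

lemma gapIndicator_add (k : ℤ) (ω : ℤ → ℝ × M) (v : ℝ) :
    gapIndicator k (v + arrivalTime ω k, ω) = gapIndicator 0 (v, shift k ω) := by
  classical
  simp only [gapIndicator, arrivalTime_shift, zero_add, sub_self, indicator_apply, mem_Ioc]
  refine if_congr ?_ rfl rfl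
  rw [add_comm 1 k, le_sub_iff_add_le, lt_add_iff_pos_left]

lemma gapIndicator_zero_add (k : ℤ) (ω : ℤ → ℝ × M) (v s : ℝ) :
    gapIndicator 0 (v + arrivalTime ω k - s, ω) = gapIndicator (-k) (v - s, shift k ω) := by
  classical
  simp only [gapIndicator, arrivalTime_shift, zero_add, neg_add_cancel, arrivalTime_zero,
    indicator_apply, mem_Ioc]
  refine if_congr ?_ rfl rfl
  rw [show -k + 1 + k = 1 by ring]
  constructor <;> rintro ⟨h1, h2⟩ <;> constructor <;> linarith

/-- Invariance of the Palm inversion formula under time shifts. -/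
lemma lintegral_Ioc_shift_eq (κ : Measure (ℝ × M)) [IsProbabilityMeasure κ]
    (hT : ∀ᵐ ω ∂(Measure.infinitePi fun _ : ℤ => κ), StrictMono (arrivalTime ω) ∧
      Tendsto (arrivalTime ω) atTop atTop ∧ Tendsto (arrivalTime ω) atBot atBot)
    {G : ℝ × (ℤ → ℝ × M) → ℝ≥0∞} (hG : Measurable G)
    (hcov : ∀ u ω k, G (u - arrivalTime ω k, shift k ω) = G (u, ω)) (s : ℝ) :
    ∫⁻ ω, (∫⁻ t in Ioc 0 (ω 0).1, G (t + s, ω)) ∂(Measure.infinitePi fun _ : ℤ => κ) =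
      ∫⁻ ω, (∫⁻ t in Ioc 0 (ω 0).1, G (t, ω)) ∂(Measure.infinitePi fun _ : ℤ => κ) := by
  set π := Measure.infinitePi fun _ : ℤ => κ with hπ
  -- the contribution of agents `0` and `-k` as the ones before the two times
  set D : ℤ → (ℤ → ℝ × M) → ℝ → ℝ≥0∞ := fun k ω v =>
    gapIndicator 0 (v, ω) * (gapIndicator (-k) (v - s, ω) * G (v, ω)) with hD
  have hDm : ∀ k, Measurable fun p : (ℤ → ℝ × M) × ℝ => D k p.1 p.2 := by
    intro k
    exact ((measurable_gapIndicator 0).comp (measurable_snd.prodMk measurable_fst)).mul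
      (((measurable_gapIndicator (-k)).comp
        ((measurable_snd.sub_const s).prodMk measurable_fst)).mul
        (hG.comp (measurable_snd.prodMk measurable_fst)))
  have hDi : ∀ k, Measurable fun ω => ∫⁻ v, D k ω v := fun k => (hDm k).lintegral_prod_right
  have hsh := fun k : ℤ => measurePreserving_shift κ k
  -- The shifted time `u = t + s` lies in exactly one gap `k`; recentering at agent `k` puts `u` in
  -- gap `0` and `u - s` in gap `-k`.
  have h1 : ∀ᵐ ω ∂π, ∫⁻ t in Ioc 0 (ω 0).1, G (t + s, ω) = ∑' k, ∫⁻ v, D k (shift k ω) v := by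
    filter_upwards [hT] with ω hω
    have hm : Measurable fun u => gapIndicator 0 (u - s, ω) * G (u, ω) :=
      ((measurable_gapIndicator 0).comp ((measurable_id.sub_const s).prodMk measurable_const)).mul
        (hG.comp (measurable_id.prodMk measurable_const))
    have hk : ∀ k, ∫⁻ v, D k (shift k ω) v =
        ∫⁻ u, gapIndicator k (u, ω) * (gapIndicator 0 (u - s, ω) * G (u, ω)) := by
      intro k
      rw [← lintegral_add_right_eq_self (fun u => gapIndicator k (u, ω) *
        (gapIndicator 0 (u - s, ω) * G (u, ω))) (arrivalTime ω k)]
      refine lintegral_congr fun v => ?_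
      rw [gapIndicator_add, gapIndicator_zero_add, ← hcov (v + arrivalTime ω k) ω k,
        add_sub_cancel_right]
    simp_rw [hk]
    have hm' : ∀ k, AEMeasurable (fun u => gapIndicator k (u, ω) *
        (gapIndicator 0 (u - s, ω) * G (u, ω))) := fun k => (((measurable_gapIndicator k).comp
      (measurable_id.prodMk measurable_const)).mul hm).aemeasurable
    rw [← lintegral_tsum hm']
    simp_rw [ENNReal.tsum_mul_right, tsum_gapIndicator hω.1 hω.2.1 hω.2.2, one_mul]
    rw [setLIntegral_Ioc_eq, ← lintegral_add_right_eq_self (fun u =>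
      gapIndicator 0 (u - s, ω) * G (u, ω)) s]
    simp only [add_sub_cancel_right]
  have h2 : ∀ᵐ ω ∂π, ∑' k, ∫⁻ v, D k ω v = ∫⁻ t in Ioc 0 (ω 0).1, G (t, ω) := by
    filter_upwards [hT] with ω hω
    have hm : ∀ k, AEMeasurable (fun v => D k ω v) := fun k =>
      ((hDm k).comp measurable_prodMk_left).aemeasurable
    rw [← lintegral_tsum hm, setLIntegral_Ioc_eq]
    refine lintegral_congr fun v => ?_
    rw [ENNReal.tsum_mul_left, ENNReal.tsum_mul_right,
      (show ∑' k : ℤ, gapIndicator (-k) (v - s, ω) = ∑' k, gapIndicator k (v - s, ω) from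
        (Equiv.neg ℤ).tsum_eq fun k => gapIndicator k (v - s, ω)), tsum_gapIndicator hω.1 hω.2.1 hω.2.2, one_mul]
  have h3 : ∀ k, AEMeasurable (fun ω => ∫⁻ v, D k (shift k ω) v) π := fun k =>
    ((hDi k).comp (hsh k).measurable).aemeasurable
  -- Mass transport: both sides are sums over `k` of the mean of the integral of `D k`, on the left
  -- after a shift by `k`, which preserves the law.
  rw [lintegral_congr_ae h1, ← lintegral_congr_ae h2, lintegral_tsum h3,
    lintegral_tsum fun k => (hDi k).aemeasurable]
  exact tsum_congr fun k => (hsh k).lintegral_comp (hDi k)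

end Palm

end Upkeep

/-! ### Regenerations occur arbitrarily far in the past -/

namespace Upkeep
open scoped ENNReal NNReal

/-- A shift-invariant event that depends only on the negative coordinates is trivial. -/
lemma measure_eq_zero_or_one_of_shift {E : Type*} [MeasurableSpace E] (κ : Measure E)
    [IsProbabilityMeasure κ] {S : Set (ℤ → E)} (hS : MeasurableSet S)
    (hinv : ∀ k ω, shift k ω ∈ S ↔ ω ∈ S)
    (hpast : ∀ ω ω' : ℤ → E, (∀ j < 0, ω j = ω' j) → (ω ∈ S ↔ ω' ∈ S)) :
    (Measure.infinitePi fun _ : ℤ => κ) S = 0 ∨ (Measure.infinitePi fun _ : ℤ => κ) S = 1 := by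
  classical
  obtain ⟨x₀⟩ : Nonempty E := κ.nonempty_of_neZero
  have hi : iIndepFun (fun n (ω : ℤ → E) => ω n) (Measure.infinitePi fun _ : ℤ => κ) :=
    iIndepFun_infinitePi (X := fun _ x => x) (fun _ => measurable_id)
  refine measure_zero_or_one_of_measurableSet_limsup_atBot
    (fun n => (measurable_pi_apply n).comap_le) ((iIndepFun_iff_iIndep _ _ _).1 hi) ?_
  rw [atBot_basis.limsup_eq_iInf_iSup]
  simp only [MeasurableSpace.measurableSet_iInf]
  intro N _
  -- By invariance, membership can be decided after a shift by `N`, from the coordinates below `N`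
  -- alone; `x₀` fills the coordinates that do not matter. As `N` is arbitrary, `S` is a tail event
  -- at `-∞`, and Kolmogorov's law applies.
  set g : (ℤ → E) → ℤ → E := fun ω j => if j < 0 then ω (j + N) else x₀ with hg
  have hgS : S = g ⁻¹' S := by
    ext ω
    rw [mem_preimage, ← hinv N ω]
    exact hpast _ _ fun j hj => by simp [hg, hj, shift]
  have hgm : Measurable[⨆ a ∈ Iic N, MeasurableSpace.comap (fun ω : ℤ → E => ω a) inferInstance] g
      := by
    refine (@measurable_pi_iff (ℤ → E) ℤ (fun _ => E)
      (⨆ a ∈ Iic N, MeasurableSpace.comap (fun ω : ℤ → E => ω a) inferInstance) _ g).2 fun j => ?_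
    by_cases hj : j < 0
    · simp only [hg, hj, if_true]
      refine (comap_measurable (fun ω : ℤ → E => ω (j + N))).mono ?_ le_rfl
      exact le_iSup₂_of_le (j + N) (by simp only [mem_Iic]; omega) le_rfl
    · simp only [hg, hj, if_false]
      exact measurable_const
  rw [hgS]
  exact hgm hS

section Sequences

variable {M : Type*} [MeasurableSpace M] (κ : Measure M) [IsProbabilityMeasure κ]

lemma ae_expMeasure_pos : ∀ᵐ x ∂(expMeasure 1), 0 < x := by
  rw [expMeasure_one_eq]
  refine (ae_withDensity_iff (measurable_erlangPDF 0)).2 ?_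
  have h0 : ∀ᵐ a : ℝ, a ≠ 0 := by simp [ae_iff]
  filter_upwards [h0] with x hx h
  by_contra hlt
  refine h (indicator_of_notMem (fun h' => hx ?_) _)
  exact le_antisymm (not_lt.1 hlt) h'

lemma expMeasure_Ici_pos (x : ℝ) (hx : 0 ≤ x) : 0 < expMeasure 1 {y | x ≤ y} := by
  have h1 := cdf_expMeasure_eq one_pos x
  rw [cdf_eq_real, if_pos hx] at h1
  have h2 : expMeasure 1 {y | x ≤ y} ≥ expMeasure 1 (Iic x)ᶜ :=
    measure_mono fun y hy => (not_le.1 (show ¬ y ≤ x from hy)).le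
  refine lt_of_lt_of_le ?_ h2
  have h3 := probReal_compl_eq_one_sub (μ := expMeasure 1) (measurableSet_Iic (a := x))
  rw [h1] at h3
  have h4 : 0 < (expMeasure 1).real (Iic x)ᶜ := by
    rw [h3]; have := Real.exp_pos (-(1 * x)); linarith
  exact (ENNReal.toReal_pos_iff.1 h4).1

/-- Sums of exponential gaps tend to infinity. -/
lemma ae_eventually_le_sum :
    ∀ᵐ y ∂(Measure.infinitePi fun _ : ℕ => (expMeasure 1).prod κ), ∀ h : ℕ,
      ∀ᶠ n in atTop, (h : ℝ) ≤ ∑ i ∈ Finset.range (n + 1), (y i).1 := by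
  rw [ae_all_iff]
  intro h
  have h1 := tsum_measure_sum_lt κ MeasurableSet.univ h
  filter_upwards [ae_eventually_notMem (h1.trans_ne (by simp))] with y hy
  filter_upwards [hy] with n hn
  simpa using hn

/-- Only finitely many marks exceed the sum of the preceding gaps. -/
lemma ae_eventually_lt_sum {l : M → ℝ} (hl : Measurable l) (hint : Integrable l κ) :
    ∀ᵐ y ∂(Measure.infinitePi fun _ : ℕ => (expMeasure 1).prod κ),
      ∀ᶠ n in atTop, l (y (n + 1)).2 < ∑ i ∈ Finset.range (n + 1), (y i).1 := by
  set π := Measure.infinitePi fun _ : ℕ => (expMeasure 1).prod κ with hπ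
  have hS : ∀ n, Measurable fun y : ℕ → ℝ × M => ∑ i ∈ Finset.range (n + 1), (y i).1 :=
    fun n => by fun_prop
  -- The mark of `n + 1` is independent of the earlier gaps and can be integrated last. The `+ 1`
  -- turns the weak inequality into the strict one of `tsum_measure_sum_lt`.
  have hle : ∀ n, π {y | ∑ i ∈ Finset.range (n + 1), (y i).1 ≤ l (y (n + 1)).2} ≤
      ∫⁻ x, π {y | ∑ i ∈ Finset.range (n + 1), (y i).1 < l x + 1} ∂κ := by
    intro n
    have hm : MeasurableSet {y : ℕ → ℝ × M | ∑ i ∈ Finset.range (n + 1), (y i).1 ≤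
        l (y (n + 1)).2} := measurableSet_le (hS n) (by fun_prop)
    have hmp := measurePreserving_update_infinitePi (ι := ℕ) ((expMeasure 1).prod κ) κ
      (f := fun q => (q.2.1, q.1)) (by fun_prop) (by
        have : (fun q : M × ℝ × M => (q.2.1, q.1)) = Prod.swap ∘ Prod.map id Prod.fst := by
          ext q <;> rfl
        rw [this, ← Measure.map_map (by fun_prop) (by fun_prop),
          ← Measure.map_prod_map _ _ measurable_id measurable_fst, Measure.map_fst_prod,
          Measure.map_id, measure_univ, one_smul, Measure.prod_swap]) (n + 1)
    rw [← hmp.measure_preimage hm.nullMeasurableSet, Measure.prod_apply (hmp.measurable hm)]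
    refine lintegral_mono fun x => measure_mono fun y hy => ?_
    simp only [mem_preimage, mem_ofPred_eq, Function.update_self] at hy ⊢
    refine lt_of_le_of_lt (le_of_eq (Finset.sum_congr rfl fun i hi => ?_)) (hy.trans_lt (lt_add_one _))
    rw [Function.update_of_ne (by have := Finset.mem_range.1 hi; omega)]
  have hsum : ∑' n, π {y | ∑ i ∈ Finset.range (n + 1), (y i).1 ≤ l (y (n + 1)).2} ≠ ∞ := by
    refine ne_top_of_le_ne_top ?_ (ENNReal.tsum_le_tsum hle)
    have hm : ∀ n, Measurable fun x => π {y | ∑ i ∈ Finset.range (n + 1), (y i).1 < l x + 1} := by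
      intro n
      have : MeasurableSet {q : M × (ℕ → ℝ × M) |
          ∑ i ∈ Finset.range (n + 1), (q.2 i).1 < l q.1 + 1} :=
        measurableSet_lt ((hS n).comp measurable_snd) (by fun_prop)
      exact measurable_measure_prodMk_left this
    rw [← lintegral_tsum fun n => (hm n).aemeasurable]
    -- For a fixed mark, the probabilities add up to the renewal measure of `Iio (l x + 1)`. A
    -- finite mean of the marks thus makes the total sum finite, as Borel-Cantelli requires.
    have h1 : ∀ x, ∑' n, π {y | ∑ i ∈ Finset.range (n + 1), (y i).1 < l x + 1} =
        ENNReal.ofReal (l x + 1) := fun x => by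
      have := tsum_measure_sum_lt κ MeasurableSet.univ (l x + 1)
      simpa using this
    simp_rw [h1]
    exact (hint.add (integrable_const 1)).lintegral_lt_top.ne
  filter_upwards [ae_eventually_notMem hsum] with y hy
  filter_upwards [hy] with n hn
  simpa using hn

/-- With positive probability no mark exceeds the sum of the preceding gaps. -/
lemma measure_forall_lt_sum_pos {l : M → ℝ} (hl : Measurable l) (hint : Integrable l κ) :
    0 < (Measure.infinitePi fun _ : ℕ => (expMeasure 1).prod κ)
      {y | ∀ k, l (y (k + 1)).2 < ∑ i ∈ Finset.range (k + 1), (y i).1} := by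
  set π := Measure.infinitePi fun _ : ℕ => (expMeasure 1).prod κ with hπ
  -- With a head start of `c`, no mark exceeds the sum of the preceding gaps. Almost every sequence
  -- lies in some `A c`, so some `A c` has positive probability. An independent first gap of length
  -- at least `c` then supplies the head start.
  set A : ℕ → Set (ℕ → ℝ × M) := fun c =>
    {y | ∀ k, l (y k).2 < c + ∑ i ∈ Finset.range k, (y i).1} with hA
  have hAm : ∀ c, MeasurableSet (A c) := fun c => by
    simp only [hA, ofPred_forall]
    exact MeasurableSet.iInter fun k => measurableSet_lt (by fun_prop) (by fun_prop)
  obtain ⟨c, hc⟩ : ∃ c, 0 < π (A c) := by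
    by_contra! h
    have h0 : ∀ᵐ y ∂π, ∀ c, y ∉ A c := ae_all_iff.2 fun c => by
      rw [ae_iff]; simpa using h c
    obtain ⟨y, hy1, hy2⟩ := (h0.and (ae_eventually_lt_sum κ hl hint)).exists
    obtain ⟨N, hN⟩ := eventually_atTop.1 hy2
    obtain ⟨c, hc⟩ := exists_nat_gt (∑ k ∈ Finset.range (N + 1),
      |l (y k).2 - ∑ i ∈ Finset.range k, (y i).1|)
    refine hy1 c fun k => ?_
    rcases lt_or_ge k (N + 1) with hk | hk
    · have h1 := Finset.single_le_sum (f := fun k => |l (y k).2 - ∑ i ∈ Finset.range k, (y i).1|)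
        (fun i _ => abs_nonneg _) (Finset.mem_range.2 hk)
      have h2 := le_abs_self (l (y k).2 - ∑ i ∈ Finset.range k, (y i).1)
      linarith
    · obtain ⟨k, rfl⟩ : ∃ j, k = j + 1 := ⟨k - 1, by omega⟩
      have := hN k (by omega)
      have h0 : (0 : ℝ) ≤ c := Nat.cast_nonneg c
      linarith
  have hmp := measurePreserving_update_infinitePi (ι := ℕ) ((expMeasure 1).prod κ)
    ((expMeasure 1).prod κ) measurable_fst (by rw [Measure.map_fst_prod]; simp) 0
  have hsucc : MeasurePreserving (fun (y : ℕ → ℝ × M) i => y (i + 1)) π π :=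
    ⟨by fun_prop, Measure.map_infinitePi_infinitePi_of_inj Nat.succ_injective⟩
  have hDm : MeasurableSet {y : ℕ → ℝ × M |
      ∀ k, l (y (k + 1)).2 < ∑ i ∈ Finset.range (k + 1), (y i).1} := by
    simp only [ofPred_forall]
    exact MeasurableSet.iInter fun k => measurableSet_lt (by fun_prop) (by fun_prop)
  rw [← hmp.measure_preimage hDm.nullMeasurableSet]
  refine lt_of_lt_of_le ?_ (measure_mono (s := ({x : ℝ | (c : ℝ) ≤ x} ×ˢ univ) ×ˢ
    ((fun (y : ℕ → ℝ × M) i => y (i + 1)) ⁻¹' A c)) ?_)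
  · rw [Measure.prod_prod, Measure.prod_prod, hsucc.measure_preimage (hAm c).nullMeasurableSet,
      measure_univ, mul_one]
    exact ENNReal.mul_pos (expMeasure_Ici_pos c (Nat.cast_nonneg c)).ne' hc.ne'
  · rintro ⟨⟨x, m⟩, y⟩ ⟨⟨hx, -⟩, hy⟩ k
    simp only [mem_preimage, hA, mem_ofPred_eq] at hx hy
    simp only [Finset.sum_range_succ', Function.update_self]
    simp only [ne_eq, Nat.add_eq_zero_iff, one_ne_zero, and_false, not_false_eq_true,
      Function.update_of_ne]
    linarith [hy k]

end Sequences

namespace Configuration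

variable {Θ : Type*} [MeasurableSpace Θ]

/-- The configuration seen at time `u`, when agent `0` arrives at time `0`; the coordinate `n` holds
the gap after agent `n` and the mark of agent `n + 1`. -/
noncomputable def ofGaps (u : ℝ) (ω : ℤ → ℝ × Θ × ℝ × ℝ) : Configuration Θ :=
  fun n => (arrivalTime ω n - u, (ω (n - 1)).2)

lemma measurable_ofGaps :
    Measurable fun p : ℝ × (ℤ → ℝ × Θ × ℝ × ℝ) => ofGaps p.1 p.2 := by
  refine measurable_pi_iff.2 fun n => ?_
  have := measurable_arrivalTime (M := Θ × ℝ × ℝ) n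
  unfold ofGaps
  fun_prop

lemma translate_ofGaps (s u : ℝ) (ω : ℤ → ℝ × Θ × ℝ × ℝ) :
    (ofGaps u ω).translate s = ofGaps (u + s) ω := by
  ext n : 1
  simp only [translate, ofGaps]
  rw [sub_sub]

lemma ofGaps_shift (u : ℝ) (ω : ℤ → ℝ × Θ × ℝ × ℝ) (k : ℤ) :
    ofGaps (u - arrivalTime ω k) (shift k ω) = (ofGaps u ω).reindex k := by
  ext n : 1
  simp only [reindex, ofGaps, arrivalTime_shift, shift]
  congr 1
  · ring
  · congr 2; ring

lemma regenerates_shift (ω : ℤ → ℝ × Θ × ℝ × ℝ) (k m : ℤ) :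
    (ofGaps 0 (shift k ω)).Regenerates m ↔ (ofGaps 0 ω).Regenerates (m + k) := by
  have h := ofGaps_shift (arrivalTime ω k) ω k
  rw [sub_self] at h
  rw [h, regenerates_reindex, ← zero_add (arrivalTime ω k), ← translate_ofGaps,
    regenerates_translate]

lemma arrivalTime_natCast (ω : ℤ → ℝ × Θ × ℝ × ℝ) (n : ℕ) :
    arrivalTime ω n = ∑ i ∈ Finset.range n, (ω i).1 := by
  induction n with
  | zero => simp [arrivalTime_zero]
  | succ n ih => rw [Nat.cast_succ, arrivalTime_add_one, ih, Finset.sum_range_succ]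

lemma arrivalTime_neg_natCast (ω : ℤ → ℝ × Θ × ℝ × ℝ) (n : ℕ) :
    arrivalTime ω (-n) = -∑ i ∈ Finset.range n, (ω (-1 - i)).1 := by
  induction n with
  | zero => simp [arrivalTime_zero]
  | succ n ih =>
    have h := arrivalTime_add_one ω (-(n + 1 : ℕ))
    rw [show -((n + 1 : ℕ) : ℤ) + 1 = -n by push_cast; ring, ih,
      show -((n + 1 : ℕ) : ℤ) = -1 - n by push_cast; ring] at h
    rw [show -((n + 1 : ℕ) : ℤ) = -1 - n by push_cast; ring, Finset.sum_range_succ]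
    linarith

variable (κ : Measure (Θ × ℝ × ℝ)) [IsProbabilityMeasure κ]

lemma ae_infinitePi_forall {E : Type*} [MeasurableSpace E] {κ : Measure E}
    [IsProbabilityMeasure κ] {p : E → Prop} (h : ∀ᵐ x ∂κ, p x) :
    ∀ᵐ ω ∂(Measure.infinitePi fun _ : ℤ => κ), ∀ n, p (ω n) :=
  ae_all_iff.2 fun n => (measurePreserving_eval_infinitePi (fun _ : ℤ => κ) n).quasiMeasurePreserving.ae h

lemma measurePreserving_forward {E : Type*} [MeasurableSpace E] (κ : Measure E)
    [IsProbabilityMeasure κ] : MeasurePreserving (fun (ω : ℤ → E) (i : ℕ) => ω i)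
      (Measure.infinitePi fun _ : ℤ => κ) (Measure.infinitePi fun _ : ℕ => κ) :=
  ⟨by fun_prop, Measure.map_infinitePi_infinitePi_of_inj Nat.cast_injective⟩

lemma measurePreserving_backward {E : Type*} [MeasurableSpace E] (κ : Measure E)
    [IsProbabilityMeasure κ] : MeasurePreserving (fun (ω : ℤ → E) (i : ℕ) => ω (-1 - i))
      (Measure.infinitePi fun _ : ℤ => κ) (Measure.infinitePi fun _ : ℕ => κ) :=
  ⟨by fun_prop, Measure.map_infinitePi_infinitePi_of_inj fun i j h => by simpa using h⟩

lemma ae_arrivalTime :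
    ∀ᵐ ω ∂(Measure.infinitePi fun _ : ℤ => (expMeasure 1).prod κ), StrictMono (arrivalTime ω) ∧
      Tendsto (arrivalTime ω) atTop atTop ∧ Tendsto (arrivalTime ω) atBot atBot := by
  have hpos : ∀ᵐ x ∂((expMeasure 1).prod κ), 0 < x.1 :=
    Measure.quasiMeasurePreserving_fst.ae ae_expMeasure_pos
  filter_upwards [ae_infinitePi_forall hpos,
    (measurePreserving_forward _).quasiMeasurePreserving.ae (ae_eventually_le_sum κ),
    (measurePreserving_backward _).quasiMeasurePreserving.ae (ae_eventually_le_sum κ)]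
    with ω h1 h2 h3
  have hmono : StrictMono (arrivalTime ω) := strictMono_int_of_lt_succ fun n => by
    rw [arrivalTime_add_one]; linarith [h1 n]
  refine ⟨hmono, tendsto_atTop_atTop_of_monotone hmono.monotone fun b => ?_,
    tendsto_atBot_atBot_of_monotone hmono.monotone fun b => ?_⟩
  · obtain ⟨h, hh⟩ := exists_nat_ge b
    obtain ⟨n, hn⟩ := (h2 h).exists
    exact ⟨(n + 1 : ℕ), by rw [arrivalTime_natCast]; linarith⟩
  · obtain ⟨h, hh⟩ := exists_nat_ge (-b)
    obtain ⟨n, hn⟩ := (h3 h).exists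
    exact ⟨-(n + 1 : ℕ), by rw [arrivalTime_neg_natCast]; linarith⟩

lemma measurableSet_regenerates_ofGaps (m : ℤ) :
    MeasurableSet {ω : ℤ → ℝ × Θ × ℝ × ℝ | (ofGaps 0 ω).Regenerates m} :=
  (measurable_ofGaps.comp (measurable_prodMk_left (x := (0 : ℝ)))) (measurableSet_regenerates m)

/-- Read backwards from agent `0`, gaps and marks form a one-sided i.i.d. sequence. Agent `-(k + 1)`
has his mark at backward index `k + 1` and arrived the sum of the first `k + 1` gaps ago, so the
event is that of `measure_forall_lt_sum_pos`. -/
lemma measure_regenerates_pos (hint : Integrable (fun x : Θ × ℝ × ℝ => x.2.2) κ) :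
    0 < (Measure.infinitePi fun _ : ℤ => (expMeasure 1).prod κ)
      {ω | (ofGaps 0 ω).Regenerates 0} := by
  have h := measure_forall_lt_sum_pos κ (l := fun x : Θ × ℝ × ℝ => x.2.2) (by fun_prop) hint
  have hDm : MeasurableSet {y : ℕ → ℝ × Θ × ℝ × ℝ |
      ∀ k, (y (k + 1)).2.2.2 < ∑ i ∈ Finset.range (k + 1), (y i).1} := by
    simp only [ofPred_forall]
    exact MeasurableSet.iInter fun k => measurableSet_lt (by fun_prop) (by fun_prop)
  rw [← (measurePreserving_backward _).measure_preimage hDm.nullMeasurableSet] at h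
  refine h.trans_le (measure_mono fun ω hω j hj => ?_)
  obtain ⟨k, rfl⟩ : ∃ k : ℕ, j = -(k + 1 : ℕ) := ⟨(-j - 1).toNat, by omega⟩
  have := hω k
  simp only [lifeEnd, ofGaps, arrivalTime_zero, arrivalTime_neg_natCast]
  rw [show -((k + 1 : ℕ) : ℤ) - 1 = -1 - (k + 1 : ℕ) by ring]
  linarith

/-- Almost surely there are regenerations arbitrarily far in the past. -/
lemma ae_exists_regenerates (hint : Integrable (fun x : Θ × ℝ × ℝ => x.2.2) κ) :
    ∀ᵐ ω ∂(Measure.infinitePi fun _ : ℤ => (expMeasure 1).prod κ),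
      ∀ N, ∃ m ≤ N, (ofGaps 0 ω).Regenerates m := by
  set π := Measure.infinitePi fun _ : ℤ => (expMeasure 1).prod κ with hπ
  set S := {ω : ℤ → ℝ × Θ × ℝ × ℝ | ∀ N, ∃ m ≤ N, (ofGaps 0 ω).Regenerates m} with hS
  have hSm : MeasurableSet S := by
    simp only [hS, ofPred_forall, ofPred_exists]
    exact MeasurableSet.iInter fun N => MeasurableSet.iUnion fun m =>
      (MeasurableSet.const _).inter (measurableSet_regenerates_ofGaps m)
  have hpos : π S ≠ 0 := by
    intro h0
    -- Poincaré recurrence: almost every sequence that regenerates at `0` also regenerates at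
    -- infinitely many `-n`. If `S` were null, regeneration at `0` would be null as well.
    have h1 := (measurePreserving_shift ((expMeasure 1).prod κ) (-1)).conservative
      |>.ae_mem_imp_frequently_image_mem
      (measurableSet_regenerates_ofGaps (Θ := Θ) 0).nullMeasurableSet
    have h2 : ∀ᵐ ω ∂π, ω ∉ S := by rw [ae_iff]; simpa using h0
    refine (measure_regenerates_pos κ hint).ne' ?_
    rw [← hπ, measure_eq_zero_iff_ae_notMem]
    filter_upwards [h1, h2] with ω hω1 hω2 hω3
    refine hω2 fun N => ?_
    have hit : ∀ n : ℕ, (shift (-1))^[n] ω = shift (-n) ω := by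
      intro n
      induction n with
      | zero => ext j : 1; simp [shift]
      | succ n ih =>
        rw [Function.iterate_succ_apply', ih]
        ext j : 1
        simp only [shift]
        congr 1; push_cast; ring
    obtain ⟨n, hn, hr⟩ := frequently_atTop.1 (hω1 hω3) (-N).toNat
    rw [hit, regenerates_shift] at hr
    exact ⟨0 + -n, by omega, hr⟩
  -- `S` is shift invariant and depends only on negative coordinates, as regeneration at `m ≤ 0`
  -- involves only agents up to `m`.
  have hone := (measure_eq_zero_or_one_of_shift ((expMeasure 1).prod κ) hSm ?_ ?_).resolve_left hpos
  · exact (prob_compl_eq_zero_iff hSm).2 hone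
  · intro k ω
    simp only [hS, mem_ofPred_eq, regenerates_shift]
    refine ⟨fun h N => ?_, fun h N => ?_⟩
    · obtain ⟨m, hm, hr⟩ := h (N - k)
      exact ⟨m + k, by omega, hr⟩
    · obtain ⟨m, hm, hr⟩ := h (N + k)
      exact ⟨m - k, by omega, by rwa [sub_add_cancel]⟩
  · intro ω ω' h
    have hT : ∀ n ≤ 0, arrivalTime ω n = arrivalTime ω' n := by
      intro n hn
      simp only [arrivalTime, Finset.Ico_eq_empty_of_le hn, Finset.sum_empty]
      congr 1
      exact Finset.sum_congr rfl fun j hj => by rw [h j (Finset.mem_Ico.1 hj).2]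
    have hr : ∀ m ≤ 0, (ofGaps 0 ω).Regenerates m ↔ (ofGaps 0 ω').Regenerates m := by
      intro m hm
      refine regenerates_congr (fun j hj => ?_) ?_
      · simp only [ofGaps, hT j (by omega), h (j - 1) (by omega)]
      · simp only [ofGaps, hT m hm]
    simp only [hS, mem_ofPred_eq]
    refine ⟨fun H N => ?_, fun H N => ?_⟩
    · obtain ⟨m, hm, hm'⟩ := H (min N 0)
      exact ⟨m, by omega, (hr m (by omega)).1 hm'⟩
    · obtain ⟨m, hm, hm'⟩ := H (min N 0)
      exact ⟨m, by omega, (hr m (by omega)).2 hm'⟩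

lemma ae_isRegular_ofGaps (hint : Integrable (fun x : Θ × ℝ × ℝ => x.2.2) κ)
    (hpos : ∀ᵐ x ∂κ, 0 < x.2.2) :
    ∀ᵐ ω ∂(Measure.infinitePi fun _ : ℤ => (expMeasure 1).prod κ),
      ∀ u, (ofGaps u ω).IsRegular := by
  have hpos' : ∀ᵐ x ∂((expMeasure 1).prod κ), 0 < x.2.2.2 :=
    Measure.quasiMeasurePreserving_snd.ae hpos
  filter_upwards [ae_arrivalTime κ, ae_exists_regenerates κ hint, ae_infinitePi_forall hpos']
    with ω h1 h2 h3 u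
  refine ⟨fun i j hij => ?_, ?_, ?_, fun n => h3 _, fun N => ?_⟩
  · simpa [ofGaps] using h1.1 hij
  · exact tendsto_atTop_add_const_right _ (-u) h1.2.1
  · exact tendsto_atBot_add_const_right _ (-u) h1.2.2
  · obtain ⟨m, hm, hr⟩ := h2 N
    refine ⟨m, hm, ?_⟩
    rwa [← zero_add u, ← translate_ofGaps, regenerates_translate]

/-- Infinitely many agents have a mark in a set of positive measure. -/
lemma ae_frequently_mem {E : Type*} [MeasurableSpace E] (κ : Measure E) [IsProbabilityMeasure κ]
    {A : Set E} (hA : MeasurableSet A) (h : κ A ≠ 0) :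
    ∀ᵐ y ∂(Measure.infinitePi fun _ : ℕ => κ), ∃ᶠ n in atTop, y n ∈ A := by
  have hm : ∀ n, MeasurableSet {y : ℕ → E | y n ∈ A} := fun n => measurable_pi_apply n hA
  have hpi : ∀ s : Finset ℕ, (Measure.infinitePi fun _ : ℕ => κ) (⋂ n ∈ s, {y : ℕ → E | y n ∈ A})
      = ∏ n ∈ s, κ A := by
    intro s
    rw [← Measure.infinitePi_pi (μ := fun _ : ℕ => κ) (s := s) (t := fun _ => A) fun _ _ => hA]
    congr 1
    ext y
    simp
  have h1 : ∀ n, (Measure.infinitePi fun _ : ℕ => κ) {y : ℕ → E | y n ∈ A} = κ A := fun n => by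
    simpa using hpi {n}
  have hind : iIndepSet (fun n => {y : ℕ → E | y n ∈ A}) (Measure.infinitePi fun _ : ℕ => κ) :=
    (iIndepSet_iff_meas_biInter hm).2 fun s => by simp_rw [hpi s, h1]
  have h2 := measure_limsup_eq_one hm hind (by
    simp_rw [h1]; exact ENNReal.tsum_const_eq_top_of_ne_zero h)
  have h3 := (prob_compl_eq_zero_iff (MeasurableSet.measurableSet_limsup hm)).2 h2
  filter_upwards [compl_mem_ae_iff.2 h3] with y hy
  rw [compl_compl, mem_limsup_iff_frequently_mem] at hy
  exact hy

end Configuration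

end Upkeep

/-! ### Independence, and selection from an i.i.d. sequence -/

namespace Upkeep
open scoped ENNReal NNReal

section Independence

/-- Used to adjoin the age, which is independent of the gaps and marks, to the information in `f`.
-/
lemma IndepFun.prod_left {A B C D : Type*} [MeasurableSpace A] [MeasurableSpace B]
    [MeasurableSpace C] [MeasurableSpace D] {α : Measure A} [IsProbabilityMeasure α]
    {π : Measure B} [IsProbabilityMeasure π] {f : B → C} {g : B → D} (hf : Measurable f)
    (hg : Measurable g) (h : IndepFun f g π) :
    IndepFun (fun p : A × B => (p.1, f p.2)) (fun p : A × B => g p.2) (α.prod π) := by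
  rw [indepFun_iff_measure_inter_preimage_eq_mul]
  intro s t hs ht
  have hs' : MeasurableSet ((fun p : A × B => (p.1, f p.2)) ⁻¹' s) :=
    (measurable_fst.prodMk (hf.comp measurable_snd)) hs
  have ht' : MeasurableSet ((fun p : A × B => g p.2) ⁻¹' t) := (hg.comp measurable_snd) ht
  have h1 : (α.prod π) ((fun p : A × B => g p.2) ⁻¹' t) = π (g ⁻¹' t) :=
    (measurePreserving_snd (μ := α) (ν := π)).measure_preimage (hg ht).nullMeasurableSet
  rw [h1, Measure.prod_apply (hs'.inter ht'), Measure.prod_apply hs',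
    ← lintegral_mul_const _ (measurable_measure_prodMk_left hs')]
  refine lintegral_congr fun a => ?_
  exact h.measure_inter_preimage_eq_mul _ _ ((measurable_prodMk_left (x := a)) hs) ht

lemma indepFun_comp_of_measurePreserving {A B C D : Type*} [MeasurableSpace A] [MeasurableSpace B]
    [MeasurableSpace C] [MeasurableSpace D] {μ : Measure A} {π : Measure B} {Z : A → B}
    (hZ : MeasurePreserving Z μ π) {f : B → C} {g : B → D} (hf : Measurable f) (hg : Measurable g)
    (h : IndepFun f g π) :
    IndepFun (fun a => f (Z a)) (fun a => g (Z a)) μ := by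
  rw [indepFun_iff_measure_inter_preimage_eq_mul] at h ⊢
  intro s t hs ht
  have h1 := hZ.measure_preimage ((hf hs).inter (hg ht)).nullMeasurableSet
  have h2 := hZ.measure_preimage (hf hs).nullMeasurableSet
  have h3 := hZ.measure_preimage (hg ht).nullMeasurableSet
  rw [h s t hs ht, ← h2, ← h3] at h1
  exact h1

/-- Lifts the resampling of an inner factor past an outer one. Its iteration reaches the lifespan,
the innermost component of a coordinate. -/
lemma measurePreserving_prodMap_right {A B C F : Type*} [MeasurableSpace A] [MeasurableSpace B]
    [MeasurableSpace C] [MeasurableSpace F] {α : Measure A} {β : Measure B} {γ : Measure C}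
    {η : Measure F} [SFinite α] [SFinite β] [SigmaFinite γ] [SFinite η] [SigmaFinite α]
    {g : F × B → C} (hg : MeasurePreserving g (η.prod β) γ) :
    MeasurePreserving (fun q : F × A × B => (q.2.1, g (q.1, q.2.2))) (η.prod (α.prod β))
      (α.prod γ) := by
  have hgm := hg.measurable
  have hm : Measurable fun q : F × A × B => (q.2.1, g (q.1, q.2.2)) := by fun_prop
  refine ⟨hm, (Measure.prod_eq fun s t hs ht => ?_).symm⟩
  rw [Measure.map_apply hm (hs.prod ht), Measure.prod_apply (hm (hs.prod ht)),
    ← hg.measure_preimage ht.nullMeasurableSet, Measure.prod_apply (hgm ht),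
    ← lintegral_const_mul _ (measurable_measure_prodMk_left (hgm ht))]
  refine lintegral_congr fun x => ?_
  rw [← Measure.prod_prod]
  rfl

end Independence

section Skipping

open Classical in
/-- The marks of an i.i.d. sequence at the times that a nonanticipating rule selects are i.i.d. -/
lemma hasLaw_nth {Ω F : Type*} [mΩ : MeasurableSpace Ω] [MeasurableSpace F] {μ : Measure Ω}
    [IsProbabilityMeasure μ] {ν : Measure F} [IsProbabilityMeasure ν] {fix : ℕ → Ω → Prop}
    {l : ℕ → Ω → F} (m : ℕ → MeasurableSpace Ω) (hm : ∀ n, m n ≤ mΩ)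
    (hlm : ∀ n, Measurable (l n)) (hl : ∀ n, μ.map (l n) = ν)
    (hind : ∀ n, Indep (m n) (MeasurableSpace.comap (l n) inferInstance) μ)
    (hfix : ∀ n, ∀ j ≤ n, MeasurableSet[m n] {ω | fix j ω})
    (hlm' : ∀ n, ∀ j < n, Measurable[m n] (l j))
    (hinf : ∀ᵐ ω ∂μ, {n | fix n ω}.Infinite) :
    HasLaw (fun ω i => l (Nat.nth (fun n => fix n ω) i) ω) (Measure.infinitePi fun _ : ℕ => ν) μ := by
  have hcount : ∀ n, ∀ j ≤ n, Measurable[m n] fun ω => Nat.count (fun n => fix n ω) j := by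
    intro n j
    induction j with
    | zero => intro _; simp only [Nat.count_zero]; exact measurable_const
    | succ j ih =>
      intro hj
      simp only [Nat.count_succ]
      exact Measurable.add (ih (by omega))
        (Measurable.ite (hfix n j (by omega)) measurable_const measurable_const)
  have hsel : ∀ i n, MeasurableSet {ω | fix n ω ∧ Nat.count (fun n => fix n ω) n = i} := fun i n =>
    (hm n _ (hfix n n le_rfl)).inter ((hcount n n le_rfl).mono (hm n) le_rfl
      (measurableSet_singleton i))
  have hnth : ∀ ω, {n | fix n ω}.Infinite → ∀ i n, Nat.nth (fun n => fix n ω) i = n ↔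
      fix n ω ∧ Nat.count (fun n => fix n ω) n = i := by
    intro ω hω i n
    constructor
    · rintro rfl
      exact ⟨Nat.nth_mem_of_infinite hω i, Nat.count_nth_of_infinite hω i⟩
    · rintro ⟨h1, rfl⟩
      exact Nat.nth_count (p := fun n => fix n ω) h1
  -- measurability of the selected marks
  have hmeas : AEMeasurable (fun ω i => l (Nat.nth (fun n => fix n ω) i) ω) μ := by
    refine aemeasurable_pi_iff.2 fun i => ?_
    -- The second alternative only guarantees that the search ends when fewer than `i + 1` indices
    -- are selected, a null event.
    set p : Ω → ℕ → Prop := fun ω n => (fix n ω ∧ Nat.count (fun n => fix n ω) n = i) ∨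
      ∀ k, ¬ (fix k ω ∧ Nat.count (fun n => fix n ω) k = i) with hp
    have hex : ∀ ω, ∃ n, p ω n := fun ω => by
      by_cases h : ∃ n, fix n ω ∧ Nat.count (fun n => fix n ω) n = i
      · exact ⟨h.choose, Or.inl h.choose_spec⟩
      · exact ⟨0, Or.inr (not_exists.1 h)⟩
    have hτm : Measurable fun ω => Nat.find (hex ω) := by
      refine measurable_find hex fun n => (hsel i n).union ?_
      have : {ω | ∀ k, ¬ (fix k ω ∧ Nat.count (fun n => fix n ω) k = i)} =
          ⋂ k, {ω | fix k ω ∧ Nat.count (fun n => fix n ω) k = i}ᶜ := by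
        ext ω; simp
      exact (congrArg MeasurableSet this).mpr (MeasurableSet.iInter fun k => (hsel i k).compl)
    have hmm : Measurable fun q : ℕ × Ω => l q.1 q.2 :=
      measurable_from_prod_countable_right fun n => hlm n
    refine ⟨fun ω => l (Nat.find (hex ω)) ω, hmm.comp (hτm.prodMk measurable_id), ?_⟩
    filter_upwards [hinf] with ω hω
    rcases Nat.find_spec (hex ω) with h | h
    · rw [(hnth ω hω i _).2 h]
    · exact absurd ((hnth ω hω i _).1 rfl) (h _)
  have key : ∀ (B : ℕ → Set F), (∀ i, MeasurableSet (B i)) → ∀ k,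
      μ {ω | ∀ i < k, l (Nat.nth (fun n => fix n ω) i) ω ∈ B i} = ∏ i ∈ Finset.range k, ν (B i) := by
    intro B hB k
    induction k with
    | zero => simp
    | succ k ih =>
      -- On `A n` the selection number `k`, counted from 0, is `n`, and the marks selected before
      -- satisfy their constraints. This is known without the mark of `n`, which therefore
      -- contributes an independent factor.
      set A : ℕ → Set Ω := fun n => {ω | (fix n ω ∧ Nat.count (fun n => fix n ω) n = k) ∧
        ∀ j < n, fix j ω → l j ω ∈ B (Nat.count (fun n => fix n ω) j)} with hA
      have hAm : ∀ n, MeasurableSet[m n] (A n) := by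
        intro n
        refine MeasurableSet.inter ((hfix n n le_rfl).inter
          (hcount n n le_rfl (measurableSet_singleton k))) ?_
        have h1 : {ω | ∀ j < n, fix j ω → l j ω ∈ B (Nat.count (fun n => fix n ω) j)} =
            ⋂ j, ⋂ (_ : j < n), ({ω | fix j ω}ᶜ ∪
              ⋃ i, {ω | Nat.count (fun n => fix n ω) j = i} ∩ {ω | l j ω ∈ B i}) := by
          ext ω
          simp [imp_iff_not_or]
        refine (congrArg MeasurableSet[m n] h1).mpr ?_
        refine MeasurableSet.iInter fun j => MeasurableSet.iInter fun hj =>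
          (hfix n j hj.le).compl.union (MeasurableSet.iUnion fun i => ?_)
        exact (hcount n j hj.le (measurableSet_singleton i)).inter (hlm' n j hj (hB i))
      have hAiff : ∀ ω, {n | fix n ω}.Infinite → ∀ n, ω ∈ A n ↔
          Nat.nth (fun n => fix n ω) k = n ∧ ∀ i < k, l (Nat.nth (fun n => fix n ω) i) ω ∈ B i := by
        intro ω hω n
        rw [hnth ω hω]
        refine and_congr_right fun hn => ⟨fun h i hi => ?_, fun h j hj hf => ?_⟩
        · have hlt : Nat.nth (fun n => fix n ω) i < n := by
            rw [← (hnth ω hω k n).2 hn]; exact Nat.nth_strictMono hω hi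
          have := h _ hlt (Nat.nth_mem_of_infinite hω i)
          rwa [Nat.count_nth_of_infinite hω] at this
        · have hlt : Nat.count (fun n => fix n ω) j < k := by
            rw [← hn.2]; exact Nat.count_strict_mono hf hj
          have := h _ hlt
          rwa [Nat.nth_count (p := fun n => fix n ω) hf] at this
      have hdisj : ∀ C : ℕ → Set Ω, Pairwise (Function.onFun Disjoint fun n => A n ∩ C n) := by
        intro C n n' hnn'
        refine Set.disjoint_left.2 fun ω h1 h2 => hnn' ?_
        have h3 := h1.1.1
        have h4 := h2.1.1
        rw [← Nat.nth_count (p := fun n => fix n ω) h3.1, h3.2, ← h4.2,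
          Nat.nth_count (p := fun n => fix n ω) h4.1]
      have hAm' := fun n => hm n _ (hAm n)
      have e1 : μ {ω | ∀ i < k, l (Nat.nth (fun n => fix n ω) i) ω ∈ B i} = ∑' n, μ (A n) := by
        have h1 : ∀ n, A n ∩ univ = A n := fun n => inter_univ _
        have h2 := measure_iUnion (μ := μ) (hdisj fun _ => univ)
          fun n => (hAm' n).inter MeasurableSet.univ
        simp only [h1] at h2
        rw [← h2]
        refine measure_congr ?_
        filter_upwards [hinf] with ω hω
        refine propext ?_
        change (∀ i < k, _) ↔ ω ∈ ⋃ n, A n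
        rw [mem_iUnion]
        simp only [hAiff ω hω]
        simp
      have e2 : μ {ω | ∀ i < k + 1, l (Nat.nth (fun n => fix n ω) i) ω ∈ B i} =
          ∑' n, μ (A n ∩ l n ⁻¹' B k) := by
        rw [← measure_iUnion (hdisj _) fun n => (hAm' n).inter (hlm n (hB k))]
        refine measure_congr ?_
        filter_upwards [hinf] with ω hω
        refine propext ?_
        change (∀ i < k + 1, _) ↔ ω ∈ ⋃ n, A n ∩ l n ⁻¹' B k
        rw [mem_iUnion]
        simp only [mem_inter_iff, hAiff ω hω, mem_preimage, Nat.forall_lt_succ_right]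
        constructor
        · rintro ⟨h1, h2⟩
          exact ⟨_, ⟨rfl, h1⟩, h2⟩
        · rintro ⟨n, ⟨rfl, h1⟩, h2⟩
          exact ⟨h1, h2⟩
      have e3 : ∀ n, μ (A n ∩ l n ⁻¹' B k) = μ (A n) * ν (B k) := by
        intro n
        rw [← hl n, Measure.map_apply (hlm n) (hB k)]
        exact (Indep_iff _ _ _).1 (hind n) _ _ (hAm n) ⟨B k, hB k, rfl⟩
      rw [e2, Finset.prod_range_succ, ← ih, e1, ← ENNReal.tsum_mul_right]
      exact tsum_congr e3
  refine ⟨hmeas, Measure.eq_infinitePi _ fun s t ht => ?_⟩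
  rw [Measure.map_apply_of_aemeasurable hmeas (.pi s.countable_toSet fun i _ => ht i)]
  obtain ⟨k, hk⟩ := s.exists_nat_subset_range
  have h := key (fun i => if i ∈ s then t i else univ) (fun i => by
    by_cases hi : i ∈ s
    · simpa [hi] using ht i
    · simp [hi]) k
  have h1 : ∏ i ∈ Finset.range k, ν (if i ∈ s then t i else univ) = ∏ i ∈ s, ν (t i) := by
    rw [← Finset.prod_subset hk (f := fun i => ν (if i ∈ s then t i else univ))
      (fun i _ hi => by simp [hi])]
    exact Finset.prod_congr rfl fun i hi => by simp [hi]
  rw [← h1, ← h]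
  congr 1
  ext ω
  simp only [mem_preimage, Set.mem_pi, Finset.mem_coe, mem_ofPred_eq]
  refine ⟨fun h i _ => ?_, fun h i hi => ?_⟩
  · by_cases hi : i ∈ s
    · simpa [hi] using h i hi
    · simp [hi]
  · simpa [hi] using h i (Finset.mem_range.1 (hk hi))

end Skipping

end Upkeep

/-! ### The stationary process in terms of age and gaps -/

namespace Upkeep
open scoped ENNReal NNReal

namespace Configuration

variable {Θ : Type*} [MeasurableSpace Θ]

lemma arrivalTime_congr {ω ω' : ℤ → ℝ × Θ × ℝ × ℝ} (h : ∀ j, (ω j).1 = (ω' j).1) (n : ℤ) :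
    arrivalTime ω n = arrivalTime ω' n := by
  simp only [arrivalTime, h]

/-- The configuration of agents around time `0`, when `p.1` is the time that has elapsed since the
arrival of agent `0`. -/
noncomputable def ofAge (p : ℝ × (ℤ → ℝ × Θ × ℝ × ℝ)) : Configuration Θ :=
  fun n => (arrivalTime p.2 n - (if n ≤ 0 then p.1 else 0), (p.2 (n - 1)).2)

lemma measurable_ofAge : Measurable (ofAge (Θ := Θ)) := by
  refine measurable_pi_iff.2 fun n => ?_
  have := measurable_arrivalTime (M := Θ × ℝ × ℝ) n
  unfold ofAge
  split_ifs <;> fun_prop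

/-- Gap `0` lengthened by the age and seen from a point at that age leaves the original gap as the
waiting time. Two views of the same configuration: `ofAge` separates past and future, while `ofGaps`
after `palmMap` gives access to Palm inversion. -/
lemma ofAge_eq_ofGaps (p : ℝ × (ℤ → ℝ × Θ × ℝ × ℝ)) :
    ofAge p = ofGaps (palmMap p).1 (palmMap p).2 := by
  have hT : ∀ n, arrivalTime (palmMap p).2 n = arrivalTime p.2 n + if 0 < n then p.1 else 0 := by
    intro n
    have := eq_arrivalTime (ω := (palmMap p).2)
      (f := fun n => arrivalTime p.2 n + if 0 < n then p.1 else 0) (fun n => by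
        rw [arrivalTime_add_one]
        rcases lt_trichotomy n 0 with h | rfl | h
        · rw [if_neg (by omega), if_neg (by omega)]
          simp [palmMap, h.ne]
        · simp [palmMap]; ring
        · rw [if_pos (by omega), if_pos h]
          simp [palmMap, h.ne']; ring) n
    simp only [arrivalTime_zero, lt_irrefl, if_false, add_zero, zero_add] at this
    exact this.symm
  ext n : 1
  simp only [ofAge, ofGaps, hT]
  refine Prod.ext ?_ ?_
  · simp only [palmMap]
    rcases le_or_gt n 0 with h | h
    · rw [if_pos h, if_neg h.not_gt]; ring
    · rw [if_neg h.not_ge, if_pos h]; ring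
  · simp only [palmMap]
    by_cases h : n - 1 = 0
    · rw [h]; simp
    · rw [Function.update_of_ne h]

lemma ofAge_zero_time (p : ℝ × (ℤ → ℝ × Θ × ℝ × ℝ)) : (ofAge p 0).1 = -p.1 := by
  simp [ofAge, arrivalTime_zero]

lemma ofAge_succ_time (p : ℝ × (ℤ → ℝ × Θ × ℝ × ℝ)) (n : ℕ) :
    (ofAge p (n + 1)).1 = ∑ i ∈ Finset.range (n + 1), (p.2 i).1 := by
  simp only [ofAge, if_neg (show ¬ ((n : ℤ) + 1 ≤ 0) by omega), sub_zero]
  exact_mod_cast arrivalTime_natCast p.2 (n + 1)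

section Law

variable (lam : Measure Θ) [IsProbabilityMeasure lam] (ν : Measure ℝ) [IsProbabilityMeasure ν]

/-- The law of the type, the randomization and the lifespan of an agent. -/
noncomputable abbrev markLaw : Measure (Θ × ℝ × ℝ) := lam.prod (unif.prod ν)

/-- The law of the sequence of gaps and marks. -/
noncomputable abbrev gapsLaw : Measure (ℤ → ℝ × Θ × ℝ × ℝ) :=
  Measure.infinitePi fun _ : ℤ => (expMeasure 1).prod (markLaw lam ν)

/-- The joint law of the age and of the sequence of gaps and marks. -/
noncomputable abbrev ageLaw : Measure (ℝ × (ℤ → ℝ × Θ × ℝ × ℝ)) :=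
  (expMeasure 1).prod (gapsLaw lam ν)

lemma measurePreserving_snd_snd_markLaw :
    MeasurePreserving (fun x : Θ × ℝ × ℝ => x.2.2) (markLaw lam ν) ν :=
  measurePreserving_snd.comp measurePreserving_snd

/-- By `lintegral_palmMap`, the law of the lengthened gaps is `gapsLaw` weighted by the length of
gap `0`, hence absolutely continuous. -/
lemma ae_ageLaw_of_ae {q : (ℤ → ℝ × Θ × ℝ × ℝ) → Prop} (h : ∀ᵐ ω ∂(gapsLaw lam ν), q ω) :
    ∀ᵐ p ∂(ageLaw lam ν), q (palmMap p).2 := by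
  obtain ⟨S, hS, hSm, hq⟩ := h.exists_measurable_mem
  have hm : Measurable fun p : ℝ × (ℤ → ℝ × Θ × ℝ × ℝ) =>
      Sᶜ.indicator (fun _ => (1 : ℝ≥0∞)) p.2 :=
    (measurable_const.indicator hSm.compl).comp measurable_snd
  have h1 := lintegral_palmMap (markLaw lam ν) hm
  have h2 : ∫⁻ ω, (∫⁻ t in Ioc 0 (ω 0).1, Sᶜ.indicator (fun _ => 1) ω) ∂(gapsLaw lam ν) =
      ∫⁻ _, (0 : ℝ≥0∞) ∂(gapsLaw lam ν) := by
    refine lintegral_congr_ae ?_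
    filter_upwards [hS] with ω hω
    simp [hω]
  have hm' : Measurable fun p : ℝ × (ℤ → ℝ × Θ × ℝ × ℝ) =>
      Sᶜ.indicator (fun _ => (1 : ℝ≥0∞)) (palmMap p).2 := hm.comp measurable_palmMap
  rw [h2, lintegral_zero, lintegral_eq_zero_iff hm'] at h1
  filter_upwards [h1] with p hp
  refine hq _ (by_contra fun hp' => ?_)
  have h3 : Sᶜ.indicator (fun _ => (1 : ℝ≥0∞)) (palmMap p).2 = 0 := hp
  rw [indicator_of_mem hp'] at h3
  exact one_ne_zero h3

lemma ae_regular_ofAge (hpos : ∀ᵐ l ∂ν, 0 < l) (hint : Integrable (fun l => l) ν) :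
    ∀ᵐ p ∂(ageLaw lam ν), (ofAge p).IsRegular ∧ (ofAge p 0).1 < 0 ∧ 0 ≤ (ofAge p 1).1 := by
  have hmp := measurePreserving_snd_snd_markLaw lam ν
  have h1 := ae_isRegular_ofGaps (markLaw lam ν)
    (hmp.integrable_comp_of_integrable hint) (hmp.quasiMeasurePreserving.ae hpos)
  have hposg : ∀ᵐ x ∂((expMeasure 1).prod (markLaw lam ν)), 0 < x.1 :=
    Measure.quasiMeasurePreserving_fst.ae ae_expMeasure_pos
  have h2 : ∀ᵐ p ∂(ageLaw lam ν), 0 < p.1 :=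
    Measure.quasiMeasurePreserving_fst.ae ae_expMeasure_pos
  have h3 : ∀ᵐ p ∂(ageLaw lam ν), ∀ n, 0 < (p.2 n).1 :=
    Measure.quasiMeasurePreserving_snd.ae (ae_infinitePi_forall hposg)
  filter_upwards [ae_ageLaw_of_ae lam ν h1, h2, h3] with p hp1 hp2 hp3
  refine ⟨ofAge_eq_ofGaps p ▸ hp1 _, by rw [ofAge_zero_time]; linarith, ?_⟩
  have := ofAge_succ_time p 0
  simp only [Nat.cast_zero, zero_add, Finset.range_one, Finset.sum_singleton] at this
  rw [this]
  exact (hp3 0).le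

variable {lam ν} (σ : MarkovianMechanism Θ) {Ω : Type*} [MeasurableSpace Ω] {μ : Measure Ω}
  {Z : Ω → ℝ × (ℤ → ℝ × Θ × ℝ × ℝ)}

/-- The system process with the given age and gaps. -/
noncomputable abbrev ageProcess (hZ : MeasurePreserving Z μ (ageLaw lam ν))
    (hreg : ∀ ω, (ofAge (Z ω)).IsRegular ∧ (ofAge (Z ω) 0).1 < 0 ∧ 0 ≤ (ofAge (Z ω) 1).1) :
    SystemProcess Ω Θ :=
  process σ (fun ω => ofAge (Z ω)) (measurable_ofAge.comp hZ.measurable) (fun ω => (hreg ω).1)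
    (fun ω => (hreg ω).2.1) (fun ω => (hreg ω).2.2)

variable (hZ : MeasurePreserving Z μ (ageLaw lam ν))
  (hreg : ∀ ω, (ofAge (Z ω)).IsRegular ∧ (ofAge (Z ω) 0).1 < 0 ∧ 0 ≤ (ofAge (Z ω) 1).1)

include hZ hreg

/-- The law of the path seen from `s` is a Palm integral with time displaced by `s`, and
`lintegral_Ioc_shift_eq` removes the displacement. The covariance required there holds because
`path` does not depend on how agents are numbered. -/
lemma isStationary_ageProcess : (ageProcess σ hZ hreg).IsStationary μ := by
  intro s
  have key : ∀ (A : Set ((ℝ → MachineState) × Measure (ℝ × Θ × Action))), MeasurableSet A → ∀ s,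
      μ ((ageProcess σ hZ hreg).pathFrom s ⁻¹' A) =
        ∫⁻ ω, (∫⁻ t in Ioc 0 (ω 0).1, A.indicator (fun _ => 1) ((ofGaps t ω).path σ))
          ∂(gapsLaw lam ν) := by
    intro A hA s
    have hG : Measurable fun p : ℝ × (ℤ → ℝ × Θ × ℝ × ℝ) =>
        A.indicator (fun _ => (1 : ℝ≥0∞)) ((ofGaps p.1 p.2).path σ) :=
      (measurable_const.indicator hA).comp ((measurable_path σ).comp measurable_ofGaps)
    have hG' : Measurable fun p : ℝ × (ℤ → ℝ × Θ × ℝ × ℝ) =>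
        A.indicator (fun _ => (1 : ℝ≥0∞)) ((ofGaps (p.1 + s) p.2).path σ) :=
      hG.comp ((measurable_fst.add_const s).prodMk measurable_snd)
    rw [← lintegral_Ioc_shift_eq _ (ae_arrivalTime (markLaw lam ν)) hG (fun u ω k => by
      simp only [ofGaps_shift, path_reindex]) s, ← lintegral_palmMap (markLaw lam ν) hG',
      ← hZ.lintegral_comp (f := fun p => A.indicator (fun _ => (1 : ℝ≥0∞))
        ((ofGaps ((palmMap p).1 + s) (palmMap p).2).path σ)) (hG'.comp measurable_palmMap),
      ← lintegral_indicator_one ((ageProcess σ hZ hreg).measurable_pathFrom s hA)]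
    refine lintegral_congr fun ω => ?_
    have h := pathFrom_process (σ := σ) (C := fun ω => ofAge (Z ω))
      (hC := measurable_ofAge.comp hZ.measurable) (hreg := fun ω => (hreg ω).1)
      (h0 := fun ω => (hreg ω).2.1) (h1 := fun ω => (hreg ω).2.2) s ω
    rw [← translate_ofGaps, ← ofAge_eq_ofGaps, ← h]
    rfl
  refine Measure.ext fun A hA => ?_
  rw [Measure.map_apply (SystemProcess.measurable_pathFrom _ _) hA,
    Measure.map_apply (SystemProcess.measurable_pathFrom _ _) hA, key A hA s, key A hA 0]

lemma futureArrivals_ageProcess (ω : Ω) (n : ℕ) :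
    (ageProcess σ hZ hreg).futureArrivals ω n = (((Z ω).2 n).1, ((Z ω).2 n).2.1) := by
  refine Prod.ext ?_ ?_
  · have harr : ∀ n : ℕ, (ageProcess σ hZ hreg).arrival (n + 1) ω =
        ∑ i ∈ Finset.range (n + 1), ((Z ω).2 i).1 := ofAge_succ_time (Z ω)
    cases n with
    | zero =>
      change (ageProcess σ hZ hreg).arrival 1 ω = _
      simpa using harr 0
    | succ n =>
      change (ageProcess σ hZ hreg).arrival (n + 2) ω - (ageProcess σ hZ hreg).arrival (n + 1) ω = _
      have h1 := harr (n + 1)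
      rw [Nat.cast_succ, add_assoc] at h1
      rw [harr n]
      refine (congrArg (· - _) h1).trans ?_
      rw [Finset.sum_range_succ]
      simp
  · change ((Z ω).2 (n + 1 - 1)).2.1 = _
    rw [add_sub_cancel_right]

/-- The gaps, types and randomizations of the agents who arrive after time `0`. -/
def futureOf (ω : ℤ → ℝ × Θ × ℝ × ℝ) (n : ℕ) : (ℝ × Θ) × ℝ :=
  (((ω n).1, (ω n).2.1), (ω n).2.2.1)

/-- The sequence of gaps and marks with all nonnegative coordinates replaced by a default value. -/
def pastOf {E : Type*} (x₀ : E) (ω : ℤ → E) (j : ℤ) : E := if j < 0 then ω j else x₀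

omit hZ hreg

lemma measurable_futureOf : Measurable (futureOf (Θ := Θ)) := by
  unfold futureOf; fun_prop

lemma measurable_pastOf {E : Type*} [MeasurableSpace E] (x₀ : E) : Measurable (pastOf x₀) := by
  refine measurable_pi_iff.2 fun j => ?_
  unfold pastOf
  split_ifs <;> fun_prop

variable (lam ν) in
lemma measurePreserving_futureOf : MeasurePreserving futureOf (gapsLaw lam ν)
    (Measure.infinitePi fun _ : ℕ => ((expMeasure 1).prod lam).prod unif) := by
  have h1 : MeasurePreserving (fun x : ℝ × Θ × ℝ × ℝ => ((x.1, x.2.1), x.2.2.1))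
      ((expMeasure 1).prod (markLaw lam ν)) (((expMeasure 1).prod lam).prod unif) :=
    (measurePreserving_prodAssoc (expMeasure 1) lam unif).symm.comp
      ((MeasurePreserving.id _).prod ((MeasurePreserving.id _).prod measurePreserving_fst))
  have h2 := Measure.infinitePi_map_pi (μ := fun _ : ℕ => (expMeasure 1).prod (markLaw lam ν))
    (fun _ => h1.measurable)
  simp only [h1.map_eq] at h2
  exact MeasurePreserving.comp ⟨by have := h1.measurable; fun_prop, h2⟩
    (measurePreserving_forward ((expMeasure 1).prod (markLaw lam ν)))

variable (lam ν) in
lemma indepFun_pastOf_futureOf (x₀ : ℝ × Θ × ℝ × ℝ) :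
    IndepFun (pastOf x₀) futureOf (gapsLaw lam ν) := by
  have hi : iIndepFun (fun n (ω : ℤ → ℝ × Θ × ℝ × ℝ) => ω n) (gapsLaw lam ν) :=
    iIndepFun_infinitePi (X := fun _ x => x) (fun _ => measurable_id)
  have hI := indep_iSup_of_disjoint (fun n => (measurable_pi_apply n).comap_le)
    ((iIndepFun_iff_iIndep _ _ _).1 hi) (S := Iio 0) (T := Ici 0)
    (Set.disjoint_left.2 fun x h1 h2 => (not_le.2 (mem_Iio.1 h1)) h2)
  rw [IndepFun_iff_Indep]
  refine indep_of_indep_of_le_left (indep_of_indep_of_le_right hI ?_) ?_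
  · refine Measurable.comap_le ((@measurable_pi_iff _ _ _ (_) _ _).2 fun n => ?_)
    have h1 : Measurable fun x : ℝ × Θ × ℝ × ℝ => ((x.1, x.2.1), x.2.2.1) := by fun_prop
    exact h1.comp ((comap_measurable (fun ω : ℤ → ℝ × Θ × ℝ × ℝ => ω n)).mono
      (le_iSup₂_of_le (n : ℤ) (by simp) le_rfl) le_rfl)
  · refine Measurable.comap_le ((@measurable_pi_iff _ _ _ (_) _ _).2 fun j => ?_)
    by_cases hj : j < 0
    · simp only [pastOf, hj, if_true]
      exact (comap_measurable (fun ω : ℤ → ℝ × Θ × ℝ × ℝ => ω j)).mono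
        (le_iSup₂_of_le j hj le_rfl) le_rfl
    · simp only [pastOf, hj, if_false]
      exact measurable_const

lemma ofAge_pastOf (x₀ : ℝ × Θ × ℝ × ℝ) (p : ℝ × (ℤ → ℝ × Θ × ℝ × ℝ)) {j : ℤ} (hj : j ≤ 0) :
    ofAge p j = ofAge (p.1, pastOf x₀ p.2) j := by
  have h : ∀ i < 0, p.2 i = pastOf x₀ p.2 i := fun i hi => by simp [pastOf, hi]
  simp only [ofAge]
  rw [← h (j - 1) (by omega)]
  congr 2
  simp only [arrivalTime, Finset.Ico_eq_empty_of_le hj, Finset.sum_empty]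
  congr 1
  exact Finset.sum_congr rfl fun i hi => by rw [h i (Finset.mem_Ico.1 hi).2]

lemma ofAge_pastOf_time_nonneg {x₀ : ℝ × Θ × ℝ × ℝ} (hx : 0 ≤ x₀.1)
    (p : ℝ × (ℤ → ℝ × Θ × ℝ × ℝ)) {j : ℤ} (hj : 0 < j) :
    0 ≤ (ofAge (p.1, pastOf x₀ p.2) j).1 := by
  obtain ⟨n, rfl⟩ : ∃ n : ℕ, j = n + 1 := ⟨(j - 1).toNat, by omega⟩
  rw [ofAge_succ_time]
  refine Finset.sum_nonneg fun i _ => ?_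
  have h : pastOf x₀ p.2 i = x₀ := if_neg (by omega)
  exact (congrArg Prod.fst h).symm ▸ hx

include hZ hreg

/-- The mark of agent `n` sits at coordinate `n - 1`, so the age and the negative coordinates
determine all agents up to `0`. A default `x₀` with a nonnegative gap keeps the later agents at
nonnegative times, where they cannot affect the history. -/
lemma history_le_comap_pastOf {x₀ : ℝ × Θ × ℝ × ℝ} (hx : 0 ≤ x₀.1) :
    (ageProcess σ hZ hreg).history ≤
      MeasurableSpace.comap (fun ω => ((Z ω).1, pastOf x₀ (Z ω).2)) inferInstance := by
  have hW := comap_measurable (m := (inferInstance : MeasurableSpace (ℝ × (ℤ → ℝ × Θ × ℝ × ℝ))))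
    (fun ω => ((Z ω).1, pastOf x₀ (Z ω).2))
  have hagree : ∀ ω, ∀ j ≤ 0, ofAge (Z ω) j = ofAge ((Z ω).1, pastOf x₀ (Z ω).2) j :=
    fun ω j hj => ofAge_pastOf x₀ (Z ω) hj
  have hpos : ∀ ω, ∀ j > 0, 0 ≤ (ofAge (Z ω) j).1 := fun ω j hj =>
    (hreg ω).2.2.trans ((hreg ω).1.le_iff.2 (by omega))
  have hneg : ∀ ω, ∀ j ≤ 0, (ofAge (Z ω) j).1 < 0 := fun ω j hj =>
    ((hreg ω).1.le_iff.2 hj).trans_lt (hreg ω).2.1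
  refine sup_le (iSup_le fun t => ?_) (iSup_le fun n => ?_)
  · have h : (ageProcess σ hZ hreg).state t =
        fun ω => (ofAge ((Z ω).1, pastOf x₀ (Z ω).2)).stateAt σ t := by
      funext ω
      exact stateAt_congr (hagree ω) (fun j hj => (mem_Iio.1 t.2).trans_le (hpos ω j hj))
        (fun j hj => (mem_Iio.1 t.2).trans_le (ofAge_pastOf_time_nonneg hx _ hj))
    rw [h]
    exact (((measurable_stateAt σ t).comp measurable_ofAge).comp hW).comap_le
  · have hn : (n : ℤ) ≤ 0 := n.2
    have h : (fun ω => ((ageProcess σ hZ hreg).arrival n ω, (ageProcess σ hZ hreg).agentType n ω,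
        (ageProcess σ hZ hreg).action n ω)) = fun ω =>
        ((ofAge ((Z ω).1, pastOf x₀ (Z ω).2) n).1, (ofAge ((Z ω).1, pastOf x₀ (Z ω).2) n).2.1,
          (ofAge ((Z ω).1, pastOf x₀ (Z ω).2)).actionOf σ n) := by
      funext ω
      refine Prod.ext ?_ (Prod.ext ?_ ?_)
      · exact congrArg (fun x => x.1) (hagree ω n hn)
      · exact congrArg (fun x => x.2.1) (hagree ω n hn)
      · exact actionOf_congr (hagree ω) hn
          (fun j hj => (hneg ω n hn).trans_le (hpos ω j hj))
          (fun j hj => (hneg ω n hn).trans_le (ofAge_pastOf_time_nonneg hx _ hj))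
    rw [h]
    have hF : Measurable fun c : Configuration Θ => ((c n).1, (c n).2.1, c.actionOf σ n) := by
      have := measurable_actionOf σ (n : ℤ)
      fun_prop
    exact ((hF.comp measurable_ofAge).comp hW).comap_le

lemma indep_history_futureOf : Indep (ageProcess σ hZ hreg).history
    (MeasurableSpace.comap (fun ω => futureOf (Z ω).2) inferInstance) μ := by
  obtain ⟨θ₀⟩ : Nonempty Θ := lam.nonempty_of_neZero
  have h := indepFun_comp_of_measurePreserving hZ
    (f := fun p => (p.1, pastOf ((1 : ℝ), θ₀, (0 : ℝ), (0 : ℝ)) p.2)) (g := fun p => futureOf p.2)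
    (measurable_fst.prodMk ((measurable_pastOf _).comp measurable_snd))
    (measurable_futureOf.comp measurable_snd)
    (IndepFun.prod_left (measurable_pastOf _) measurable_futureOf
      (indepFun_pastOf_futureOf lam ν _))
  rw [IndepFun_iff_Indep] at h
  exact indep_of_indep_of_le_left h (history_le_comap_pastOf σ hZ hreg (by simp))

lemma isCompatible_ageProcess : σ.IsCompatible (ageProcess σ hZ hreg) μ lam := by
  have he : (fun ω n => ((ageProcess σ hZ hreg).futureArrivals ω n, ((Z ω).2 n).2.2.1)) =
      fun ω => futureOf (Z ω).2 := by
    funext ω n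
    rw [futureArrivals_ageProcess]
    rfl
  refine ⟨fun n ω => ((Z ω).2 n).2.2.1, ?_, ?_, Eventually.of_forall fun ω n => ?_⟩
  · rw [he]
    have h := (measurePreserving_futureOf lam ν).comp (measurePreserving_snd.comp hZ)
    exact ⟨h.measurable.aemeasurable, h.map_eq⟩
  · rw [he]
    exact indep_history_futureOf σ hZ hreg
  · have h := process_compatible (σ := σ) (C := fun ω => ofAge (Z ω))
      (hC := measurable_ofAge.comp hZ.measurable) (hreg := fun ω => (hreg ω).1)
      (h0 := fun ω => (hreg ω).2.1) (h1 := fun ω => (hreg ω).2.2) ω (n + 1)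
    have e : (ofAge (Z ω) (n + 1)).2.2.1 = ((Z ω).2 n).2.2.1 := by
      simp only [ofAge, add_sub_cancel_right]
    rw [e] at h
    exact h

lemma futureArrivals_law_and_indep :
    HasLaw (ageProcess σ hZ hreg).futureArrivals
      (Measure.infinitePi fun _ : ℕ => (expMeasure 1).prod lam) μ ∧
    Indep (ageProcess σ hZ hreg).history
      (MeasurableSpace.comap (ageProcess σ hZ hreg).futureArrivals inferInstance) μ := by
  have he : (ageProcess σ hZ hreg).futureArrivals = fun ω n => (futureOf (Z ω).2 n).1 := by
    funext ω n
    rw [futureArrivals_ageProcess]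
    rfl
  have h := (measurePreserving_futureOf lam ν).comp (measurePreserving_snd.comp hZ)
  have h1 : MeasurePreserving (fun (y : ℕ → (ℝ × Θ) × ℝ) n => (y n).1)
      (Measure.infinitePi fun _ : ℕ => ((expMeasure 1).prod lam).prod unif)
      (Measure.infinitePi fun _ : ℕ => (expMeasure 1).prod lam) := by
    refine ⟨by fun_prop, ?_⟩
    rw [Measure.infinitePi_map_pi (μ := fun _ : ℕ => ((expMeasure 1).prod lam).prod unif)
      (f := fun _ x => x.1) fun _ => measurable_fst]
    simp only [Measure.map_fst_prod, measure_univ, one_smul]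
  rw [he]
  refine ⟨⟨(h1.comp h).measurable.aemeasurable, (h1.comp h).map_eq⟩, ?_⟩
  refine indep_of_indep_of_le_right (indep_history_futureOf σ hZ hreg) ?_
  exact (h1.measurable.comp (comap_measurable fun ω => futureOf (Z ω).2)).comap_le

omit hZ hreg

/-- Forget the lifespan in coordinate `n`. -/
def eraseLife (n : ℤ) (ω : ℤ → ℝ × Θ × ℝ × ℝ) : ℤ → ℝ × Θ × ℝ × ℝ :=
  Function.update ω n ((ω n).1, (ω n).2.1, (ω n).2.2.1, 0)

lemma measurable_eraseLife (n : ℤ) : Measurable (eraseLife (Θ := Θ) n) := by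
  refine measurable_pi_iff.2 fun j => ?_
  unfold eraseLife
  by_cases h : j = n
  · subst h; simp only [Function.update_self]; fun_prop
  · simp only [Function.update_of_ne h]; fun_prop

variable (lam ν) in
-- Resample the lifespan in coordinate `n`: the law is unchanged, the erased sequence is not
-- affected, and the new lifespan is independent of it by construction.
lemma indepFun_eraseLife (n : ℤ) :
    IndepFun (eraseLife n) (fun ω => (ω n).2.2.2) (gapsLaw lam ν) := by
  have hf : MeasurePreserving
      (fun q : ℝ × ℝ × Θ × ℝ × ℝ => (q.2.1, q.2.2.1, q.2.2.2.1, q.1))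
      (ν.prod ((expMeasure 1).prod (markLaw lam ν))) ((expMeasure 1).prod (markLaw lam ν)) := by
    have h0 : MeasurePreserving (fun q : ℝ × ℝ => q.1) (ν.prod ν) ν := measurePreserving_fst
    exact measurePreserving_prodMap_right (measurePreserving_prodMap_right
      (measurePreserving_prodMap_right h0))
  have hmp := measurePreserving_update_infinitePi (ι := ℤ) ((expMeasure 1).prod (markLaw lam ν)) ν
    hf.measurable hf.map_eq n
  have hl : Measurable fun ω : ℤ → ℝ × Θ × ℝ × ℝ => (ω n).2.2.2 := by fun_prop
  have hlaw : MeasurePreserving (fun ω : ℤ → ℝ × Θ × ℝ × ℝ => (ω n).2.2.2) (gapsLaw lam ν) ν :=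
    ((measurePreserving_snd_snd_markLaw lam ν).comp measurePreserving_snd).comp
      (measurePreserving_eval_infinitePi (fun _ : ℤ => (expMeasure 1).prod (markLaw lam ν)) n)
  rw [indepFun_iff_measure_inter_preimage_eq_mul]
  intro s t hs ht
  have hs' := measurable_eraseLife n hs
  rw [hlaw.measure_preimage ht.nullMeasurableSet,
    ← hmp.measure_preimage (hs'.inter (hl ht)).nullMeasurableSet, mul_comm, ← Measure.prod_prod]
  congr 1
  ext q
  simp only [mem_preimage, mem_inter_iff, mem_prod, eraseLife, Function.update_self,
    Function.update_idem]
  tauto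

/-- Coordinate `n` holds the potential lifespan of agent `n + 1`, which has no influence on whether
he or anyone before him repairs. -/
lemma repairs_ofAge_eraseLife (p : ℝ × (ℤ → ℝ × Θ × ℝ × ℝ)) {n j : ℤ} (hj : j ≤ n) :
    (ofAge p).Repairs σ (j + 1) ↔ (ofAge (p.1, eraseLife n p.2)).Repairs σ (j + 1) := by
  have hT : ∀ i, arrivalTime (eraseLife n p.2) i = arrivalTime p.2 i := fun i =>
    arrivalTime_congr (fun k => by
      by_cases h : k = n
      · subst h; simp [eraseLife]
      · simp [eraseLife, h]) i
  refine repairs_congr (fun i hi => ?_) ?_ ?_ ?_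
  · have : i - 1 ≠ n := by omega
    have h : eraseLife n p.2 (i - 1) = p.2 (i - 1) := Function.update_of_ne this _ _
    simp only [ofAge, hT, h]
  · simp only [ofAge, hT]
  all_goals
    simp only [ofAge, add_sub_cancel_right]
    by_cases h : j = n
    · subst h; simp [eraseLife]
    · simp [eraseLife, h]

include hZ hreg

/-- If agents volunteer with probability zero, there are almost surely no repairs after time `0`,
contrary to `hF`; otherwise there are almost surely infinitely many, and the conditioning is void.
The repairing agents are selected without knowledge of the lifespans that they start, so
`hasLaw_nth` applies. -/
lemma lifespans_law_ageProcess [IsProbabilityMeasure μ]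
    (hF : μ {ω | {n | (ageProcess σ hZ hreg).Fixes ω n}.Infinite} ≠ 0) :
    HasLaw (fun ω i => (ageProcess σ hZ hreg).lifespan i ω) (Measure.infinitePi fun _ : ℕ => ν)
      (cond μ {ω | {n | (ageProcess σ hZ hreg).Fixes ω n}.Infinite}) := by
  set X := ageProcess σ hZ hreg with hX
  have hfixes : ∀ ω n, X.Fixes ω n ↔ (ofAge (Z ω)).Repairs σ (n + 1) := fun ω n =>
    fixes_process ω n
  have hvol : ∀ p (n : ℤ), (ofAge p).Volunteers σ (n + 1) ↔
      p.2 n ∈ {x : ℝ × Θ × ℝ × ℝ | x.2.2.1 < σ.prob (x.2.1, .broken)} := fun p n => by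
    simp only [Volunteers, ofAge, add_sub_cancel_right, mem_ofPred_eq]
  have hAm : MeasurableSet {x : ℝ × Θ × ℝ × ℝ | x.2.2.1 < σ.prob (x.2.1, .broken)} := by
    have := σ.measurable_prob
    exact measurableSet_lt (by fun_prop) (by fun_prop)
  have hZω := measurePreserving_snd.comp hZ
  have hinf : ∀ᵐ ω ∂μ, {n | X.Fixes ω n}.Infinite := by
    by_cases h0 : ((expMeasure 1).prod (markLaw lam ν))
        {x : ℝ × Θ × ℝ × ℝ | x.2.2.1 < σ.prob (x.2.1, .broken)} = 0
    · refine absurd ?_ hF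
      rw [measure_eq_zero_iff_ae_notMem]
      filter_upwards [hZω.quasiMeasurePreserving.ae
        (ae_infinitePi_forall (measure_eq_zero_iff_ae_notMem.1 h0))] with ω hω h
      obtain ⟨n, hn⟩ := h.nonempty
      exact hω n ((hvol _ _).1 ((hfixes ω n).1 hn).1)
    · have hfw := (measurePreserving_forward ((expMeasure 1).prod (markLaw lam ν))).comp hZω
      filter_upwards [hfw.quasiMeasurePreserving.ae (ae_frequently_mem _ hAm h0)] with ω hω
      have hv : ∀ N, ∃ n ≥ N, (ofAge (Z ω)).Volunteers σ n := fun N => by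
        obtain ⟨n, hn, h⟩ := frequently_atTop.1 hω N.toNat
        exact ⟨n + 1, by omega, (hvol _ _).2 h⟩
      refine Set.infinite_of_not_bddAbove fun ⟨b, hb⟩ => ?_
      obtain ⟨n, hn, hr⟩ := (hreg ω).1.exists_repairs_ge hv (b + 2)
      obtain ⟨k, rfl⟩ : ∃ k : ℕ, n = k + 1 := ⟨(n - 1).toNat, by omega⟩
      have := hb ((hfixes ω k).2 hr)
      omega
  have hcond : ProbabilityTheory.cond μ {ω | {n | X.Fixes ω n}.Infinite} = μ := by
    rw [ProbabilityTheory.cond, measure_congr (eventuallyEq_univ.2 hinf), measure_univ, inv_one,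
      one_smul, Measure.restrict_eq_self_of_ae_mem (s := {ω | {n | X.Fixes ω n}.Infinite}) hinf]
  rw [hcond]
  have hlaw : ∀ n : ℕ, MeasurePreserving (fun ω => ((Z ω).2 n).2.2.2) μ ν := fun n =>
    (((measurePreserving_snd_snd_markLaw lam ν).comp measurePreserving_snd).comp
      (measurePreserving_eval_infinitePi
        (fun _ : ℤ => (expMeasure 1).prod (markLaw lam ν)) n)).comp hZω
  have hE : ∀ n : ℕ, Measurable fun p : ℝ × (ℤ → ℝ × Θ × ℝ × ℝ) => (p.1, eraseLife n p.2) :=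
    fun n => measurable_fst.prodMk ((measurable_eraseLife n).comp measurable_snd)
  -- The σ-algebra for `n` reveals everything, even later agents, except the lifespan in coordinate
  -- `n`; only this one must be hidden from the selection.
  have h := hasLaw_nth (μ := μ) (ν := ν) (fix := fun n ω => X.Fixes ω n)
    (l := fun n ω => ((Z ω).2 n).2.2.2)
    (fun n => MeasurableSpace.comap (fun ω => ((Z ω).1, eraseLife n (Z ω).2)) inferInstance)
    (fun n => ((hE n).comp hZ.measurable).comap_le) (fun n => (hlaw n).measurable)
    (fun n => (hlaw n).map_eq) (fun n => ?_) (fun n j hj => ?_) (fun n j hj => ?_) hinf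
  · refine h.congr ?_
    filter_upwards [hinf] with ω hω
    funext i
    refine (lifespan_process i hω).trans ?_
    simp only [ofAge, add_sub_cancel_right]
    rfl
  · rw [← IndepFun_iff_Indep]
    exact indepFun_comp_of_measurePreserving hZ (f := fun p => (p.1, eraseLife n p.2))
      (g := fun p => (p.2 n).2.2.2) (hE n) (by fun_prop)
      (IndepFun.prod_left (measurable_eraseLife n) (by fun_prop) (indepFun_eraseLife lam ν n))
  · refine ⟨{p | (ofAge p).Repairs σ (j + 1)}, measurable_ofAge (measurableSet_repairs σ _), ?_⟩
    ext ω
    exact (repairs_ofAge_eraseLife σ (Z ω) (by exact_mod_cast hj)).symm.trans (hfixes ω j).symm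
  · have h1 : (fun ω => ((Z ω).2 j).2.2.2) = (fun p : ℝ × (ℤ → ℝ × Θ × ℝ × ℝ) => (p.2 j).2.2.2) ∘
        fun ω => ((Z ω).1, eraseLife n (Z ω).2) := by
      funext ω
      have : (j : ℤ) ≠ n := by exact_mod_cast hj.ne
      simp [eraseLife, this]
    rw [h1]
    exact Measurable.comp (by fun_prop) (comap_measurable _)

lemma isAdmissible_ageProcess [IsProbabilityMeasure μ] :
    (ageProcess σ hZ hreg).IsAdmissible μ lam ν where
  arrivals_law := (futureArrivals_law_and_indep σ hZ hreg).1
  arrivals_indep := (futureArrivals_law_and_indep σ hZ hreg).2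
  breaks := Eventually.of_forall fun ω t h => process_breaks ω t h
  lifespans_law := lifespans_law_ageProcess σ hZ hreg
  usage_working := Eventually.of_forall fun ω n h => process_usage_working ω n h
  contribution_broken := Eventually.of_forall fun ω n h => process_contribution_broken ω n h

end Law

end Configuration

/-- For each Markovian mechanism there is a compatible stationary admissible process. -/
theorem MarkovianMechanism.exists_process {Θ : Type u} [MeasurableSpace Θ]
    (σ : MarkovianMechanism Θ) (lam : Measure Θ) [IsProbabilityMeasure lam]
    (ν : Measure ℝ) [IsProbabilityMeasure ν] (hν_pos : ∀ᵐ l ∂ν, 0 < l)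
    (hν_int : Integrable (fun l => l) ν) :
    ∃ (Ω : Type u) (_ : MeasurableSpace Ω) (μ : Measure Ω) (_ : IsProbabilityMeasure μ)
      (X : SystemProcess Ω Θ), X.IsStationary μ ∧ X.IsAdmissible μ lam ν ∧
        σ.IsCompatible X μ lam := by
  -- A `SystemProcess` must be regular at every outcome, so the sample space is cut down to a set of
  -- full measure.
  obtain ⟨S, hS, hSm, hreg⟩ :=
    (Configuration.ae_regular_ofAge lam ν hν_pos hν_int).exists_measurable_mem
  have hZ : MeasurePreserving (Subtype.val : S → _)
      ((Configuration.ageLaw lam ν).comap Subtype.val) (Configuration.ageLaw lam ν) :=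
    ⟨measurable_subtype_coe, by
      rw [map_comap_subtype_coe hSm, Measure.restrict_eq_self_of_ae_mem hS]⟩
  have hμ : IsProbabilityMeasure ((Configuration.ageLaw lam ν).comap (Subtype.val : S → _)) :=
    ⟨by rw [← preimage_univ (f := (Subtype.val : S → _)),
      hZ.measure_preimage MeasurableSet.univ.nullMeasurableSet, measure_univ]⟩
  have hreg' : ∀ ω : S, (Configuration.ofAge (ω : ℝ × (ℤ → ℝ × Θ × ℝ × ℝ))).IsRegular ∧
      (Configuration.ofAge (ω : ℝ × (ℤ → ℝ × Θ × ℝ × ℝ)) 0).1 < 0 ∧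
      0 ≤ (Configuration.ofAge (ω : ℝ × (ℤ → ℝ × Θ × ℝ × ℝ)) 1).1 := fun ω => hreg ω ω.2
  exact ⟨S, inferInstance, _, hμ, Configuration.ageProcess σ hZ hreg',
    Configuration.isStationary_ageProcess σ hZ hreg',
    Configuration.isAdmissible_ageProcess σ hZ hreg',
    Configuration.isCompatible_ageProcess σ hZ hreg'⟩

end Upkeep

/-! ### The proposition -/

theorem proposition7 {Θ : Type u} [MeasurableSpace Θ]
    (lam : MeasureTheory.Measure Θ) [MeasureTheory.IsProbabilityMeasure lam]
    (ρ : ℝ) (hρ : 0 < ρ)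
    (ν : MeasureTheory.Measure ℝ) [MeasureTheory.IsProbabilityMeasure ν]
    (hν_pos : ∀ᵐ l ∂ν, 0 < l) (hν_int : MeasureTheory.Integrable (fun l => l) ν)
    (hν_mean : ∫ l, l ∂ν = 1 / ρ) :
    (∀ (Ω : Type v) [MeasurableSpace Ω] (μ : MeasureTheory.Measure Ω)
        [MeasureTheory.IsProbabilityMeasure μ] (X : Upkeep.SystemProcess Ω Θ),
      X.IsStationary μ → X.IsAdmissible μ lam ν →
        (∃ (R P : Θ → ℝ) (Q : ℝ), X.IsReducedForm μ lam R P Q ∧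
          Upkeep.Balance lam ρ P Q ∧ ∀ θ, Upkeep.SimplexBounds R P Q θ) ∧
        (∀ (R P : Θ → ℝ) (Q : ℝ), X.IsReducedForm μ lam R P Q →
          Upkeep.Balance lam ρ P Q ∧ ∀ᵐ θ ∂lam, Upkeep.SimplexBounds R P Q θ)) ∧
    (∀ (R P : Θ → ℝ) (Q : ℝ), Measurable R → Measurable P →
      (∀ θ, R θ ∈ Set.Icc (0 : ℝ) 1) → (∀ θ, P θ ∈ Set.Icc (0 : ℝ) 1) → Q ∈ Set.Icc (0 : ℝ) 1 →
      Upkeep.Balance lam ρ P Q → (∀ θ, Upkeep.SimplexBounds R P Q θ) →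
        ∃ σ : Upkeep.MarkovianMechanism Θ,
          (∃ (Ω : Type u) (_ : MeasurableSpace Ω) (μ : MeasureTheory.Measure Ω)
              (_ : MeasureTheory.IsProbabilityMeasure μ) (X : Upkeep.SystemProcess Ω Θ),
            X.IsStationary μ ∧ X.IsAdmissible μ lam ν ∧ σ.IsCompatible X μ lam ∧
              X.IsReducedForm μ lam R P Q) ∧
          (∀ (Ω : Type v) [MeasurableSpace Ω] (μ : MeasureTheory.Measure Ω)
              [MeasureTheory.IsProbabilityMeasure μ] (X : Upkeep.SystemProcess Ω Θ),
            X.IsStationary μ → X.IsAdmissible μ lam ν → σ.IsCompatible X μ lam →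
              X.IsReducedForm μ lam R P Q)) := by
  refine ⟨fun Ω _ μ _ X hst hX =>
    ⟨Upkeep.SystemProcess.IsStationary.exists_isReducedForm hst hX hρ hν_int hν_mean,
      fun R P Q h => Upkeep.SystemProcess.IsReducedForm.balance_and_bounds hst hX hρ hν_int hν_mean h⟩,
    fun R P Q hR hP hR1 hP1 hQ hbal h => ?_⟩
  refine ⟨Upkeep.inducingMechanism hR hP (fun θ => (hR1 θ).1) (fun θ => (hP1 θ).1) hQ.1 hQ.2 h,
    ?_, fun Ω _ μ _ X hst hX hcomp =>
      Upkeep.isReducedForm_of_isCompatible hρ hν_int hν_mean hR hP hR1 hP1 hQ hbal h hst hX hcomp⟩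
  obtain ⟨Ω, mΩ, μ, hμ, X, hst, hX, hcomp⟩ := Upkeep.MarkovianMechanism.exists_process
    (Upkeep.inducingMechanism hR hP (fun θ => (hR1 θ).1) (fun θ => (hP1 θ).1) hQ.1 hQ.2 h)
    lam ν hν_pos hν_int
  exact ⟨Ω, mΩ, μ, hμ, X, hst, hX, hcomp, Upkeep.isReducedForm_of_isCompatible hρ hν_int hν_mean
    hR hP hR1 hP1 hQ hbal h hst hX hcomp⟩
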